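/- **Model.** At most $k$ anonymous stations share a channel, in synchronous rounds. All are initially asleep. At the start of each round an adaptive adversary chooses which sleeping stations to activate in that round, knowing the algorithm and the whole computation history (including all past random choices) but no future randomness. An activated station follows the protocol from the next round on. It does not know $k$, has no global clock, and in each round either transmits or listens. A transmission is successful iff it is the only one in its round; then its sender gets an acknowledgement and all active listeners receive the message. Otherwise nothing is perceived by anyone (no collision detection). A message is the station's packet or one of two one-bit control messages: $\langle$D mode$\rangle$ and $\langle$is there anybody out there?$\rangle$. **Protocol AdaptiveNoK (with constant $q>0$).** *Waiting.* An activated station listens in consecutive blocks of $4$ rounds. As soon as it receives $\langle$is there anybody out there?$\rangle$, or at the end of a block in which it received no message, it enters leader election mode; otherwise it goes on with another block. *Leader election mode (DecreaseSlowly).* In the $i$-th round ($i=0,1,2,\dots$) after entering this mode, the station transmits its packet with probability $q/(2q+i)$, independently. At the first successful transmission its sender becomes the leader, all other stations in this mode become followers, and all of them enter dissemination mode with a common round counter $tc$, equal to $0$ in that round. *Dissemination mode.* In rounds with $tc$ odd, the followers execute the successive rounds of SUniform, and each follower switches off upon its first successful transmission of its packet. In rounds with $tc=2^x$, $x\ge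 2$ an integer, the leader and all followers still on transmit $\langle$is there anybody out there?$\rangle$; if the leader gets an acknowledgement it switches off. In all other even rounds only the leader transmits, and it sends $\langle$D mode$\rangle$. *SUniform (back-on/back-off).* For $j=1,2,3,\dots$, run through consecutive contention windows of $2^j,2^{j-1},\dots,2,1$ rounds; in each window the station transmits its packet in exactly one round, chosen uniformly at random, independently of everything else. **Theorem 6.3.** For every $\eta>0$ there are $q>0$ and $C>0$ such that for every $k\ge1$ and every strategy of the adaptive adversary on $k$ stations, AdaptiveNoK with constant $q$ satisfies the following with probability at least $1-1/k^{\eta}$: every activated station transmits its packet successfully at most $Ck$ rounds after its activation, and eventually switches off. That is, AdaptiveNoK solves contention resolution with latency $O(k)$ with high probability, even against an adaptive adversary. -/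

import Mathlib

open MeasureTheory

namespace AdaptiveNoK

/-- What a station can put on the channel: its data packet, or one of the two values of the one-bit
control message. `dMode` is the control message "D mode" (bit 0) and `anybody` is the control message
"is there anybody out there?" (bit 1). -/
inductive Message
  | packet
  | dMode
  | anybody

/-- What a station perceives at the end of a round. There is no collision detection: `nothing` is
perceived by a listener both on a silent channel and on a collision, and by a transmitter whose
transmission collided. -/
inductive Feedback
  | nothing
  | ack
  | received (m : Message)

/-! ### The synchronized back-on/back-off protocol `SUniform`

The outer loop runs through the window sizes `2 ^ top` for `top = 1, 2, 3, ...`. For each of them, the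
inner loop runs through the windows of sizes `2 ^ top, 2 ^ (top - 1), ..., 2, 1`. In each window, the
station transmits in exactly one slot, chosen uniformly at random. -/

/-- The program counter of `SUniform`: the current slot is slot number `pos` of a window of size
`2 ^ cur`, within step `top` of the outer loop, and `slot` is the slot chosen in the current window
(meaningful once it has been drawn, at slot `0` of the window). -/
structure Sawtooth where
  top : ℕ
  cur : ℕ
  pos : ℕ
  slot : ℕ

/-- The start of `SUniform`. -/
def Sawtooth.init : Sawtooth := ⟨1, 1, 0, 0⟩

/-- At the beginning of a window, use a uniform coin `x` of `[0, 1]` to choose the slot of the window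
uniformly (`x = 1` has probability zero). -/
noncomputable def Sawtooth.draw (b : Sawtooth) (x : unitInterval) : Sawtooth :=
  if b.pos = 0 then { b with slot := ⌊(2 : ℝ) ^ b.cur * (x : ℝ)⌋₊ } else b

/-- Move to the next slot: within the window, or else to the window of half the size, or else, after a
window of size `1`, to the next step of the outer loop. -/
def Sawtooth.next (b : Sawtooth) : Sawtooth :=
  if b.pos + 1 < 2 ^ b.cur then { b with pos := b.pos + 1 }
  else if 0 < b.cur then { b with cur := b.cur - 1, pos := 0 }
  else { b with top := b.top + 1, cur := b.top + 1, pos := 0 }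

/-! ### The protocol of a single station -/

/-- The local state of a station.
* `asleep`: not yet activated.
* `listening n heard`: in the initial waiting loop; `n` rounds of the current block of four listening
  rounds are over, and `heard` tells whether a message was received in them.
* `electing i`: in leader election mode, executing `DecreaseSlowly` with loop counter `i`.
* `leader tc`: in dissemination mode, as the leader; `tc` is the number of the coming round, counted
  from the round of the election, which has number `0`.
* `follower tc b`: in dissemination mode, not the leader; `b` is the program counter of `SUniform`.
* `off`: permanently switched off. -/
inductive State
  | asleep
  | listening (n : ℕ) (heard : Bool)
  | electing (i : ℕ)
  | leader (tc : ℕ)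
  | follower (tc : ℕ) (b : Sawtooth)
  | off

/-- The rounds of the dissemination mode in which the leader and all followers transmit `anybody`. -/
def IsWhite (tc : ℕ) : Prop := ∃ e : ℕ, 1 < e ∧ tc = 2 ^ e

open Classical in
/-- What a station in state `s` with coin `x` transmits in the coming round (`none`: it does not
transmit). `q` is the constant of `DecreaseSlowly`. -/
noncomputable def act (q : ℝ) (s : State) (x : unitInterval) : Option Message :=
  match s with
  | .asleep => none
  | .listening _ _ => none
  | .electing i => if (x : ℝ) < q * (1 / (2 * q + i)) then some .packet else none
  | .leader tc =>
      if Odd tc then none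
      else if IsWhite tc then some .anybody
      else some .dMode
  | .follower tc b =>
      if Odd tc then
        if (b.draw x).pos = (b.draw x).slot then some .packet else none
      else if IsWhite tc then some .anybody
      else none
  | .off => none

open Classical in
/-- The state of a station after a round that it entered in state `s`, in which it had coin `x`, and
at whose end it perceived `fb`. -/
noncomputable def update (s : State) (x : unitInterval) (fb : Feedback) : State :=
  match s with
  | .asleep => .asleep
  | .listening n heard =>
      match fb with
      -- the dissemination mode is over: join the leader election
      | .received .anybody => .electing 0
      | .received _ => if n + 1 < 4 then .listening (n + 1) true else .listening 0 false
      | _ =>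
        if n + 1 < 4 then .listening (n + 1) heard
        else if heard then .listening 0 false
        else .electing 0
  | .electing i =>
      match fb with
      | .ack => .leader 1
      | .received _ => .follower 1 Sawtooth.init
      | .nothing => .electing (i + 1)
  | .leader tc =>
      match fb with
      | .ack => if IsWhite tc then .off else .leader (tc + 1)
      | _ => .leader (tc + 1)
  | .follower tc b =>
      if Odd tc then
        match fb with
        | .ack => .off
        | _ => .follower (tc + 1) (b.draw x).next
      else .follower (tc + 1) b
  | .off => .off

/-! ### The channel, the adversary, and the execution -/

/-- The feedback of the channel to station `u` when station `v` transmits `sent v`: a transmission is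
successful if and only if it is the only one in its round. -/
def feedback {k : ℕ} (sent : Fin k → Option Message) (u : Fin k) : Feedback :=
  match (List.finRange k).filterMap sent with
  | [m] => if (sent u).isSome then .ack else .received m
  | _ => .nothing

/-- The record of a completed round: the states of the stations at its beginning, and what they
transmitted in it. -/
structure RoundRecord (k : ℕ) where
  state : Fin k → State
  sent : Fin k → Option Message

/-- A computation history: the records of all completed rounds, in chronological order, and the
current states of all stations. -/
structure History (k : ℕ) where
  past : List (RoundRecord k)
  now : Fin k → State

/-- A strategy of an adaptive adversary: given the whole computation history, which includes all
random choices made so far and no future ones, it names the stations to be activated in the current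
round (stations that are not asleep are not affected). -/
abbrev Adversary (k : ℕ) : Type := History k → Finset (Fin k)

/-- The coins of an execution: one for every round and every station. -/
abbrev Coins (k : ℕ) : Type := ℕ → Fin k → unitInterval

/-- All coins are independent and uniform on `[0, 1]`. -/
noncomputable def coinMeasure (k : ℕ) : Measure (Coins k) :=
  Measure.infinitePi fun _ : ℕ => Measure.pi fun _ : Fin k => (volume : Measure unitInterval)

/-- What the stations transmit in a round. -/
noncomputable def transmissions {k : ℕ} (q : ℝ) (s : Fin k → State) (x : Fin k → unitInterval) :
    Fin k → Option Message :=
  fun u => act q (s u) (x u)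

open Classical in
/-- The states after a round with coins `x` in which the adversary activates the stations of `wake`.
The round of its activation is round `0` of the local clock of a station; it starts to take part
in the next round. -/
noncomputable def nextStates {k : ℕ} (q : ℝ) (s : Fin k → State) (wake : Finset (Fin k))
    (x : Fin k → unitInterval) : Fin k → State :=
  fun u =>
    if s u = State.asleep ∧ u ∈ wake then State.listening 0 false
    else update (s u) (x u) (feedback (transmissions q s x) u)

/-- The history at the beginning of each round of the execution with adversary `adv` and coins `ω`.
At the beginning all stations are asleep. -/
noncomputable def run {k : ℕ} (q : ℝ) (adv : Adversary k) (ω : Coins k) : ℕ → History k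
  | 0 => ⟨[], fun _ => State.asleep⟩
  | r + 1 =>
      let h := run q adv ω r
      ⟨h.past ++ [⟨h.now, transmissions q h.now (ω r)⟩], nextStates q h.now (adv h) (ω r)⟩

/-- Station `u` is activated in round `r`. -/
def ActivatedAt {k : ℕ} (q : ℝ) (adv : Adversary k) (ω : Coins k) (u : Fin k) (r : ℕ) : Prop :=
  (run q adv ω r).now u = State.asleep ∧ u ∈ adv (run q adv ω r)

/-- Station `u` transmits its packet in round `r`, and no other station transmits in round `r`. -/
def DeliversAt {k : ℕ} (q : ℝ) (adv : Adversary k) (ω : Coins k) (u : Fin k) (r : ℕ) : Prop :=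
  transmissions q (run q adv ω r).now (ω r) u = some Message.packet ∧
    ∀ v, v ≠ u → transmissions q (run q adv ω r).now (ω r) v = none

/-- The contention is resolved with latency at most `L`: every station that is activated transmits its
packet successfully at most `L` rounds after its activation, and it eventually switches off. -/
def ResolvedWithLatency {k : ℕ} (q : ℝ) (adv : Adversary k) (ω : Coins k) (L : ℝ) : Prop :=
  ∀ (u : Fin k) (r : ℕ), ActivatedAt q adv ω u r →
    (∃ d : ℕ, (d : ℝ) ≤ L ∧ DeliversAt q adv ω u (r + d)) ∧
    ∃ t : ℕ, (run q adv ω t).now u = State.off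

end AdaptiveNoK

namespace AdaptiveNoK

/-! ### The channel -/

/-! A deterministic part is separated from a probabilistic one. Every reachable configuration is
either an election or a dissemination mode with one leader and synchronised followers (`Regular`).
It is overdue when an election counter has reached `A` or a follower has passed the first `J` steps
of `SUniform`. If this never happens, all followers have left before round `2 ^ (J + 3)` of their
mode, so the leader is alone in that white round at the latest. A station then waits for at most one
old mode, one election and one new mode (`resolvedWithLatency_of_not_overdue`).

The probability that some station ever becomes overdue is bounded by a potential of the current
states. It starts small, is at least `1` in overdue configurations, and does not increase in
expectation whichever stations are woken (`lintegral_potential_le`). A maximal inequality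
(`measure_exists_run_le`) does the rest, and adaptivity costs nothing.

Election term: when the transmission probabilities add up to `s ≥ 0`, each being at most `1 / 2`, a
round succeeds with probability at least `s * exp (-2 * s)`. The exponential of the sum of these
bounds over the past rounds compensates for the decreasing probability that the election is still
unfinished. Over linearly many rounds the sum is at least `Q * log k` for all arrival times
(`log_le_sum_successBound`). If many stations join early, the contention later is neither too low
nor, in most rounds, too high. If few do, it is at most `1` in most rounds, and the oldest station
alone contributes a multiple of `log k`.

Dissemination term: if `X` of `n` stations collide in a window of size `w`, the mean of `2 ^ X` is
at most `(1 + 3 * n / w) ^ n` (`lintegral_two_pow_card_collided_le`). In a sweep that starts with a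
large enough window, each halving of the window typically comes with a sixteenfold reduction of the
stations, until a birthday bound clears the rest. With `32 ^ L` of order `k`, a sweep fails with
probability at most `2 ^ (-L)`. A constant number of sweeps therefore gives any inverse power of `k`
in linear time.

Each mode uses up a station as its leader, so there are at most `k` modes; the corresponding union
bound is the `pendingCount` term of `potential`. -/

/-- Station `v` is the only one to transmit, and it transmits `m`. -/
def Solo {k : ℕ} (sent : Fin k → Option Message) (v : Fin k) (m : Message) : Prop :=
  sent v = some m ∧ ∀ w, w ≠ v → sent w = none

theorem filterMap_eq_singleton_of_unique {α β : Type*} {f : α → Option β} {v : α} {m : β}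
    (hv : f v = some m) :
    ∀ {l : List α}, l.Nodup → v ∈ l → (∀ w ∈ l, w ≠ v → f w = none) → l.filterMap f = [m] := by
  intro l
  induction l with
  | nil => intro _ h; simp at h
  | cons a l ih =>
    intro hn hmem hnone
    rw [List.nodup_cons] at hn
    by_cases hav : a = v
    · subst hav
      rw [List.filterMap_cons, hv]
      have : l.filterMap f = [] := by
        rw [List.filterMap_eq_nil_iff]
        intro w hw
        exact hnone w (List.mem_cons_of_mem _ hw) (fun h => hn.1 (h ▸ hw))
      simp [this]
    · rw [List.filterMap_cons, hnone a List.mem_cons_self hav]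
      exact ih hn.2 ((List.mem_cons.1 hmem).resolve_left (fun h => hav h.symm))
        (fun w hw => hnone w (List.mem_cons_of_mem _ hw))

theorem exists_solo_of_filterMap_eq {k : ℕ} {sent : Fin k → Option Message} {m : Message}
    (h : (List.finRange k).filterMap sent = [m]) : ∃ v, Solo sent v m := by
  obtain ⟨l₁, a, l₂, hl, h₁, ha, h₂⟩ := List.filterMap_eq_cons_iff.1 h
  rw [List.filterMap_eq_nil_iff] at h₂
  refine ⟨a, ha, fun w hw => ?_⟩
  have hmem : w ∈ l₁ ++ a :: l₂ := hl ▸ List.mem_finRange w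
  rcases List.mem_append.1 hmem with h' | h'
  · exact h₁ w h'
  · exact h₂ w ((List.mem_cons.1 h').resolve_left hw)

theorem Solo.filterMap_eq {k : ℕ} {sent : Fin k → Option Message} {v : Fin k} {m : Message}
    (h : Solo sent v m) : (List.finRange k).filterMap sent = [m] :=
  filterMap_eq_singleton_of_unique h.1 (List.nodup_finRange k) (List.mem_finRange v)
    (fun w _ => h.2 w)

theorem Solo.feedback_self {k : ℕ} {sent : Fin k → Option Message} {v : Fin k} {m : Message}
    (h : Solo sent v m) : feedback sent v = .ack := by
  unfold feedback
  rw [h.filterMap_eq]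
  simp [h.1]

theorem Solo.feedback_of_ne {k : ℕ} {sent : Fin k → Option Message} {u v : Fin k} {m : Message}
    (h : Solo sent v m) (hu : u ≠ v) : feedback sent u = .received m := by
  unfold feedback
  rw [h.filterMap_eq]
  simp [h.2 u hu]

theorem feedback_of_not_solo {k : ℕ} {sent : Fin k → Option Message}
    (h : ∀ v m, ¬ Solo sent v m) (u : Fin k) : feedback sent u = .nothing := by
  unfold feedback
  split
  · rename_i m hm
    obtain ⟨v, hv⟩ := exists_solo_of_filterMap_eq hm
    exact absurd hv (h v m)
  · rfl

/-! ### Waking stations -/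

theorem nextStates_of_asleep_mem {k : ℕ} {q : ℝ} {s : Fin k → State} {wake : Finset (Fin k)}
    {x : Fin k → unitInterval} {u : Fin k} (h : s u = .asleep) (hu : u ∈ wake) :
    nextStates q s wake x u = .listening 0 false := by
  simp [nextStates, h, hu]

theorem nextStates_of_asleep {k : ℕ} (q : ℝ) {s : Fin k → State} (wake : Finset (Fin k))
    (x : Fin k → unitInterval) {u : Fin k} (h : s u = .asleep) :
    nextStates q s wake x u = .listening 0 false ∨ nextStates q s wake x u = .asleep := by
  by_cases hu : u ∈ wake
  · exact .inl (nextStates_of_asleep_mem h hu)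
  · right; simp [nextStates, h, hu, update]

theorem nextStates_of_ne_asleep {k : ℕ} (q : ℝ) {s : Fin k → State} (wake : Finset (Fin k))
    (x : Fin k → unitInterval) {u : Fin k} (h : s u ≠ .asleep) :
    nextStates q s wake x u = update (s u) (x u) (feedback (transmissions q s x) u) := by
  simp [nextStates, h]

theorem nextStates_of_off {k : ℕ} (q : ℝ) {s : Fin k → State} (wake : Finset (Fin k))
    (x : Fin k → unitInterval) {u : Fin k} (h : s u = .off) :
    nextStates q s wake x u = .off := by
  rw [nextStates_of_ne_asleep _ _ _ (by simp [h]), h]; rfl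

/-! ### The two phases of an execution -/

/-- No station is in dissemination mode, and the listening stations have not heard any message. -/
def Electing {k : ℕ} (s : Fin k → State) : Prop :=
  ∀ u, s u = .asleep ∨ s u = .off ∨ (∃ n, n < 4 ∧ s u = .listening n false) ∨
    ∃ i, s u = .electing i

/-- Station `l` is the leader, in round `tc` of the dissemination mode. All followers are in the same
slot of `SUniform`, and a listening station that has not heard a message yet will be listening in the
next round whose number is `2` modulo `4`. -/
structure Disseminating {k : ℕ} (s : Fin k → State) (l : Fin k) (tc top cur pos : ℕ) : Prop where
  leader : s l = .leader tc
  -- So far `tc / 2` slots of `SUniform` are over. The steps before `top` take `2 ^ (top + 1) - top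
  -- - 3` slots, and the larger windows of step `top` take `2 ^ (top + 1) - 2 ^ (cur + 1)`; the
  -- equation is their sum plus `pos`, without subtractions.
  clock : tc / 2 + 2 ^ (cur + 1) + top + 3 = 2 ^ (top + 2) + pos
  pos_lt : pos < 2 ^ cur
  cur_le : cur ≤ top
  others : ∀ u, u ≠ l → s u = .asleep ∨ s u = .off ∨ (∃ n, n < 4 ∧ s u = .listening n true) ∨
    (∃ n, n + (6 - tc % 4) % 4 < 4 ∧ s u = .listening n false) ∨
    ∃ slot, s u = .follower tc ⟨top, cur, pos, slot⟩

/-- The slot used in the current window: at the start of a window a new one is drawn. -/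
noncomputable def currentSlot (cur pos slot : ℕ) (x : unitInterval) : ℕ :=
  if pos = 0 then ⌊(2 : ℝ) ^ cur * (x : ℝ)⌋₊ else slot

theorem draw_mk (top cur pos slot : ℕ) (x : unitInterval) :
    (⟨top, cur, pos, slot⟩ : Sawtooth).draw x = ⟨top, cur, pos, currentSlot cur pos slot x⟩ := by
  unfold Sawtooth.draw currentSlot
  split_ifs <;> simp_all

theorem next_mk (top cur pos slot : ℕ) :
    (⟨top, cur, pos, slot⟩ : Sawtooth).next =
      if pos + 1 < 2 ^ cur then ⟨top, cur, pos + 1, slot⟩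
      else if 0 < cur then ⟨top, cur - 1, 0, slot⟩ else ⟨top + 1, top + 1, 0, slot⟩ := by
  unfold Sawtooth.next
  rfl

/-- Hence a round with number `2` modulo `4` is never white, and every block of four rounds contains
a `dMode` of the leader. -/
theorem IsWhite.four_dvd {tc : ℕ} (h : IsWhite tc) : 4 ∣ tc := by
  obtain ⟨e, he, rfl⟩ := h
  exact pow_dvd_pow 2 (show 2 ≤ e by omega)

theorem IsWhite.not_odd {tc : ℕ} (h : IsWhite tc) : ¬ Odd tc := by
  have := h.four_dvd
  rw [Nat.odd_iff]; omega

/-! #### Transmissions -/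

theorem Electing.act_eq {k : ℕ} {q : ℝ} {s : Fin k → State} (h : Electing s)
    (x : Fin k → unitInterval) (u : Fin k) :
    transmissions q s x u = none ∨
      ((∃ i, s u = .electing i) ∧ transmissions q s x u = some .packet) := by
  unfold transmissions
  rcases h u with h | h | ⟨n, _, h⟩ | ⟨i, h⟩ <;> simp only [h, act] <;> try simp
  exact (lt_or_ge _ _).symm

theorem Electing.solo {k : ℕ} {q : ℝ} {s : Fin k → State} (h : Electing s)
    {x : Fin k → unitInterval} {v : Fin k} {m : Message} (hv : Solo (transmissions q s x) v m) :
    m = .packet ∧ ∃ i, s v = .electing i := by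
  rcases h.act_eq x v (q := q) with h' | ⟨hi, h'⟩
  · simp [hv.1] at h'
  · rw [hv.1] at h'
    exact ⟨by simpa using h', hi⟩

/-! #### The steps of the election -/

theorem Electing.step_of_not_solo {k : ℕ} {q : ℝ} {s : Fin k → State} (h : Electing s)
    {x : Fin k → unitInterval} (hx : ∀ v m, ¬ Solo (transmissions q s x) v m)
    (wake : Finset (Fin k)) (u : Fin k) :
    (s u = .asleep ∧ (nextStates q s wake x u = .asleep ∨
        nextStates q s wake x u = .listening 0 false)) ∨
      (s u = .off ∧ nextStates q s wake x u = .off) ∨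
      (∃ n, n < 3 ∧ s u = .listening n false ∧
        nextStates q s wake x u = .listening (n + 1) false) ∨
      (s u = .listening 3 false ∧ nextStates q s wake x u = .electing 0) ∨
      ∃ i, s u = .electing i ∧ nextStates q s wake x u = .electing (i + 1) := by
  have hf := feedback_of_not_solo hx u
  rcases h u with h | h | ⟨n, hn, h⟩ | ⟨i, h⟩
  · exact .inl ⟨h, (nextStates_of_asleep q wake x h).symm⟩
  · exact .inr (.inl ⟨h, nextStates_of_off q wake x h⟩)
  · have hs := nextStates_of_ne_asleep q wake x (s := s) (u := u) (by simp [h])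
    rw [hs, hf, h]
    rcases Nat.lt_or_ge n 3 with h3 | h3
    · right; right; left
      exact ⟨n, h3, rfl, by simp [update, show n + 1 < 4 by omega]⟩
    · obtain rfl : n = 3 := by omega
      right; right; right; left
      exact ⟨rfl, by simp [update]⟩
  · have hs := nextStates_of_ne_asleep q wake x (s := s) (u := u) (by simp [h])
    rw [hs, hf, h]
    right; right; right; right
    exact ⟨i, rfl, by simp [update]⟩

theorem Electing.electing_of_not_solo {k : ℕ} {q : ℝ} {s : Fin k → State} (h : Electing s)
    {x : Fin k → unitInterval} (hx : ∀ v m, ¬ Solo (transmissions q s x) v m)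
    (wake : Finset (Fin k)) : Electing (nextStates q s wake x) := by
  intro u
  rcases h.step_of_not_solo hx wake u with ⟨_, h | h⟩ | ⟨_, h⟩ | ⟨n, hn, _, h⟩ | ⟨_, h⟩ | ⟨i, _, h⟩
  · exact .inl h
  · exact .inr (.inr (.inl ⟨0, by norm_num, h⟩))
  · exact .inr (.inl h)
  · exact .inr (.inr (.inl ⟨n + 1, by omega, h⟩))
  · exact .inr (.inr (.inr ⟨0, h⟩))
  · exact .inr (.inr (.inr ⟨i + 1, h⟩))

theorem Electing.step_of_solo {k : ℕ} {q : ℝ} {s : Fin k → State} (h : Electing s)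
    {x : Fin k → unitInterval} {v : Fin k} {m : Message} (hv : Solo (transmissions q s x) v m)
    (wake : Finset (Fin k)) {u : Fin k} (hu : u ≠ v) :
    (s u = .asleep ∧ (nextStates q s wake x u = .asleep ∨
        nextStates q s wake x u = .listening 0 false)) ∨
      (s u = .off ∧ nextStates q s wake x u = .off) ∨
      (∃ n, n < 3 ∧ s u = .listening n false ∧
        nextStates q s wake x u = .listening (n + 1) true) ∨
      (s u = .listening 3 false ∧ nextStates q s wake x u = .listening 0 false) ∨
      ∃ i, s u = .electing i ∧ nextStates q s wake x u = .follower 1 Sawtooth.init := by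
  obtain ⟨rfl, -⟩ := h.solo hv
  have hf := hv.feedback_of_ne hu
  rcases h u with h | h | ⟨n, hn, h⟩ | ⟨i, h⟩
  · exact .inl ⟨h, (nextStates_of_asleep q wake x h).symm⟩
  · exact .inr (.inl ⟨h, nextStates_of_off q wake x h⟩)
  · have hs := nextStates_of_ne_asleep q wake x (s := s) (u := u) (by simp [h])
    rw [hs, hf, h]
    rcases Nat.lt_or_ge n 3 with h3 | h3
    · right; right; left
      exact ⟨n, h3, rfl, by simp [update, show n + 1 < 4 by omega]⟩
    · obtain rfl : n = 3 := by omega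
      right; right; right; left
      exact ⟨rfl, by simp [update]⟩
  · have hs := nextStates_of_ne_asleep q wake x (s := s) (u := u) (by simp [h])
    rw [hs, hf, h]
    right; right; right; right
    exact ⟨i, rfl, by simp [update]⟩

theorem Electing.leader_of_solo {k : ℕ} {q : ℝ} {s : Fin k → State} (h : Electing s)
    {x : Fin k → unitInterval} {v : Fin k} {m : Message} (hv : Solo (transmissions q s x) v m)
    (wake : Finset (Fin k)) : nextStates q s wake x v = .leader 1 := by
  obtain ⟨-, i, hi⟩ := h.solo hv
  rw [nextStates_of_ne_asleep q wake x (by simp [hi]), hv.feedback_self, hi]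
  rfl

/-- All participants perceive the success in the same round, so the followers start `SUniform` in
step. Round number `2` comes soon enough for every listener that starts a new block. -/
theorem Electing.disseminating_of_solo {k : ℕ} {q : ℝ} {s : Fin k → State} (h : Electing s)
    {x : Fin k → unitInterval} {v : Fin k} {m : Message} (hv : Solo (transmissions q s x) v m)
    (wake : Finset (Fin k)) : Disseminating (nextStates q s wake x) v 1 1 1 0 where
  leader := h.leader_of_solo hv wake
  clock := by norm_num
  pos_lt := by norm_num
  cur_le := le_rfl
  others := by
    intro u hu
    rcases h.step_of_solo hv wake hu with ⟨_, h | h⟩ | ⟨_, h⟩ | ⟨n, hn, _, h⟩ | ⟨_, h⟩ | ⟨i, _, h⟩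
    · exact .inl h
    · exact .inr (.inr (.inr (.inl ⟨0, by norm_num, h⟩)))
    · exact .inr (.inl h)
    · exact .inr (.inr (.inl ⟨n + 1, by omega, h⟩))
    · exact .inr (.inr (.inr (.inl ⟨0, by norm_num, h⟩)))
    · exact .inr (.inr (.inr (.inr ⟨0, h⟩)))

/-! #### The steps of the dissemination -/

/-- What happens to a listening station of the dissemination mode in a round that does not end it. -/
theorem update_listening {n tc : ℕ} {heard : Bool} {x : unitInterval} {fb : Feedback}
    (hn : n < 4) (hd : heard = false → n + (6 - tc % 4) % 4 < 4)
    (hne : fb ≠ .received .anybody) (h2 : tc % 4 = 2 → fb = .received .dMode) :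
    (∃ n', n' < 4 ∧ update (.listening n heard) x fb = .listening n' true) ∨
      ∃ n', n' + (6 - (tc + 1) % 4) % 4 < 4 ∧
        update (.listening n heard) x fb = .listening n' false := by
  -- A new block of four rounds contains a round with number `2` modulo `4`, whenever it starts.
  have h0 : 0 + (6 - (tc + 1) % 4) % 4 < 4 := by omega
  have hrec : ∀ m, m ≠ Message.anybody → fb = .received m →
      update (.listening n heard) x fb =
        if n + 1 < 4 then .listening (n + 1) true else .listening 0 false := by
    rintro m hm rfl
    cases m <;> first | rfl | exact absurd rfl hm
  by_cases hr : ∃ m, m ≠ Message.anybody ∧ fb = .received m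
  · obtain ⟨m, hm, hfb⟩ := hr
    rw [hrec m hm hfb]
    split_ifs with h
    · exact .inl ⟨n + 1, h, rfl⟩
    · exact .inr ⟨0, h0, rfl⟩
  · have htc : tc % 4 ≠ 2 := fun h => hr ⟨.dMode, by simp, h2 h⟩
    have hu : update (.listening n heard) x fb =
        if n + 1 < 4 then .listening (n + 1) heard
        else if heard then .listening 0 false else .electing 0 := by
      cases fb with
      | nothing => rfl
      | ack => rfl
      | received m =>
        exact absurd ⟨m, fun h => hne (by rw [h]), rfl⟩ hr
    rw [hu]
    split_ifs with h h'
    · cases heard with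
      | true => exact .inl ⟨n + 1, h, rfl⟩
      | false =>
        have := hd rfl
        exact .inr ⟨n + 1, by omega, rfl⟩
    · exact .inr ⟨0, h0, rfl⟩
    -- With `n = 3`, the invariant forces the current round number to be `2` modulo `4`, contrary to
    -- `htc`; so no listener joins an election during a mode.
    · have := hd (by simpa using h')
      omega

/-! #### Transmissions in dissemination mode -/

section
variable {k : ℕ} {q : ℝ} {s : Fin k → State} {l : Fin k} {tc top cur pos : ℕ}

theorem Disseminating.transmissions_leader (h : Disseminating s l tc top cur pos)
    (x : Fin k → unitInterval) :
    (Odd tc → transmissions q s x l = none) ∧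
      (IsWhite tc → transmissions q s x l = some .anybody) ∧
      (¬ Odd tc → ¬ IsWhite tc → transmissions q s x l = some .dMode) := by
  unfold transmissions
  rw [h.leader]
  refine ⟨fun ho => by simp [act, ho], fun hw => by simp [act, hw, hw.not_odd], fun ho hw => ?_⟩
  simp [act, ho, hw]

theorem transmissions_follower (x : Fin k → unitInterval) {u : Fin k} {slot : ℕ}
    (hu : s u = .follower tc ⟨top, cur, pos, slot⟩) :
    (Odd tc → transmissions q s x u =
        if pos = currentSlot cur pos slot (x u) then some .packet else none) ∧
      (IsWhite tc → transmissions q s x u = some .anybody) ∧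
      (¬ Odd tc → ¬ IsWhite tc → transmissions q s x u = none) := by
  unfold transmissions
  rw [hu]
  refine ⟨fun ho => by simp [act, ho, draw_mk], fun hw => by simp [act, hw, hw.not_odd],
    fun ho hw => ?_⟩
  simp [act, ho, hw]

/-- Apart from the leader, only followers transmit. -/
theorem Disseminating.transmissions_of_ne (h : Disseminating s l tc top cur pos)
    (x : Fin k → unitInterval) {u : Fin k} (hu : u ≠ l) :
    transmissions q s x u = none ∨ ∃ slot, s u = .follower tc ⟨top, cur, pos, slot⟩ := by
  rcases h.others u hu with h | h | ⟨n, _, h⟩ | ⟨n, _, h⟩ | h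
  · left; simp [transmissions, h, act]
  · left; simp [transmissions, h, act]
  · left; simp [transmissions, h, act]
  · left; simp [transmissions, h, act]
  · exact .inr h

theorem Disseminating.solo_of_odd (h : Disseminating s l tc top cur pos) (ho : Odd tc)
    {x : Fin k → unitInterval} {v : Fin k} {m : Message} (hv : Solo (transmissions q s x) v m) :
    v ≠ l ∧ m = .packet ∧ ∃ slot, s v = .follower tc ⟨top, cur, pos, slot⟩ ∧
      pos = currentSlot cur pos slot (x v) := by
  have hvl : v ≠ l := by
    rintro rfl
    have := hv.1
    rw [(h.transmissions_leader x).1 ho] at this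
    simp at this
  refine ⟨hvl, ?_⟩
  rcases h.transmissions_of_ne x hvl (q := q) with h' | ⟨slot, hs⟩
  · have := hv.1
    simp [h'] at this
  · have h' := hv.1
    rw [(transmissions_follower x hs).1 ho] at h'
    split_ifs at h' with hp
    exact ⟨by simpa using h'.symm, slot, hs, hp⟩

theorem Disseminating.solo_of_beacon (h : Disseminating s l tc top cur pos) (ho : ¬ Odd tc)
    (hw : ¬ IsWhite tc) (x : Fin k → unitInterval) : Solo (transmissions q s x) l .dMode := by
  refine ⟨(h.transmissions_leader x).2.2 ho hw, fun w hwl => ?_⟩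
  rcases h.transmissions_of_ne x hwl (q := q) with h' | ⟨slot, hs⟩
  · exact h'
  · exact (transmissions_follower x hs).2.2 ho hw

theorem Disseminating.solo_of_white (h : Disseminating s l tc top cur pos) (hw : IsWhite tc)
    (hF : ∀ u t b, s u ≠ .follower t b) (x : Fin k → unitInterval) :
    Solo (transmissions q s x) l .anybody := by
  refine ⟨(h.transmissions_leader x).2.1 hw, fun w hwl => ?_⟩
  rcases h.transmissions_of_ne x hwl (q := q) with h' | ⟨slot, hs⟩
  · exact h'
  · exact absurd hs (hF _ _ _)

/-- A remaining follower transmits together with the leader. Their collision hides the message from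
the listeners and denies the leader its acknowledgement, so the mode goes on. -/
theorem Disseminating.not_solo_of_white (h : Disseminating s l tc top cur pos) (hw : IsWhite tc)
    {u : Fin k} {t : ℕ} {b : Sawtooth} (hu : s u = .follower t b) (x : Fin k → unitInterval)
    (v : Fin k) (m : Message) : ¬ Solo (transmissions q s x) v m := by
  intro hv
  have hul : u ≠ l := by
    rintro rfl
    have := h.leader
    simp [hu] at this
  have h1 := (h.transmissions_leader x (q := q)).2.1 hw
  have h2 : transmissions q s x u = some .anybody := by
    rcases h.others u hul with h | h | ⟨n, _, h⟩ | ⟨n, _, h⟩ | ⟨slot, h⟩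
    · simp [hu] at h
    · simp [hu] at h
    · simp [hu] at h
    · simp [hu] at h
    · exact (transmissions_follower x h).2.1 hw
  by_cases hvl : l = v
  · have := hv.2 u (by rw [← hvl]; exact hul)
    simp [h2] at this
  · have := hv.2 l hvl
    simp [h1] at this

/-- The dissemination mode ends in the coming round. -/
def Ending {k : ℕ} (s : Fin k → State) (tc : ℕ) : Prop :=
  IsWhite tc ∧ ∀ u t b, s u ≠ .follower t b

theorem Disseminating.leader_step (h : Disseminating s l tc top cur pos) (he : ¬ Ending s tc)
    (x : Fin k → unitInterval) (wake : Finset (Fin k)) :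
    nextStates q s wake x l = .leader (tc + 1) := by
  rw [nextStates_of_ne_asleep q wake x (by simp [h.leader]), h.leader]
  by_cases hw : IsWhite tc
  · have : ∃ u t b, s u = .follower t b := by
      by_contra! hc
      exact he ⟨hw, hc⟩
    obtain ⟨u, t, b, hu⟩ := this
    rw [feedback_of_not_solo (h.not_solo_of_white hw hu x)]
    rfl
  · cases feedback (transmissions q s x) l <;> simp [update, hw]

/-- No station hears the message that ends the dissemination mode before it ends, and all listening
stations hear the leader in the rounds with number `2` modulo `4`. -/
theorem Disseminating.feedback_listener (h : Disseminating s l tc top cur pos)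
    (he : ¬ Ending s tc) (x : Fin k → unitInterval) {u : Fin k} (hu : u ≠ l) :
    feedback (transmissions q s x) u ≠ .received .anybody ∧
      (tc % 4 = 2 → feedback (transmissions q s x) u = .received .dMode) := by
  by_cases ho : Odd tc
  · refine ⟨fun hf => ?_, fun h2 => by rw [Nat.odd_iff] at ho; omega⟩
    by_cases hs : ∃ v m, Solo (transmissions q s x) v m
    · obtain ⟨v, m, hv⟩ := hs
      obtain ⟨-, rfl, -⟩ := h.solo_of_odd ho hv
      by_cases huv : u = v
      · rw [huv, hv.feedback_self] at hf; simp at hf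
      · rw [hv.feedback_of_ne huv] at hf; simp at hf
    · push Not at hs
      rw [feedback_of_not_solo hs] at hf; simp at hf
  by_cases hw : IsWhite tc
  · have : ∃ u t b, s u = .follower t b := by
      by_contra! hc
      exact he ⟨hw, hc⟩
    obtain ⟨v, t, b, hv⟩ := this
    rw [feedback_of_not_solo (h.not_solo_of_white hw hv x)]
    have := hw.four_dvd
    exact ⟨by simp, fun h => by omega⟩
  · rw [(h.solo_of_beacon ho hw x).feedback_of_ne hu]
    simp

open Classical in
theorem Disseminating.step_of_ne (h : Disseminating s l tc top cur pos)
    (he : ¬ Ending s tc) (x : Fin k → unitInterval) (wake : Finset (Fin k)) {u : Fin k}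
    (hu : u ≠ l) :
    (s u = .asleep ∧ (nextStates q s wake x u = .asleep ∨
        nextStates q s wake x u = .listening 0 false)) ∨
      (s u = .off ∧ nextStates q s wake x u = .off) ∨
      ((∃ n heard, s u = .listening n heard) ∧
        ((∃ n, n < 4 ∧ nextStates q s wake x u = .listening n true) ∨
          ∃ n, n + (6 - (tc + 1) % 4) % 4 < 4 ∧ nextStates q s wake x u = .listening n false)) ∨
      ∃ slot, s u = .follower tc ⟨top, cur, pos, slot⟩ ∧
        nextStates q s wake x u =
          if Odd tc then
            if (∃ m, Solo (transmissions q s x) u m) then .off else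
              .follower (tc + 1) (Sawtooth.next ⟨top, cur, pos, currentSlot cur pos slot (x u)⟩)
          else .follower (tc + 1) ⟨top, cur, pos, slot⟩ := by
  have hf := h.feedback_listener he x hu (q := q)
  rcases h.others u hu with h' | h' | ⟨n, hn, h'⟩ | ⟨n, hn, h'⟩ | ⟨slot, h'⟩
  · exact .inl ⟨h', (nextStates_of_asleep q wake x h').symm⟩
  · exact .inr (.inl ⟨h', nextStates_of_off q wake x h'⟩)
  · have hs := nextStates_of_ne_asleep q wake x (s := s) (u := u) (by simp [h'])
    right; right; left
    refine ⟨⟨n, true, h'⟩, ?_⟩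
    rw [hs, h']
    exact update_listening hn (by simp) hf.1 hf.2
  · have hs := nextStates_of_ne_asleep q wake x (s := s) (u := u) (by simp [h'])
    right; right; left
    refine ⟨⟨n, false, h'⟩, ?_⟩
    rw [hs, h']
    exact update_listening (by omega) (fun _ => hn) hf.1 hf.2
  · have hs := nextStates_of_ne_asleep q wake x (s := s) (u := u) (by simp [h'])
    right; right; right
    refine ⟨slot, h', ?_⟩
    rw [hs, h']
    by_cases ho : Odd tc
    · rw [if_pos ho]
      by_cases hsolo : ∃ m, Solo (transmissions q s x) u m
      · obtain ⟨m, hm⟩ := hsolo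
        rw [if_pos ⟨m, hm⟩, hm.feedback_self]
        simp [update, ho]
      · rw [if_neg hsolo]
        have : feedback (transmissions q s x) u ≠ .ack := by
          by_cases hs : ∃ v m, Solo (transmissions q s x) v m
          · obtain ⟨v, m, hv⟩ := hs
            rw [hv.feedback_of_ne (fun (huv : u = v) => hsolo ⟨m, by rw [huv]; exact hv⟩)]
            simp
          · push Not at hs
            rw [feedback_of_not_solo hs]; simp
        cases hfb : feedback (transmissions q s x) u <;> simp_all [update, draw_mk]
    · rw [if_neg ho]
      simp [update, ho]

theorem Disseminating.disseminating_of_even (h : Disseminating s l tc top cur pos)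
    (he : ¬ Ending s tc) (ho : ¬ Odd tc) (x : Fin k → unitInterval) (wake : Finset (Fin k)) :
    Disseminating (nextStates q s wake x) l (tc + 1) top cur pos where
  leader := h.leader_step he x wake
  clock := by
    have := h.clock
    rw [Nat.odd_iff] at ho
    rw [show (tc + 1) / 2 = tc / 2 by omega]
    exact this
  pos_lt := h.pos_lt
  cur_le := h.cur_le
  others := by
    intro u hu
    rcases h.step_of_ne he x wake hu (q := q) with
      ⟨_, h | h⟩ | ⟨_, h⟩ | ⟨_, h⟩ | ⟨slot, _, h⟩
    · exact .inl h
    · exact .inr (.inr (.inr (.inl ⟨0, by omega, h⟩)))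
    · exact .inr (.inl h)
    · rcases h with h | h
      · exact .inr (.inr (.inl h))
      · exact .inr (.inr (.inr (.inl h)))
    · rw [if_neg ho] at h
      exact .inr (.inr (.inr (.inr ⟨slot, h⟩)))

/-- The position of `SUniform` after the one given by `top`, `cur` and `pos`. -/
structure Advances (top cur pos top' cur' pos' : ℕ) : Prop where
  next_eq : ∀ slot, Sawtooth.next ⟨top, cur, pos, slot⟩ = ⟨top', cur', pos', slot⟩
  -- The variable `c` stands for `tc / 2`, which an odd round increases by one.
  clock : ∀ c, c + 2 ^ (cur + 1) + top + 3 = 2 ^ (top + 2) + pos →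
    c + 1 + 2 ^ (cur' + 1) + top' + 3 = 2 ^ (top' + 2) + pos'
  pos_lt : pos' < 2 ^ cur'
  cur_le : cur ≤ top → cur' ≤ top'

theorem advances_within {top cur pos : ℕ} (h : pos + 1 < 2 ^ cur) :
    Advances top cur pos top cur (pos + 1) where
  next_eq slot := by rw [next_mk, if_pos h]
  clock c hc := by omega
  pos_lt := h
  cur_le := id

theorem advances_down {top cur pos : ℕ} (h : pos + 1 = 2 ^ (cur + 1)) :
    Advances top (cur + 1) pos top cur 0 where
  next_eq slot := by rw [next_mk, if_neg (by omega), if_pos (by omega)]; rfl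
  clock c hc := by
    have : 2 ^ (cur + 1 + 1) = 2 * 2 ^ (cur + 1) := by ring
    omega
  pos_lt := by positivity
  cur_le := by omega

theorem advances_up (top : ℕ) : Advances top 0 0 (top + 1) (top + 1) 0 where
  next_eq slot := by rw [next_mk, if_neg (by norm_num), if_neg (by omega)]
  clock c hc := by
    have h1 : 2 ^ (top + 1 + 2) = 2 * 2 ^ (top + 2) := by ring
    have h2 : 2 ^ (top + 1 + 1) = 2 ^ (top + 2) := by ring
    norm_num at hc
    omega
  pos_lt := by positivity
  cur_le := by omega

theorem exists_advances {top cur pos : ℕ} (hp : pos < 2 ^ cur) :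
    ∃ top' cur' pos', Advances top cur pos top' cur' pos' := by
  by_cases h : pos + 1 < 2 ^ cur
  · exact ⟨_, _, _, advances_within h⟩
  · rcases cur with _ | cur
    · obtain rfl : pos = 0 := by simpa using hp
      exact ⟨_, _, _, advances_up top⟩
    · exact ⟨_, _, _, advances_down (by omega)⟩

theorem Disseminating.disseminating_of_odd (h : Disseminating s l tc top cur pos)
    (ho : Odd tc) {top' cur' pos' : ℕ} (ha : Advances top cur pos top' cur' pos')
    (x : Fin k → unitInterval) (wake : Finset (Fin k)) :
    Disseminating (nextStates q s wake x) l (tc + 1) top' cur' pos' where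
  leader := h.leader_step (fun he => he.1.not_odd ho) x wake
  clock := by
    rw [Nat.odd_iff] at ho
    rw [show (tc + 1) / 2 = tc / 2 + 1 by omega]
    exact ha.clock _ h.clock
  pos_lt := ha.pos_lt
  cur_le := ha.cur_le h.cur_le
  others := by
    intro u hu
    rcases h.step_of_ne (fun he => he.1.not_odd ho) x wake hu (q := q) with
      ⟨_, h | h⟩ | ⟨_, h⟩ | ⟨_, h⟩ | ⟨slot, _, h⟩
    · exact .inl h
    · exact .inr (.inr (.inr (.inl ⟨0, by omega, h⟩)))
    · exact .inr (.inl h)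
    · rcases h with h | h
      · exact .inr (.inr (.inl h))
      · exact .inr (.inr (.inr (.inl h)))
    · rw [if_pos ho] at h
      split_ifs at h with hs
      · exact .inr (.inl h)
      · rw [ha.next_eq] at h
        exact .inr (.inr (.inr (.inr ⟨_, h⟩)))

theorem Disseminating.step_of_ending (h : Disseminating s l tc top cur pos) (he : Ending s tc)
    (x : Fin k → unitInterval) (wake : Finset (Fin k)) (u : Fin k) :
    (s u = .asleep ∧ (nextStates q s wake x u = .asleep ∨
        nextStates q s wake x u = .listening 0 false)) ∨
      (s u = .off ∧ nextStates q s wake x u = .off) ∨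
      ((∃ n heard, s u = .listening n heard) ∧ nextStates q s wake x u = .electing 0) ∨
      (s u = .leader tc ∧ nextStates q s wake x u = .off) := by
  have hsolo := h.solo_of_white he.1 he.2 x (q := q)
  by_cases hu : u = l
  · subst hu
    right; right; right
    refine ⟨h.leader, ?_⟩
    rw [nextStates_of_ne_asleep q wake x (by simp [h.leader]), h.leader, hsolo.feedback_self]
    simp [update, he.1]
  · have hf := hsolo.feedback_of_ne hu
    rcases h.others u hu with h' | h' | ⟨n, hn, h'⟩ | ⟨n, hn, h'⟩ | ⟨slot, h'⟩
    · exact .inl ⟨h', (nextStates_of_asleep q wake x h').symm⟩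
    · exact .inr (.inl ⟨h', nextStates_of_off q wake x h'⟩)
    · right; right; left
      refine ⟨⟨n, true, h'⟩, ?_⟩
      rw [nextStates_of_ne_asleep q wake x (by simp [h']), hf, h']; rfl
    · right; right; left
      refine ⟨⟨n, false, h'⟩, ?_⟩
      rw [nextStates_of_ne_asleep q wake x (by simp [h']), hf, h']; rfl
    · exact absurd h' (he.2 _ _ _)

theorem Disseminating.electing_of_ending (h : Disseminating s l tc top cur pos)
    (he : Ending s tc) (x : Fin k → unitInterval) (wake : Finset (Fin k)) :
    Electing (nextStates q s wake x) := by
  intro u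
  rcases h.step_of_ending he x wake u (q := q) with ⟨_, h | h⟩ | ⟨_, h⟩ | ⟨_, h⟩ | ⟨_, h⟩
  · exact .inl h
  · exact .inr (.inr (.inl ⟨0, by norm_num, h⟩))
  · exact .inr (.inl h)
  · exact .inr (.inr (.inr ⟨0, h⟩))
  · exact .inr (.inl h)

/-- The configurations that occur in an execution. -/
def Regular {k : ℕ} (s : Fin k → State) : Prop :=
  Electing s ∨ ∃ l tc top cur pos, Disseminating s l tc top cur pos

theorem Regular.next (h : Regular s) (x : Fin k → unitInterval) (wake : Finset (Fin k)) :
    Regular (nextStates q s wake x) := by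
  rcases h with h | ⟨l, tc, top, cur, pos, h⟩
  · by_cases hx : ∃ v m, Solo (transmissions q s x) v m
    · obtain ⟨v, m, hv⟩ := hx
      exact .inr ⟨_, _, _, _, _, h.disseminating_of_solo hv wake⟩
    · push Not at hx
      exact .inl (h.electing_of_not_solo hx wake)
  · by_cases he : Ending s tc
    · exact .inl (h.electing_of_ending he x wake)
    · by_cases ho : Odd tc
      · obtain ⟨_, _, _, ha⟩ := exists_advances (top := top) h.pos_lt
        exact .inr ⟨_, _, _, _, _, h.disseminating_of_odd ho ha x wake⟩
      · exact .inr ⟨_, _, _, _, _, h.disseminating_of_even he ho x wake⟩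

theorem regular_run (adv : Adversary k) (ω : Coins k) (r : ℕ) : Regular (run q adv ω r).now := by
  induction r with
  | zero => exact .inl fun u => .inl rfl
  | succ r ih => exact ih.next _ _

end

/-! ### Executions without overdue stations -/

/-- Some station has been in an unfinished election for `A` rounds, or is a follower that has left the
first `J` steps of the outer loop of `SUniform` behind. -/
def Overdue {k : ℕ} (A J : ℕ) (s : Fin k → State) : Prop :=
  (∃ u i, s u = .electing i ∧ A ≤ i) ∨ ∃ u t b, s u = .follower t b ∧ J < b.top

/-- The number of rounds for which a station has taken part in an election. -/
def electionTime : State → ℕ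
  | .electing i => i
  | _ => 0

/-- The number of rounds for which the oldest participant of an election has taken part in it. -/
def age {k : ℕ} (s : Fin k → State) : ℕ :=
  Finset.univ.sup fun u => electionTime (s u)

section
variable {k : ℕ} {q : ℝ} {s : Fin k → State} {l : Fin k} {tc top cur pos A J : ℕ}

theorem le_age {u : Fin k} {i : ℕ} (h : s u = .electing i) : i ≤ age s := by
  have := Finset.le_sup (f := fun u => electionTime (s u)) (Finset.mem_univ u)
  simp only [h] at this
  exact this

theorem age_le {n : ℕ} (h : ∀ u i, s u = .electing i → i ≤ n) : age s ≤ n := by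
  refine Finset.sup_le fun u _ => ?_
  cases hu : s u with
  | electing i => exact h u i hu
  | _ => exact Nat.zero_le _

theorem exists_electing_age {u : Fin k} {i : ℕ} (h : s u = .electing i) :
    ∃ v, s v = .electing (age s) := by
  by_cases h0 : age s = 0
  · have := le_age h
    exact ⟨u, by rw [h]; congr 1; omega⟩
  · obtain ⟨v, -, hv⟩ := Finset.exists_mem_eq_sup Finset.univ ⟨u, Finset.mem_univ u⟩
      (fun u => electionTime (s u))
    change age s = electionTime (s v) at hv
    cases hs : s v with
    | electing i =>
      rw [hs] at hv
      exact ⟨v, by rw [hs, hv]; rfl⟩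
    | _ => rw [hs] at hv; exact absurd hv h0

/-- All counters advance by one and newcomers start at `0`. Without a participant the age would stay
`0`, hence `hu`. -/
theorem Electing.age_of_not_solo (h : Electing s) {x : Fin k → unitInterval}
    (hx : ∀ v m, ¬ Solo (transmissions q s x) v m) (wake : Finset (Fin k)) {u : Fin k} {i : ℕ}
    (hu : s u = .electing i) : age (nextStates q s wake x) = age s + 1 := by
  apply le_antisymm
  · refine age_le fun v j hj => ?_
    rcases h.step_of_not_solo hx wake v with
      ⟨_, h | h⟩ | ⟨_, h⟩ | ⟨n, hn, _, h⟩ | ⟨_, h⟩ | ⟨i, h', h⟩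
    · simp [h] at hj
    · simp [h] at hj
    · simp [h] at hj
    · simp [h] at hj
    · obtain rfl : 0 = j := by simpa [h] using hj
      omega
    · obtain rfl : i + 1 = j := by simpa [h] using hj
      have := le_age h'
      omega
  · obtain ⟨v, hv⟩ := exists_electing_age hu
    rcases h.step_of_not_solo hx wake v with
      ⟨h', _⟩ | ⟨h', _⟩ | ⟨n, hn, h', _⟩ | ⟨h', _⟩ | ⟨i, h', h⟩
    · simp [hv] at h'
    · simp [hv] at h'
    · simp [hv] at h'
    · simp [hv] at h'
    · obtain rfl : age s = i := by simpa [hv] using h'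
      exact le_age h

/-- The clock equation gives `tc / 2 < 2 ^ (top + 2)`, and `top ≤ J` for a follower that is not
overdue. -/
theorem Disseminating.lt_of_not_overdue (h : Disseminating s l tc top cur pos)
    (hs : ¬ Overdue A J s) {u : Fin k} {t : ℕ} {b : Sawtooth} (hu : s u = .follower t b) :
    tc < 2 ^ (J + 3) := by
  have hul : u ≠ l := by
    rintro rfl
    have := h.leader
    simp [hu] at this
  have htop : top ≤ J := by
    rcases h.others u hul with h | h | ⟨n, _, h⟩ | ⟨n, _, h⟩ | ⟨slot, h⟩
    · simp [hu] at h
    · simp [hu] at h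
    · simp [hu] at h
    · simp [hu] at h
    · by_contra hlt
      exact hs (.inr ⟨u, _, _, h, by simpa using hlt⟩)
  have h1 := h.clock
  have h2 := h.pos_lt
  have h3 : 2 ^ (top + 2) ≤ 2 ^ (J + 2) := Nat.pow_le_pow_right (by norm_num) (by omega)
  have h4 : 2 ^ (cur + 1) = 2 * 2 ^ cur := by ring
  have h5 : 2 ^ (J + 3) = 2 * 2 ^ (J + 2) := by ring
  omega

/-- A configuration of an execution in which the dissemination mode has not lasted too long. -/
def Timely (J : ℕ) (s : Fin k → State) : Prop :=
  Electing s ∨ ∃ l tc top cur pos, Disseminating s l tc top cur pos ∧ tc ≤ 2 ^ (J + 3)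

/-- Round `2 ^ (J + 3)` is white and no follower can be left in it, so the mode ends there at the
latest. -/
theorem Disseminating.lt_of_not_ending (h : Disseminating s l tc top cur pos)
    (hs : ¬ Overdue A J s) (ht : tc ≤ 2 ^ (J + 3)) (he : ¬ Ending s tc) : tc < 2 ^ (J + 3) := by
  by_contra hlt
  have htc : tc = 2 ^ (J + 3) := by omega
  refine he ⟨⟨J + 3, by omega, htc⟩, fun u t b hu => ?_⟩
  exact hlt (h.lt_of_not_overdue hs hu)

theorem Disseminating.exists_disseminating (h : Disseminating s l tc top cur pos)
    (he : ¬ Ending s tc) (x : Fin k → unitInterval) (wake : Finset (Fin k)) :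
    ∃ top' cur' pos', Disseminating (nextStates q s wake x) l (tc + 1) top' cur' pos' := by
  by_cases ho : Odd tc
  · obtain ⟨_, _, _, ha⟩ := exists_advances (top := top) h.pos_lt
    exact ⟨_, _, _, h.disseminating_of_odd ho ha x wake⟩
  · exact ⟨_, _, _, h.disseminating_of_even he ho x wake⟩

theorem Timely.next (h : Timely J s) (hs : ¬ Overdue A J s) (x : Fin k → unitInterval)
    (wake : Finset (Fin k)) : Timely J (nextStates q s wake x) := by
  rcases h with h | ⟨l, tc, top, cur, pos, h, ht⟩
  · by_cases hx : ∃ v m, Solo (transmissions q s x) v m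
    · obtain ⟨v, m, hv⟩ := hx
      exact .inr ⟨_, _, _, _, _, h.disseminating_of_solo hv wake, Nat.one_le_two_pow⟩
    · push Not at hx
      exact .inl (h.electing_of_not_solo hx wake)
  · by_cases he : Ending s tc
    · exact .inl (h.electing_of_ending he x wake)
    · obtain ⟨_, _, _, h'⟩ := h.exists_disseminating he x wake (q := q)
      exact .inr ⟨_, _, _, _, _, h', h.lt_of_not_ending hs ht he⟩

end

/-! ### Delivery and switching off in bounded time -/

section
variable {k : ℕ} {q : ℝ} {adv : Adversary k} {ω : Coins k} {l : Fin k} {tc top cur pos A J : ℕ}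

theorem timely_run (hok : ∀ r, ¬ Overdue A J (run q adv ω r).now) (r : ℕ) :
    Timely J (run q adv ω r).now := by
  induction r with
  | zero => exact .inl fun u => .inl rfl
  | succ r ih => exact ih.next (hok r) _ _

theorem run_succ_now (r : ℕ) : (run q adv ω (r + 1)).now =
    nextStates q (run q adv ω r).now (adv (run q adv ω r)) (ω r) := rfl

theorem deliversAt_iff_solo {u : Fin k} {r : ℕ} : DeliversAt q adv ω u r ↔
    Solo (transmissions q (run q adv ω r).now (ω r)) u .packet := Iff.rfl

/-- The dissemination mode comes to an end. -/
theorem exists_ending (hok : ∀ r, ¬ Overdue A J (run q adv ω r).now) (n : ℕ) :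
    ∀ r tc top cur pos, Disseminating (run q adv ω r).now l tc top cur pos →
      tc ≤ 2 ^ (J + 3) → 2 ^ (J + 3) ≤ tc + n →
      ∃ d ≤ n, ∃ tc' top' cur' pos',
        Disseminating (run q adv ω (r + d)).now l tc' top' cur' pos' ∧
          Ending (run q adv ω (r + d)).now tc' ∧
          -- Listeners stay in the waiting loop until the mode ends, and so they join the next
          -- election with counter `0`.
          ∀ u n heard, (run q adv ω r).now u = .listening n heard →
            ∃ n heard, (run q adv ω (r + d)).now u = .listening n heard := by
  induction n with
  | zero =>
    intro r tc top cur pos h ht hn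
    refine ⟨0, le_rfl, tc, top, cur, pos, h, ?_, fun u n heard hu => ⟨n, heard, hu⟩⟩
    by_contra he
    have := h.lt_of_not_ending (hok r) ht he
    omega
  | succ n ih =>
    intro r tc top cur pos h ht hn
    by_cases he : Ending (run q adv ω r).now tc
    · exact ⟨0, Nat.zero_le _, tc, top, cur, pos, h, he, fun u n heard hu => ⟨n, heard, hu⟩⟩
    · obtain ⟨_, _, _, h'⟩ :=
        h.exists_disseminating he (ω r) (adv (run q adv ω r)) (q := q)
      obtain ⟨d, hd, tc', top', cur', pos', h1, h2, h3⟩ := ih (r + 1) _ _ _ _ h'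
        (h.lt_of_not_ending (hok r) ht he) (by omega)
      refine ⟨d + 1, by omega, tc', top', cur', pos', ?_⟩
      rw [show r + (d + 1) = r + 1 + d by omega]
      refine ⟨h1, h2, fun u m heard hu => ?_⟩
      have hul : u ≠ l := by
        rintro rfl
        have := h.leader
        simp [hu] at this
      rcases h.step_of_ne he (ω r) (adv (run q adv ω r)) hul (q := q) with
        ⟨h', _⟩ | ⟨h', _⟩ | ⟨_, ⟨m', _, hm⟩ | ⟨m', _, hm⟩⟩ | ⟨_, h', _⟩
      · simp [hu] at h'
      · simp [hu] at h'
      · exact h3 u _ _ hm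
      · exact h3 u _ _ hm
      · simp [hu] at h'

theorem exists_off_of_leader (hok : ∀ r, ¬ Overdue A J (run q adv ω r).now) {r : ℕ}
    (h : Disseminating (run q adv ω r).now l tc top cur pos) (ht : tc ≤ 2 ^ (J + 3)) :
    ∃ t, (run q adv ω t).now l = .off := by
  obtain ⟨d, -, tc', top', cur', pos', h', he, -⟩ :=
    exists_ending hok (2 ^ (J + 3)) r tc top cur pos h ht (by omega)
  refine ⟨r + d + 1, ?_⟩
  rcases h'.step_of_ending he (ω (r + d)) (adv (run q adv ω (r + d))) l (q := q) with
    ⟨h, _⟩ | ⟨h, _⟩ | ⟨⟨_, _, h⟩, _⟩ | ⟨_, h⟩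
  · simp [h'.leader] at h
  · simp [h'.leader] at h
  · simp [h'.leader] at h
  · exact h

/-- A station that has delivered its packet will switch off. -/
theorem exists_off_of_deliversAt (hok : ∀ r, ¬ Overdue A J (run q adv ω r).now) {u : Fin k}
    {r : ℕ} (hd : DeliversAt q adv ω u r) : ∃ t, (run q adv ω t).now u = .off := by
  rw [deliversAt_iff_solo] at hd
  rcases regular_run (q := q) adv ω r with h | ⟨l, tc, top, cur, pos, h⟩
  · exact exists_off_of_leader hok (r := r + 1) (h.disseminating_of_solo hd _) Nat.one_le_two_pow
  · by_cases ho : Odd tc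
    · refine ⟨r + 1, ?_⟩
      obtain ⟨hul, -, slot, hslot, -⟩ := h.solo_of_odd ho hd
      rw [run_succ_now]
      rcases h.step_of_ne (fun he => he.1.not_odd ho) (ω r) (adv (run q adv ω r)) hul (q := q) with
        ⟨h', _⟩ | ⟨h', _⟩ | ⟨⟨_, _, h'⟩, _⟩ | ⟨_, _, h'⟩
      · simp [hslot] at h'
      · simp [hslot] at h'
      · simp [hslot] at h'
      · rwa [if_pos ho, if_pos ⟨_, hd⟩] at h'
    · exfalso
      have h1 := hd.1
      by_cases hul : u = l
      · subst hul
        by_cases hw : IsWhite tc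
        · rw [(h.transmissions_leader _).2.1 hw] at h1; simp at h1
        · rw [(h.transmissions_leader _).2.2 ho hw] at h1; simp at h1
      · rcases h.transmissions_of_ne (ω r) hul (q := q) with h' | ⟨slot, h'⟩
        · simp [h'] at h1
        · by_cases hw : IsWhite tc
          · rw [(transmissions_follower _ h').2.1 hw] at h1; simp at h1
          · rw [(transmissions_follower _ h').2.2 ho hw] at h1; simp at h1

/-- Induction on the rounds left until number `2 ^ (J + 3)`, by which no follower can remain; a
follower leaves the mode only by delivering its packet. -/
theorem exists_deliversAt_of_follower (hok : ∀ r, ¬ Overdue A J (run q adv ω r).now) {u : Fin k}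
    (n : ℕ) : ∀ r tc top cur pos, Disseminating (run q adv ω r).now l tc top cur pos →
      2 ^ (J + 3) ≤ tc + n → (∃ t b, (run q adv ω r).now u = .follower t b) →
      ∃ d ≤ n, DeliversAt q adv ω u (r + d) := by
  induction n with
  | zero =>
    rintro r tc top cur pos h hn ⟨t, b, hu⟩
    have := h.lt_of_not_overdue (hok r) hu
    omega
  | succ n ih =>
    rintro r tc top cur pos h hn ⟨t, b, hu⟩
    by_cases hd : DeliversAt q adv ω u r
    · exact ⟨0, Nat.zero_le _, hd⟩
    have he : ¬ Ending (run q adv ω r).now tc := fun he => he.2 _ _ _ hu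
    obtain ⟨_, _, _, h'⟩ := h.exists_disseminating he (ω r) (adv (run q adv ω r)) (q := q)
    have hul : u ≠ l := by
      rintro rfl
      have := h.leader
      simp [hu] at this
    have hu' : ∃ t b, (run q adv ω (r + 1)).now u = .follower t b := by
      rw [run_succ_now]
      rcases h.step_of_ne he (ω r) (adv (run q adv ω r)) hul (q := q) with
        ⟨h', _⟩ | ⟨h', _⟩ | ⟨⟨_, _, h'⟩, _⟩ | ⟨_, _, h'⟩
      · simp [hu] at h'
      · simp [hu] at h'
      · simp [hu] at h'
      · split_ifs at h' with ho hs
        · obtain ⟨m, hm⟩ := hs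
          obtain ⟨-, rfl, -⟩ := h.solo_of_odd ho hm
          exact absurd hm hd
        · exact ⟨_, _, h'⟩
        · exact ⟨_, _, h'⟩
    obtain ⟨d, hdn, hd⟩ := ih (r + 1) _ _ _ _ h' (by omega) hu'
    exact ⟨d + 1, by omega, by rw [show r + (d + 1) = r + 1 + d by omega]; exact hd⟩

/-- The remaining time is measured by the oldest participant, whose counter must stay below `A`.
When the election ends, `u` either has just delivered as the new leader or becomes a follower. -/
theorem exists_deliversAt_of_electing (hok : ∀ r, ¬ Overdue A J (run q adv ω r).now) {u : Fin k}
    (n : ℕ) : ∀ r, Electing (run q adv ω r).now → A ≤ age (run q adv ω r).now + n →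
      (∃ i, (run q adv ω r).now u = .electing i) →
      ∃ d ≤ n + 1 + 2 ^ (J + 3), DeliversAt q adv ω u (r + d) := by
  induction n with
  | zero =>
    rintro r h hn ⟨i, hu⟩
    obtain ⟨v, hv⟩ := exists_electing_age hu
    exact absurd (.inl ⟨v, _, hv, hn⟩) (hok r)
  | succ n ih =>
    rintro r h hn ⟨i, hu⟩
    by_cases hx : ∃ v m, Solo (transmissions q (run q adv ω r).now (ω r)) v m
    · obtain ⟨v, m, hv⟩ := hx
      by_cases huv : u = v
      · subst huv
        obtain ⟨rfl, -⟩ := h.solo hv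
        exact ⟨0, Nat.zero_le _, hv⟩
      · have h' := h.disseminating_of_solo hv (adv (run q adv ω r))
        have hu' : ∃ t b, (run q adv ω (r + 1)).now u = .follower t b := by
          rw [run_succ_now]
          rcases h.step_of_solo hv (adv (run q adv ω r)) huv with
            ⟨h', _⟩ | ⟨h', _⟩ | ⟨_, _, h', _⟩ | ⟨h', _⟩ | ⟨_, _, h'⟩
          · simp [hu] at h'
          · simp [hu] at h'
          · simp [hu] at h'
          · simp [hu] at h'
          · exact ⟨_, _, h'⟩
        obtain ⟨d, hdn, hd⟩ := exists_deliversAt_of_follower hok (2 ^ (J + 3)) (r + 1) _ _ _ _ h'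
          (by omega) hu'
        exact ⟨d + 1, by omega, by rw [show r + (d + 1) = r + 1 + d by omega]; exact hd⟩
    · push Not at hx
      have hage := h.age_of_not_solo hx (adv (run q adv ω r)) hu
      have hu' : ∃ i, (run q adv ω (r + 1)).now u = .electing i := by
        rw [run_succ_now]
        rcases h.step_of_not_solo hx (adv (run q adv ω r)) u with
          ⟨h', _⟩ | ⟨h', _⟩ | ⟨_, _, h', _⟩ | ⟨h', _⟩ | ⟨_, _, h'⟩
        · simp [hu] at h'
        · simp [hu] at h'
        · simp [hu] at h'
        · simp [hu] at h'
        · exact ⟨_, h'⟩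
      obtain ⟨d, hdn, hd⟩ := ih (r + 1) (h.electing_of_not_solo hx _)
        (by rw [run_succ_now, hage]; omega) hu'
      exact ⟨d + 1, by omega, by rw [show r + (d + 1) = r + 1 + d by omega]; exact hd⟩

/-- The station waits for the end of the running mode, takes part in one election, and is at worst a
follower in the next mode. -/
theorem exists_deliversAt_of_disseminating (hok : ∀ r, ¬ Overdue A J (run q adv ω r).now)
    {u : Fin k} {r : ℕ} (h : Disseminating (run q adv ω r).now l tc top cur pos)
    (ht : tc ≤ 2 ^ (J + 3)) (hu : ∃ n heard, (run q adv ω r).now u = .listening n heard) :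
    ∃ d ≤ A + 2 + 2 * 2 ^ (J + 3), DeliversAt q adv ω u (r + d) := by
  obtain ⟨n, heard, hu⟩ := hu
  obtain ⟨d, hd, tc', top', cur', pos', h', he, hl⟩ :=
    exists_ending hok (2 ^ (J + 3)) r tc top cur pos h ht (by omega)
  obtain ⟨n', heard', hu'⟩ := hl u n heard hu
  have hu1 : ∃ i, (run q adv ω (r + d + 1)).now u = .electing i := by
    rw [run_succ_now]
    rcases h'.step_of_ending he (ω (r + d)) (adv (run q adv ω (r + d))) u (q := q) with
      ⟨h, _⟩ | ⟨h, _⟩ | ⟨_, h⟩ | ⟨h, _⟩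
    · simp [hu'] at h
    · simp [hu'] at h
    · exact ⟨0, h⟩
    · simp [hu'] at h
  obtain ⟨e, hen, he⟩ := exists_deliversAt_of_electing hok A (r + d + 1)
    (h'.electing_of_ending he _ _) (by omega) hu1
  exact ⟨d + 1 + e, by omega, by rw [show r + (d + 1 + e) = r + d + 1 + e by omega]; exact he⟩

/-- At most `n` rounds of the block are left. A success among them starts a mode, whose end the
station then awaits. -/
theorem exists_deliversAt_of_listening (hok : ∀ r, ¬ Overdue A J (run q adv ω r).now)
    {u : Fin k} (n : ℕ) : ∀ r m heard, (run q adv ω r).now u = .listening m heard →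
      4 ≤ m + n → Electing (run q adv ω r).now →
      ∃ d ≤ n + (A + 2 + 2 * 2 ^ (J + 3)), DeliversAt q adv ω u (r + d) := by
  induction n with
  | zero =>
    intro r m heard hu hm h
    rcases h u with h | h | ⟨m', hm', h⟩ | ⟨_, h⟩
    · simp [hu] at h
    · simp [hu] at h
    · have : m = m' ∧ heard = false := by simpa [hu] using h
      omega
    · simp [hu] at h
  | succ n ih =>
    intro r m heard hu hm h
    have key : ∃ d ≤ n + (A + 2 + 2 * 2 ^ (J + 3)), DeliversAt q adv ω u (r + 1 + d) := by
      by_cases hx : ∃ v m, Solo (transmissions q (run q adv ω r).now (ω r)) v m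
      · obtain ⟨v, m', hv⟩ := hx
        have huv : u ≠ v := by
          rintro rfl
          obtain ⟨-, i, hi⟩ := h.solo hv
          simp [hu] at hi
        have h' := h.disseminating_of_solo hv (adv (run q adv ω r))
        have hu' : ∃ n heard, (run q adv ω (r + 1)).now u = .listening n heard := by
          rw [run_succ_now]
          rcases h.step_of_solo hv (adv (run q adv ω r)) huv with
            ⟨h', _⟩ | ⟨h', _⟩ | ⟨_, _, _, h'⟩ | ⟨_, h'⟩ | ⟨_, h', _⟩
          · simp [hu] at h'
          · simp [hu] at h'
          · exact ⟨_, _, h'⟩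
          · exact ⟨_, _, h'⟩
          · simp [hu] at h'
        obtain ⟨d, hdn, hd⟩ := exists_deliversAt_of_disseminating hok (r := r + 1) h'
          Nat.one_le_two_pow hu'
        exact ⟨d, by omega, hd⟩
      · push Not at hx
        have h' := h.electing_of_not_solo hx (adv (run q adv ω r))
        rcases h.step_of_not_solo hx (adv (run q adv ω r)) u with
          ⟨h1, _⟩ | ⟨h1, _⟩ | ⟨m', _, h1, h2⟩ | ⟨_, h2⟩ | ⟨_, h1, _⟩
        · simp [hu] at h1
        · simp [hu] at h1
        · have : m = m' ∧ heard = false := by simpa [hu] using h1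
          exact ih (r + 1) _ _ h2 (by omega) h'
        · obtain ⟨d, hdn, hd⟩ := exists_deliversAt_of_electing hok A (r + 1) h' (by omega) ⟨_, h2⟩
          exact ⟨d, by omega, hd⟩
        · simp [hu] at h1
    obtain ⟨d, hdn, hd⟩ := key
    exact ⟨d + 1, by omega, by rw [show r + (d + 1) = r + 1 + d by omega]; exact hd⟩

/-- If no station is ever overdue, then the contention is resolved in time. -/
theorem resolvedWithLatency_of_not_overdue (hok : ∀ r, ¬ Overdue A J (run q adv ω r).now) {L : ℝ}
    (hL : (A + 2 ^ (J + 4) + 7 : ℕ) ≤ L) : ResolvedWithLatency q adv ω L := by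
  rintro u r ⟨hu, hmem⟩
  have key : ∃ d, d ≤ A + 2 ^ (J + 4) + 7 ∧ DeliversAt q adv ω u (r + d) := by
    have hu' : (run q adv ω (r + 1)).now u = .listening 0 false :=
      nextStates_of_asleep_mem hu hmem
    -- There are two modes of at most `2 ^ (J + 3)` rounds each. The `7` counts the activation, four
    -- listening rounds, the round that ends a mode and the round of the election.
    have hpow : 2 ^ (J + 4) = 2 * 2 ^ (J + 3) := by ring
    rcases timely_run hok (r + 1) with h | ⟨l, tc, top, cur, pos, h, ht⟩
    · obtain ⟨d, hdn, hd⟩ := exists_deliversAt_of_listening hok 4 (r + 1) 0 false hu' (by omega) h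
      exact ⟨d + 1, by omega, by rw [show r + (d + 1) = r + 1 + d by omega]; exact hd⟩
    · obtain ⟨d, hdn, hd⟩ := exists_deliversAt_of_disseminating hok h ht ⟨_, _, hu'⟩
      exact ⟨d + 1, by omega, by rw [show r + (d + 1) = r + 1 + d by omega]; exact hd⟩
  obtain ⟨d, hdn, hd⟩ := key
  exact ⟨⟨d, le_trans (by exact_mod_cast hdn) hL, hd⟩, exists_off_of_deliversAt hok hd⟩

end

/-! ### Measurability -/

instance : Countable Message :=
  Function.Injective.countable (f := fun m : Message => match m with
    | .packet => 0
    | .dMode => 1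
    | .anybody => (2 : ℕ)) (by intro a b h; cases a <;> cases b <;> simp_all)

instance : Countable Feedback :=
  Function.Injective.countable (f := fun b : Feedback => match b with
    | .nothing => none
    | .ack => some none
    | .received m => some (some m)) (by intro a b h; cases a <;> cases b <;> simp_all)

instance : Countable Sawtooth :=
  Function.Injective.countable (f := fun b : Sawtooth => (b.top, b.cur, b.pos, b.slot))
    (by rintro ⟨_, _, _, _⟩ ⟨_, _, _, _⟩ h; simp_all)

instance : Countable State :=
  Function.Injective.countable (β := ℕ × ℕ × Bool × Option Sawtooth)
    (f := fun s : State => match s with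
    | .asleep => (0, 0, false, none)
    | .listening n heard => (1, n, heard, none)
    | .electing i => (2, i, false, none)
    | .leader tc => (3, tc, false, none)
    | .follower tc b => (4, tc, false, some b)
    | .off => (5, 0, false, none)) (by intro a b h; cases a <;> cases b <;> simp_all)

instance (k : ℕ) : Countable (RoundRecord k) :=
  Function.Injective.countable (f := fun b : RoundRecord k => (b.state, b.sent))
    (by rintro ⟨_, _⟩ ⟨_, _⟩ h; simp_all)

/-- A history contains states and transmissions, but not the real-valued coins. Being countable, the
type carries the discrete σ-algebra, and no measurability condition on the adversary is needed. -/
instance (k : ℕ) : Countable (History k) :=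
  Function.Injective.countable (f := fun b : History k => (b.past, b.now))
    (by rintro ⟨_, _⟩ ⟨_, _⟩ h; simp_all)

instance : MeasurableSpace Message := ⊤
instance : MeasurableSpace (Option Message) := ⊤
instance : MeasurableSpace Feedback := ⊤
instance : MeasurableSpace Sawtooth := ⊤
instance : MeasurableSpace State := ⊤
instance (k : ℕ) : MeasurableSpace (History k) := ⊤

theorem measurable_draw (b : Sawtooth) : Measurable b.draw := by
  unfold Sawtooth.draw
  split_ifs
  · have h1 : Measurable fun x : unitInterval => ⌊(2 : ℝ) ^ b.cur * (x : ℝ)⌋₊ :=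
      Nat.measurable_floor.comp (by fun_prop)
    exact (Measurable.of_discrete (f := fun n : ℕ => ({ b with slot := n } : Sawtooth))).comp h1
  · exact measurable_const

theorem measurable_act (q : ℝ) (s : State) : Measurable (act q s) := by
  cases s with
  | electing i =>
    unfold act
    exact Measurable.ite (measurableSet_lt (by fun_prop) (by fun_prop)) measurable_const
      measurable_const
  | follower tc b =>
    change Measurable fun x => act q (.follower tc b) x
    simp only [act]
    split_ifs
    · exact (Measurable.of_discrete (f := fun b : Sawtooth =>
        if b.pos = b.slot then some Message.packet else none)).comp (measurable_draw b)
    · exact measurable_const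
    · exact measurable_const
  | _ => exact measurable_const

theorem measurable_transmissions {k : ℕ} (q : ℝ) (s : Fin k → State) :
    Measurable (transmissions q s) :=
  measurable_pi_lambda _ fun u => (measurable_act q (s u)).comp (measurable_pi_apply u)

theorem measurable_update (s : State) (fb : Feedback) : Measurable fun x => update s x fb := by
  cases s with
  | follower tc b =>
    have h2 : Measurable fun x => State.follower (tc + 1) (b.draw x).next :=
      (Measurable.of_discrete (f := fun b : Sawtooth => State.follower (tc + 1) b.next)).comp
        (measurable_draw b)
    simp only [update]
    split_ifs
    · cases fb with
      | ack => exact measurable_const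
      | _ => exact h2
    · exact measurable_const
  | _ => exact measurable_const

theorem measurable_nextStates {k : ℕ} (q : ℝ) (s : Fin k → State) (wake : Finset (Fin k)) :
    Measurable (nextStates q s wake) := by
  refine measurable_pi_lambda _ fun u => ?_
  unfold nextStates
  split_ifs
  · exact measurable_const
  · have h1 : Measurable fun x => (x u, feedback (transmissions q s x) u) :=
      (measurable_pi_apply u).prodMk
        ((Measurable.of_discrete (f := fun t : Fin k → Option Message => feedback t u)).comp
          (measurable_transmissions q s))
    have h2 : Measurable fun p : unitInterval × Feedback => update (s u) p.1 p.2 :=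
      measurable_from_prod_countable_left fun fb => measurable_update (s u) fb
    exact h2.comp h1

/-! ### The execution as a random process -/

/-- The coins of a single round. -/
noncomputable def coinRow (k : ℕ) : Measure (Fin k → unitInterval) :=
  Measure.pi fun _ : Fin k => (volume : Measure unitInterval)

instance (k : ℕ) : IsProbabilityMeasure (coinRow k) := by unfold coinRow; infer_instance

instance (k : ℕ) : IsProbabilityMeasure (coinMeasure k) := by unfold coinMeasure; infer_instance

section
variable {k : ℕ} {q : ℝ} {adv : Adversary k}

/-- The history after a round with coins `x` that starts with history `h`. -/
noncomputable def extend (q : ℝ) (adv : Adversary k) (h : History k) (x : Fin k → unitInterval) :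
    History k :=
  ⟨h.past ++ [⟨h.now, transmissions q h.now x⟩], nextStates q h.now (adv h) x⟩

theorem run_succ (ω : Coins k) (r : ℕ) :
    run q adv ω (r + 1) = extend q adv (run q adv ω r) (ω r) := rfl

theorem measurable_extend (h : History k) : Measurable (extend q adv h) := by
  have h1 : Measurable fun x => (transmissions q h.now x, nextStates q h.now (adv h) x) :=
    (measurable_transmissions q _).prodMk (measurable_nextStates q _ _)
  exact (Measurable.of_discrete (f := fun p : (Fin k → Option Message) × (Fin k → State) =>
    (⟨h.past ++ [⟨h.now, p.1⟩], p.2⟩ : History k))).comp h1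

theorem measurable_extend_prod :
    Measurable fun p : History k × (Fin k → unitInterval) => extend q adv p.1 p.2 :=
  measurable_from_prod_countable_right fun h => measurable_extend h

theorem measurable_run (r : ℕ) : Measurable fun ω => run q adv ω r := by
  induction r with
  | zero => exact measurable_const
  | succ r ih => exact measurable_extend_prod.comp (ih.prodMk (measurable_pi_apply r))

theorem run_congr {ω ω' : Coins k} {r : ℕ} (h : ∀ i < r, ω i = ω' i) :
    run q adv ω r = run q adv ω' r := by
  induction r with
  | zero => rfl
  | succ r ih =>
    rw [run_succ, run_succ, ih fun i hi => h i (by omega), h r (by omega)]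

/-- The history at the beginning of a round is independent of the coins of the round. -/
theorem indepFun_run (r : ℕ) : ProbabilityTheory.IndepFun (fun ω => run q adv ω r)
    (fun ω : Coins k => ω r) (coinMeasure k) := by
  have h1 : ProbabilityTheory.iIndepFun (fun (i : ℕ) (ω : Coins k) => ω i) (coinMeasure k) :=
    ProbabilityTheory.iIndepFun_infinitePi (X := fun _ x => x) fun _ => measurable_id
  have h2 := h1.indepFun_finset (Finset.range r) {r} (by simp) fun i => measurable_pi_apply i
  -- Rows from `r` on are filled with zeros, which the history at the beginning of round `r` does
  -- not see.
  let e : ((i : Finset.range r) → Fin k → unitInterval) → Coins k := fun y i =>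
    if h : i ∈ Finset.range r then y ⟨i, h⟩ else fun _ => 0
  have he : Measurable e := by
    refine measurable_pi_lambda _ fun i => ?_
    by_cases h : i ∈ Finset.range r
    · simp only [e, h, dite_true]; exact measurable_pi_apply _
    · simp only [e, h, dite_false]; exact measurable_const
  have hψ : Measurable fun y : (i : ({r} : Finset ℕ)) → Fin k → unitInterval =>
      y ⟨r, Finset.mem_singleton_self r⟩ := measurable_pi_apply _
  have h3 := h2.comp (φ := fun y => run q adv (e y) r) ((measurable_run r).comp he) hψ
  have h4 : ((fun y => run q adv (e y) r) ∘ fun (ω : Coins k) (i : Finset.range r) => ω i) =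
      fun ω => run q adv ω r := by
    funext ω
    refine run_congr fun i hi => ?_
    simp [e, hi]
  rw [h4] at h3
  exact h3

/-- By independence, the coins of round `r` can be integrated for a fixed history, and then the
choice of the adversary is a constant. -/
theorem lintegral_run_succ (r : ℕ) (U : History k → ENNReal) :
    ∫⁻ ω, U (run q adv ω (r + 1)) ∂coinMeasure k =
      ∫⁻ ω, ∫⁻ x, U (extend q adv (run q adv ω r) x) ∂coinRow k ∂coinMeasure k := by
  have hr : Measurable fun ω => run q adv ω r := measurable_run r
  have hω : Measurable fun ω : Coins k => ω r := measurable_pi_apply r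
  have hg : Measurable fun p : History k × (Fin k → unitInterval) => U (extend q adv p.1 p.2) :=
    (Measurable.of_discrete (f := U)).comp measurable_extend_prod
  have hmap : (coinMeasure k).map (fun ω : Coins k => ω r) = coinRow k :=
    Measure.infinitePi_map_eval _ r
  calc ∫⁻ ω, U (run q adv ω (r + 1)) ∂coinMeasure k
      = ∫⁻ p, U (extend q adv p.1 p.2)
          ∂(coinMeasure k).map (fun ω => (run q adv ω r, ω r)) := by
        rw [lintegral_map hg (hr.prodMk hω)]; rfl
    _ = ∫⁻ p, U (extend q adv p.1 p.2)
          ∂((coinMeasure k).map (fun ω => run q adv ω r)).prod (coinRow k) := by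
        rw [(ProbabilityTheory.indepFun_iff_map_prod_eq_prod_map_map hr.aemeasurable
          hω.aemeasurable).1 (indepFun_run r), hmap]
    _ = ∫⁻ h, ∫⁻ x, U (extend q adv h x) ∂coinRow k
          ∂(coinMeasure k).map (fun ω => run q adv ω r) :=
        lintegral_prod _ hg.aemeasurable
    _ = _ := by
        rw [lintegral_map Measurable.of_discrete hr]

/-- Thus the event that `P` has occurred is a function of the current history, which is what
stopping the potential requires. -/
theorem past_run (ω : Coins k) (r : ℕ) (P : (Fin k → State) → Prop) :
    (∃ b ∈ (run q adv ω r).past, P b.state) ↔ ∃ i < r, P (run q adv ω i).now := by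
  induction r with
  | zero => simp [run]
  | succ r ih =>
    rw [run_succ]
    unfold extend
    simp only [List.mem_append, List.mem_singleton, or_and_right, exists_or, ih, exists_eq_left]
    constructor
    · rintro (⟨i, hi, h⟩ | h)
      · exact ⟨i, by omega, h⟩
      · exact ⟨r, by omega, h⟩
    · rintro ⟨i, hi, h⟩
      rcases Nat.lt_succ_iff_lt_or_eq.1 hi with hi | rfl
      · exact .inl ⟨i, hi, h⟩
      · exact .inr h

open Classical in
/-- The maximal inequality for a potential that does not increase in expectation. -/
theorem measure_exists_run_le (V : (Fin k → State) → ENNReal) (P : (Fin k → State) → Prop)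
    (hV : ∀ s, Regular s → ¬ P s → ∀ wake,
      ∫⁻ x, V (nextStates q s wake x) ∂coinRow k ≤ V s)
    (hP : ∀ s, P s → 1 ≤ V s) :
    coinMeasure k {ω | ∃ r, P (run q adv ω r).now} ≤ V fun _ => .asleep := by
  -- The potential, stopped at the value `1` one round after `P` first holds; `hP` makes this last
  -- step downwards.
  let U : History k → ENNReal := fun h => if ∃ b ∈ h.past, P b.state then 1 else V h.now
  have hstep : ∀ h : History k, Regular h.now →
      ∫⁻ x, U (extend q adv h x) ∂coinRow k ≤ U h := by
    intro h hreg
    by_cases hpast : ∃ b ∈ h.past, P b.state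
    · have h1 : ∀ x, U (extend q adv h x) = 1 := fun x => if_pos <| by
        obtain ⟨b, hb, hPb⟩ := hpast
        exact ⟨b, by simp [extend, hb], hPb⟩
      simp [h1, U, hpast]
    by_cases hnow : P h.now
    · have h1 : ∀ x, U (extend q adv h x) = 1 := fun x =>
        if_pos ⟨⟨h.now, transmissions q h.now x⟩, by simp [extend], hnow⟩
      simp only [h1, lintegral_const, measure_univ, mul_one, U, if_neg hpast]
      exact hP _ hnow
    · have h1 : ∀ x, U (extend q adv h x) = V (nextStates q h.now (adv h) x) := fun x =>
        if_neg <| by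
          rintro ⟨b, hb, hPb⟩
          simp only [extend, List.mem_append, List.mem_singleton] at hb
          rcases hb with hb | rfl
          · exact hpast ⟨b, hb, hPb⟩
          · exact hnow hPb
      simp only [h1, U, if_neg hpast]
      exact hV _ hreg hnow _
  have hU : ∀ r, ∫⁻ ω, U (run q adv ω r) ∂coinMeasure k ≤ V fun _ => .asleep := by
    intro r
    induction r with
    | zero => simp [run, U]
    | succ r ih =>
      rw [lintegral_run_succ]
      exact (lintegral_mono fun ω => hstep _ (regular_run adv ω r)).trans ih
  have hr : ∀ r, coinMeasure k {ω | ∃ i < r, P (run q adv ω i).now} ≤ V fun _ => .asleep := by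
    intro r
    refine le_trans ?_ (hU r)
    have hmeas : MeasurableSet {ω | ∃ i < r, P (run q adv ω i).now} := by
      simp only [← past_run]
      exact measurable_run r (MeasurableSet.of_discrete (s := {h | ∃ b ∈ h.past, P b.state}))
    rw [← lintegral_indicator_one hmeas]
    refine lintegral_mono fun ω => ?_
    by_cases h : ∃ i < r, P (run q adv ω i).now
    · have h' := h
      rw [← past_run] at h'
      simp [U, h, h']
    · simp [Set.indicator, h]
  have hunion : {ω | ∃ r, P (run q adv ω r).now} =
      ⋃ r, {ω | ∃ i < r, P (run q adv ω i).now} := by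
    ext ω
    simp only [Set.mem_ofPred_eq, Set.mem_iUnion]
    exact ⟨fun ⟨r, h⟩ => ⟨r + 1, r, by omega, h⟩, fun ⟨_, i, _, h⟩ => ⟨i, h⟩⟩
  rw [hunion, Monotone.measure_iUnion]
  · exact iSup_le hr
  · intro a b hab ω
    simp only [Set.mem_ofPred_eq]
    rintro ⟨i, hi, h⟩
    exact ⟨i, by omega, h⟩

end

/-! ### The total contention of an election -/

/-- A lower bound for the probability of a successful transmission when the transmission probabilities
add up to `s`. -/
noncomputable def successBound (s : ℝ) : ℝ := s * Real.exp (-2 * s)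

theorem successBound_nonneg {s : ℝ} (h : 0 ≤ s) : 0 ≤ successBound s :=
  mul_nonneg h (Real.exp_nonneg _)

theorem successBound_zero : successBound 0 = 0 := by simp [successBound]

theorem exp_neg_two_ge : (1 / 8 : ℝ) ≤ Real.exp (-2) := by
  have h1 : Real.exp 2 ≤ 8 := by
    have h := Real.exp_one_lt_d9
    have h2 : Real.exp 2 = Real.exp 1 * Real.exp 1 := by rw [← Real.exp_add]; norm_num
    have h0 := Real.exp_pos 1
    rw [h2]
    nlinarith
  rw [Real.exp_neg, one_div]
  exact inv_anti₀ (Real.exp_pos _) h1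

theorem div_eight_le_successBound {s : ℝ} (h0 : 0 ≤ s) (h1 : s ≤ 1) :
    s / 8 ≤ successBound s := by
  have h2 : Real.exp (-2) ≤ Real.exp (-2 * s) := Real.exp_le_exp.2 (by linarith)
  have := exp_neg_two_ge
  unfold successBound
  nlinarith

/-- The function `s * exp (-2 * s)` is not monotone: up to `1` its linear factor is used, and above
`1` only the exponential. -/
theorem min_le_successBound {s₀ s S : ℝ} (h0 : 0 ≤ s₀) (h1 : s₀ ≤ s) (h2 : s ≤ S) :
    min (s₀ / 8) (Real.exp (-2 * S)) ≤ successBound s := by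
  rcases le_total s 1 with h | h
  · refine (min_le_left _ _).trans ?_
    have := div_eight_le_successBound (h0.trans h1) h
    linarith
  · refine (min_le_right _ _).trans ?_
    have h3 : Real.exp (-2 * S) ≤ Real.exp (-2 * s) := Real.exp_le_exp.2 (by linarith)
    have := Real.exp_pos (-2 * s)
    unfold successBound
    nlinarith

/-- The probability with which a station transmits in the `i`-th round of its election. -/
noncomputable def decrease (q : ℝ) (i : ℕ) : ℝ := q * (1 / (2 * q + i))

section
variable {q : ℝ}

theorem decrease_pos (hq : 0 < q) (i : ℕ) : 0 < decrease q i := by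
  unfold decrease; positivity

theorem decrease_le_half (hq : 0 < q) (i : ℕ) : decrease q i ≤ 1 / 2 := by
  unfold decrease
  rw [mul_one_div, div_le_div_iff₀ (by positivity) (by norm_num)]
  have : (0 : ℝ) ≤ i := Nat.cast_nonneg i
  linarith

theorem decrease_anti (hq : 0 < q) {i j : ℕ} (h : i ≤ j) : decrease q j ≤ decrease q i := by
  unfold decrease
  have : (i : ℝ) ≤ j := by exact_mod_cast h
  gcongr

theorem sum_decrease_le (hq : 1 ≤ q) (n : ℕ) :
    ∑ i ∈ Finset.range n, decrease q i ≤ q * (1 + Real.log n) := by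
  have h1 : (harmonic n : ℝ) ≤ 1 + Real.log n := harmonic_le_one_add_log n
  have h2 : ∑ i ∈ Finset.range n, decrease q i ≤ q * (harmonic n : ℝ) := by
    rw [harmonic]
    push_cast
    rw [Finset.mul_sum]
    refine Finset.sum_le_sum fun i _ => ?_
    unfold decrease
    rw [one_div]
    exact mul_le_mul_of_nonneg_left (inv_anti₀ (by positivity) (by linarith)) (by linarith)
  exact h2.trans (by gcongr)

/-- Comparison with the integral of `q / (2 * q + x)`; each step is `log (1 + x) ≤ x`. -/
theorem le_sum_Ico_decrease (hq : 0 < q) {a b : ℕ} (hab : a ≤ b) :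
    q * Real.log ((2 * q + b) / (2 * q + a)) ≤ ∑ i ∈ Finset.Ico a b, decrease q i := by
  induction b, hab using Nat.le_induction with
  | base => rw [div_self (by positivity)]; simp
  | succ b hab ih =>
    rw [Finset.sum_Ico_succ_top hab]
    have h1 : (0 : ℝ) < 2 * q + b := by positivity
    have h2 : (0 : ℝ) < 2 * q + a := by positivity
    have h3 : Real.log ((2 * q + (b + 1 : ℕ)) / (2 * q + a)) ≤
        Real.log ((2 * q + b) / (2 * q + a)) + 1 / (2 * q + b) := by
      have h4 : (2 * q + (b + 1 : ℕ)) / (2 * q + a) =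
          ((2 * q + b) / (2 * q + a)) * (1 + 1 / (2 * q + b)) := by
        push_cast; field_simp; ring
      rw [h4, Real.log_mul (by positivity) (by positivity)]
      have := Real.log_le_sub_one_of_pos (show (0 : ℝ) < 1 + 1 / (2 * q + b) by positivity)
      linarith
    have := mul_le_mul_of_nonneg_left h3 hq.le
    unfold decrease at *
    linarith

/-! ### Success bounds for arbitrary arrival times -/

variable {ι : Type*}

/-- The sum of the transmission probabilities in round `t` of an election in which the station `u`
takes part from round `τ u` on. -/
noncomputable def contentionAt (q : ℝ) (U : Finset ι) (τ : ι → ℕ) (t : ℕ) : ℝ :=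
  ∑ u ∈ U, if τ u ≤ t then decrease q (t - τ u) else 0

theorem contentionAt_nonneg (hq : 0 < q) (U : Finset ι) (τ : ι → ℕ) (t : ℕ) :
    0 ≤ contentionAt q U τ t := by
  refine Finset.sum_nonneg fun u _ => ?_
  split_ifs
  · exact (decrease_pos hq _).le
  · exact le_rfl

theorem sum_shift_decrease_le (hq : 0 < q) (n a : ℕ) :
    (∑ t ∈ Finset.range n, if a ≤ t then decrease q (t - a) else 0) ≤
      ∑ i ∈ Finset.range n, decrease q i := by
  rw [← Finset.sum_filter]
  have h1 : (Finset.range n).filter (fun t => a ≤ t) = Finset.Ico a n := by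
    ext t; simp [and_comm]
  rw [h1, Finset.sum_Ico_eq_sum_range]
  simp only [Nat.add_sub_cancel_left]
  exact Finset.sum_le_sum_of_subset_of_nonneg (Finset.range_subset_range.2 (Nat.sub_le _ _))
    fun i _ _ => (decrease_pos hq i).le

/-- Only the stations that have joined by round `n` contribute to the contention up to round `n`. -/
theorem sum_contentionAt_le (hq : 0 < q) (U : Finset ι) (τ : ι → ℕ) (n : ℕ) :
    ∑ t ∈ Finset.range n, contentionAt q U τ t ≤
      (U.filter fun u => τ u < n).card * ∑ i ∈ Finset.range n, decrease q i := by
  unfold contentionAt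
  rw [Finset.sum_comm, ← nsmul_eq_mul, ← Finset.sum_const, Finset.sum_filter]
  refine Finset.sum_le_sum fun u _ => ?_
  split_ifs with h
  · exact sum_shift_decrease_le hq n (τ u)
  · refine le_of_eq (Finset.sum_eq_zero fun t ht => if_neg ?_)
    rw [Finset.mem_range] at ht
    omega

theorem card_mul_decrease_le_contentionAt (hq : 0 < q) (U : Finset ι) (τ : ι → ℕ) {n t m : ℕ}
    (hn : n ≤ t) (hm : t ≤ m) :
    (U.filter fun u => τ u < n).card * decrease q m ≤ contentionAt q U τ t := by
  unfold contentionAt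
  rw [← nsmul_eq_mul, ← Finset.sum_const, Finset.sum_filter]
  refine Finset.sum_le_sum fun u _ => ?_
  by_cases h : τ u < n
  · rw [if_pos h, if_pos (by omega)]
    exact decrease_anti hq (by omega)
  · rw [if_neg h]
    split_ifs
    · exact (decrease_pos hq _).le
    · exact le_rfl

/-- Markov's inequality for the counting measure on `I`. -/
theorem card_filter_mul_le_sum {I : Finset ℕ} {g : ℕ → ℝ} (hg : ∀ t, 0 ≤ g t) (S : ℝ) :
    (I.filter fun t => S < g t).card * S ≤ ∑ t ∈ I, g t := by
  rw [← nsmul_eq_mul, ← Finset.sum_const]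
  refine (Finset.sum_le_sum fun t ht => (Finset.mem_filter.1 ht).2.le).trans ?_
  exact Finset.sum_le_sum_of_subset_of_nonneg (Finset.filter_subset _ _) fun t _ _ => hg t

/-- If many stations join the election early, then a success is likely in the rounds after that. -/
theorem sum_successBound_ge_of_many (hq : 1 ≤ q) {U : Finset ι} {τ : ι → ℕ} {k N : ℕ}
    (hU : U.card ≤ k) (hk : 0 < k) (hN : q ≤ N) :
    min ((U.filter fun u => τ u < N).card * q / 64)
        (N / 2 * Real.exp (-4 * k * (q * (1 + Real.log (2 * N : ℕ))) / N)) ≤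
      ∑ t ∈ Finset.range (2 * N), successBound (contentionAt q U τ t) := by
  have hq0 : 0 < q := by linarith
  have hN0 : (0 : ℝ) < N := by linarith
  have hk0 : (0 : ℝ) < k := by exact_mod_cast hk
  set m := (U.filter fun u => τ u < N).card
  set H := q * (1 + Real.log (2 * N : ℕ)) with hH
  have hlog : 0 ≤ Real.log (2 * N : ℕ) := Real.log_natCast_nonneg _
  have hH0 : 0 < H := by positivity
  -- Twice the mean contention per round of `I` allowed by the total `k * H`, so that at most half
  -- of these rounds exceed it.
  set S := 2 * k * H / N with hS
  have hS0 : 0 < S := by positivity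
  set g := contentionAt q U τ
  have hg : ∀ t, 0 ≤ g t := contentionAt_nonneg hq0 U τ
  set I := Finset.Ico N (2 * N)
  have hsum : ∑ t ∈ I, g t ≤ k * H := by
    calc ∑ t ∈ I, g t ≤ ∑ t ∈ Finset.range (2 * N), g t :=
          Finset.sum_le_sum_of_subset_of_nonneg
            (fun t ht => by simp only [I, Finset.mem_Ico] at ht; simpa using ht.2)
            fun t _ _ => hg t
      _ ≤ _ := sum_contentionAt_le hq0 U τ (2 * N)
      _ ≤ k * H := by
          have h1 : ((U.filter fun u => τ u < 2 * N).card : ℝ) ≤ k := by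
            exact_mod_cast (Finset.card_filter_le _ _).trans hU
          exact mul_le_mul h1 (sum_decrease_le hq _)
            (Finset.sum_nonneg fun i _ => (decrease_pos hq0 i).le) hk0.le
  have hbad : ((I.filter fun t => S < g t).card : ℝ) ≤ N / 2 := by
    have h1 := (card_filter_mul_le_sum hg S (I := I)).trans hsum
    have h2 : (N / 2 : ℝ) * S = k * H := by rw [hS]; field_simp
    rw [← h2] at h1
    exact le_of_mul_le_mul_right h1 hS0
  have hgood : (N / 2 : ℝ) ≤ (I.filter fun t => ¬ S < g t).card := by
    have h1 : (I.filter fun t => S < g t).card + (I.filter fun t => ¬ S < g t).card = N := by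
      rw [Finset.card_filter_add_card_filter_not]
      simp [I]; omega
    have h2 : ((I.filter fun t => S < g t).card : ℝ) + (I.filter fun t => ¬ S < g t).card = N := by
      exact_mod_cast h1
    linarith
  -- In each round of `I`, an early station transmits with at least the probability that belongs to
  -- counter `2 * N`.
  set s₀ := (m : ℝ) * decrease q (2 * N) with hs₀
  have hs0 : 0 ≤ s₀ := mul_nonneg (Nat.cast_nonneg _) (decrease_pos hq0 _).le
  have hterm : ∀ t ∈ I.filter (fun t => ¬ S < g t),
      min (s₀ / 8) (Real.exp (-2 * S)) ≤ successBound (g t) := by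
    intro t ht
    simp only [Finset.mem_filter, I, Finset.mem_Ico, not_lt] at ht
    exact min_le_successBound hs0
      (card_mul_decrease_le_contentionAt hq0 U τ ht.1.1 ht.1.2.le) ht.2
  have hmin0 : 0 ≤ min (s₀ / 8) (Real.exp (-2 * S)) := le_min (by positivity) (Real.exp_nonneg _)
  have hs₀' : m * q / 64 ≤ N / 2 * (s₀ / 8) := by
    rw [hs₀]
    unfold decrease
    have h1 : (1 / 4 : ℝ) ≤ N * (1 / (2 * q + (2 * N : ℕ))) := by
      rw [mul_one_div, div_le_div_iff₀ (by norm_num) (by positivity)]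
      push_cast
      linarith
    have h2 : 0 ≤ (m : ℝ) * q := by positivity
    nlinarith
  calc min (m * q / 64) (N / 2 * Real.exp (-4 * k * H / N))
      ≤ N / 2 * min (s₀ / 8) (Real.exp (-2 * S)) := by
        rw [mul_min_of_nonneg _ _ (by positivity)]
        refine min_le_min hs₀' (le_of_eq ?_)
        rw [hS]
        congr 2
        ring
    _ ≤ (I.filter fun t => ¬ S < g t).card * min (s₀ / 8) (Real.exp (-2 * S)) :=
        mul_le_mul_of_nonneg_right hgood hmin0
    _ = ∑ t ∈ I.filter (fun t => ¬ S < g t), min (s₀ / 8) (Real.exp (-2 * S)) := by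
        rw [Finset.sum_const, nsmul_eq_mul]
    _ ≤ ∑ t ∈ I.filter (fun t => ¬ S < g t), successBound (g t) := Finset.sum_le_sum hterm
    _ ≤ _ := Finset.sum_le_sum_of_subset_of_nonneg
        (fun t ht => by
          simp only [Finset.mem_filter, I, Finset.mem_Ico] at ht
          simpa using ht.1.2) fun t _ _ => successBound_nonneg (hg t)

/-- If only few stations join the election early, then the contention is low in most early rounds, and
the oldest station alone makes a success likely. -/
theorem sum_successBound_ge_of_few (hq : 1 ≤ q) {U : Finset ι} {τ : ι → ℕ} {N B : ℕ}
    {u₀ : ι} (hu₀ : u₀ ∈ U) (hτ : τ u₀ = 0) (hBN : B ≤ N)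
    (hB : (U.filter fun u => τ u < N).card * (q * (1 + Real.log N)) ≤ B) :
    q / 8 * (Real.log ((2 * q + N) / (2 * q + B)) - 1) ≤
      ∑ t ∈ Finset.range (2 * N), successBound (contentionAt q U τ t) := by
  have hq0 : 0 < q := by linarith
  set g := contentionAt q U τ
  have hg : ∀ t, 0 ≤ g t := contentionAt_nonneg hq0 U τ
  set I := Finset.Ico B N
  have hbad : ((I.filter fun t => 1 < g t).card : ℝ) ≤ B := by
    have h1 := card_filter_mul_le_sum hg 1 (I := I)
    rw [mul_one] at h1
    refine h1.trans ((Finset.sum_le_sum_of_subset_of_nonneg (t := Finset.range N) ?_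
      fun t _ _ => hg t).trans ((sum_contentionAt_le hq0 U τ N).trans (le_trans ?_ hB)))
    · intro t ht
      simp only [I, Finset.mem_Ico] at ht
      simpa using ht.2
    · exact mul_le_mul_of_nonneg_left (sum_decrease_le hq N) (Nat.cast_nonneg _)
  -- There are at most `B` crowded rounds, all from round `B` on. Leaving them out costs the oldest
  -- station at most `q`, which is the `- 1` of the statement.
  have hbadsum : ∑ t ∈ I.filter (fun t => 1 < g t), decrease q t ≤ q := by
    calc ∑ t ∈ I.filter (fun t => 1 < g t), decrease q t
        ≤ ∑ t ∈ I.filter (fun t => 1 < g t), decrease q B := by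
          refine Finset.sum_le_sum fun t ht => decrease_anti hq0 ?_
          simp only [Finset.mem_filter, I, Finset.mem_Ico] at ht
          exact ht.1.1
      _ = (I.filter fun t => 1 < g t).card * decrease q B := by
          rw [Finset.sum_const, nsmul_eq_mul]
      _ ≤ B * decrease q B := mul_le_mul_of_nonneg_right hbad (decrease_pos hq0 _).le
      _ ≤ q := by
          unfold decrease
          have h1 : (B : ℝ) * (1 / (2 * q + B)) ≤ 1 := by
            rw [mul_one_div, div_le_one (by positivity)]
            linarith
          nlinarith
  have hterm : ∀ t ∈ I.filter (fun t => ¬ 1 < g t), decrease q t / 8 ≤ successBound (g t) := by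
    intro t ht
    simp only [Finset.mem_filter, not_lt] at ht
    have h1 : decrease q t ≤ g t := by
      have h2 : (if τ u₀ ≤ t then decrease q (t - τ u₀) else 0) ≤ g t :=
        Finset.single_le_sum (f := fun u => if τ u ≤ t then decrease q (t - τ u) else 0)
          (fun u _ => by
            split_ifs
            · exact (decrease_pos hq0 _).le
            · exact le_rfl) hu₀
      simpa [hτ] using h2
    have := div_eight_le_successBound (hg t) ht.2
    linarith
  have hsplit := Finset.sum_filter_add_sum_filter_not I (fun t => 1 < g t) (decrease q)
  have hlow := le_sum_Ico_decrease hq0 hBN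
  calc q / 8 * (Real.log ((2 * q + N) / (2 * q + B)) - 1)
      ≤ (∑ t ∈ I.filter (fun t => ¬ 1 < g t), decrease q t) / 8 := by
        have : ∑ t ∈ I, decrease q t = ∑ t ∈ Finset.Ico B N, decrease q t := rfl
        linarith
    _ = ∑ t ∈ I.filter (fun t => ¬ 1 < g t), decrease q t / 8 := Finset.sum_div _ _ _
    _ ≤ ∑ t ∈ I.filter (fun t => ¬ 1 < g t), successBound (g t) := Finset.sum_le_sum hterm
    _ ≤ _ := Finset.sum_le_sum_of_subset_of_nonneg
        (fun t ht => by
          simp only [Finset.mem_filter, I, Finset.mem_Ico] at ht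
          simp; omega) fun t _ _ => successBound_nonneg (hg t)

/-- The first term of the minimum is the number of early stations times `q / 64 = Q`. In the second,
`c` exceeds `q` so far that the exponential is at least of order `1 / √(c * k)`; what remains is of
order `√(c * k)`, more than `Q * log k`. -/
theorem log_le_sum_of_many {Q : ℝ}
    (hQ : 1 ≤ Q) (hq : q = 64 * Q) {U : Finset ι} {τ : ι → ℕ}
    {k c : ℕ} (hk : 0 < k) (hU : U.card ≤ k)
    (hc : (c : ℝ) = (100 * q) ^ 2)
    (hm : Real.log k ≤ ((U.filter fun u => τ u < c * k).card : ℝ)) :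
    Q * Real.log k ≤
      ∑ t ∈ Finset.range (2 * (c * k)), successBound (contentionAt q U τ t) := by
  have hq1 : 1 ≤ q := by linarith
  have hq0 : 0 < q := by linarith
  have hk1 : (1 : ℝ) ≤ k := by exact_mod_cast hk
  have hk0 : (0 : ℝ) < k := by linarith
  have hc0 : (0 : ℝ) < c := by rw [hc]; positivity
  have hlogk : 0 ≤ Real.log k := Real.log_nonneg hk1
  have hcast : ((c * k : ℕ) : ℝ) = c * k := by push_cast; ring
  have hck0 : (0 : ℝ) < c * k := by positivity
  have hqc : q ≤ c := by rw [hc]; nlinarith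
  refine le_trans (le_min ?_ ?_)
    (sum_successBound_ge_of_many hq1 hU hk (by rw [hcast]; nlinarith))
  · rw [hq]; nlinarith
  · rw [hcast]
    have hlog : Real.log ((2 * (c * k) : ℕ) : ℝ) = Real.log 2 + Real.log (c * k) := by
      push_cast
      rw [Real.log_mul (by norm_num) (by positivity)]
    have hlog2 : Real.log 2 ≤ 1 := by
      have := Real.log_two_lt_d9; linarith
    have hlogck : 0 ≤ Real.log (c * k) := Real.log_nonneg (by nlinarith)
    rw [hlog]
    -- Because `8 * q ≤ c`, the exponent costs at most half of the logarithm, that is, a square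
    -- root.
    have hexp : -(1 / 2) * (2 + Real.log (c * k)) ≤
        -4 * k * (q * (1 + (Real.log 2 + Real.log (c * k)))) / (c * k) := by
      rw [le_div_iff₀ hck0]
      have h8 : 8 * q ≤ c := by rw [hc]; nlinarith
      have h1 : q * (1 + (Real.log 2 + Real.log (c * k))) ≤
          c / 8 * (2 + Real.log (c * k)) := by
        apply mul_le_mul (by linarith) (by linarith) (by
          have := Real.log_nonneg (show (1 : ℝ) ≤ 2 by norm_num)
          linarith) (by positivity)
      nlinarith
    have hval : Real.exp (-(1 / 2) * (2 + Real.log (c * k))) =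
        Real.exp (-1) * (Real.sqrt (c * k))⁻¹ := by
      rw [show -(1 / 2) * (2 + Real.log ((c : ℝ) * k)) = -1 + -(Real.log (c * k) / 2) by ring,
        Real.exp_add, Real.exp_neg (Real.log (c * k) / 2), ← Real.log_sqrt hck0.le,
        Real.exp_log (Real.sqrt_pos.2 hck0)]
    have hsq : Real.sqrt (c * k) = 100 * q * Real.sqrt k := by
      rw [Real.sqrt_mul hc0.le, hc, Real.sqrt_sq (by positivity)]
    have hlk : Real.log k ≤ 2 * Real.sqrt k := by
      have h1 := Real.log_le_sub_one_of_pos (Real.sqrt_pos.2 hk0)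
      rw [Real.log_sqrt hk0.le] at h1
      linarith
    have hs0 := Real.sqrt_pos.2 hk0
    calc Q * Real.log k ≤ Q * (2 * Real.sqrt k) := by gcongr
      _ ≤ Real.sqrt (c * k) / 16 := by rw [hsq, hq]; nlinarith
      _ = (c * k) / 2 * (1 / 8 * (Real.sqrt (c * k))⁻¹) := by
          have h1 : (c : ℝ) * k = Real.sqrt (c * k) * Real.sqrt (c * k) :=
            (Real.mul_self_sqrt hck0.le).symm
          have h2 : Real.sqrt ((c : ℝ) * k) ≠ 0 := (Real.sqrt_pos.2 hck0).ne'
          generalize hr : Real.sqrt ((c : ℝ) * k) = r at *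
          rw [h1]
          field_simp
          norm_num
      _ ≤ (c * k) / 2 * Real.exp (-(1 / 2) * (2 + Real.log (c * k))) := by
          rw [hval]
          have h1 : (1 / 8 : ℝ) ≤ Real.exp (-1) :=
            exp_neg_two_ge.trans (Real.exp_le_exp.2 (by norm_num))
          gcongr
      _ ≤ _ := by gcongr

/-- For fixed `q`, the number `B` of crowded rounds is at most of order `√k`, so the ratio inside
the logarithm is at least `3 * √k`. Half of `log k` survives, and the factor `3` absorbs the `- 1`.
-/
theorem log_le_sum_of_few {Q : ℝ}
    (hQ : 1 ≤ Q) (hq : q = 64 * Q) {U : Finset ι} {τ : ι → ℕ}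
    {k c : ℕ} (hk : 0 < k) {u₀ : ι} (hu₀ : u₀ ∈ U) (hτ : τ u₀ = 0)
    (hc : (c : ℝ) = (100 * q) ^ 2)
    (hm : ((U.filter fun u => τ u < c * k).card : ℝ) < Real.log k) :
    Q * Real.log k ≤
      ∑ t ∈ Finset.range (2 * (c * k)), successBound (contentionAt q U τ t) := by
  have hq1 : 1 ≤ q := by linarith
  have hq0 : 0 < q := by linarith
  have hk1 : (1 : ℝ) ≤ k := by exact_mod_cast hk
  have hk0 : (0 : ℝ) < k := by linarith
  have hc0 : (0 : ℝ) < c := by rw [hc]; positivity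
  have hlogk : 0 ≤ Real.log k := Real.log_nonneg hk1
  have hcast : ((c * k : ℕ) : ℝ) = c * k := by push_cast; ring
  -- By `log k ≤ 4 * y`, a product of two logarithms is at most of order `y ^ 2 = √k`, leaving
  -- another factor `y ^ 2` of `k` to spare.
  set y := (k : ℝ) ^ (1 / 4 : ℝ) with hy
  have hy1 : 1 ≤ y := Real.one_le_rpow hk1 (by norm_num)
  have hy4 : y ^ 4 = k := by
    rw [hy, ← Real.rpow_natCast, ← Real.rpow_mul hk0.le]; norm_num
  have hly : Real.log k ≤ 4 * y := by
    have := Real.log_le_rpow_div hk0.le (show (0 : ℝ) < 1 / 4 by norm_num)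
    rw [← hy] at this
    linarith
  have hlc : Real.log c ≤ 200 * q := by
    rw [hc, Real.log_pow]
    have := Real.log_le_sub_one_of_pos (show (0 : ℝ) < 100 * q by positivity)
    push_cast
    linarith
  set H := q * (1 + Real.log ((c * k : ℕ) : ℝ)) with hH
  have hH1 : H ≤ q * (1 + 200 * q + 4 * y) := by
    rw [hH, hcast, Real.log_mul hc0.ne' hk0.ne']
    exact mul_le_mul_of_nonneg_left (by linarith) hq0.le
  have hH0 : 0 ≤ H := by
    have : 0 ≤ Real.log ((c * k : ℕ) : ℝ) := Real.log_natCast_nonneg _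
    positivity
  set B := ⌈Real.log k * H⌉₊ with hB
  have hBle : (B : ℝ) ≤ 820 * q ^ 2 * y ^ 2 + 1 := by
    have h1 : (B : ℝ) < Real.log k * H + 1 := Nat.ceil_lt_add_one (by positivity)
    have h2 : Real.log k * H ≤ (4 * y) * (q * (1 + 200 * q + 4 * y)) := by gcongr
    have h3 : 1 + 200 * q + 4 * y ≤ 205 * q * y := by nlinarith
    have h4 : (4 * y) * (q * (1 + 200 * q + 4 * y)) ≤ (4 * y) * (q * (205 * q * y)) := by
      gcongr
    nlinarith
  have hden : 3 * y ^ 2 * (2 * q + B) ≤ c * k := by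
    have h1 : 2 * q + B ≤ 823 * q ^ 2 * y ^ 2 := by
      have hqq : q ≤ q ^ 2 := by nlinarith
      have hyy : 1 ≤ y ^ 2 := by nlinarith
      have hqy : q ^ 2 ≤ q ^ 2 * y ^ 2 := le_mul_of_one_le_right (by positivity) hyy
      linarith
    have h2 : (c : ℝ) * k = 10000 * q ^ 2 * y ^ 4 := by rw [hc, hy4]; ring
    have h3 : 3 * y ^ 2 * (2 * q + B) ≤ 3 * y ^ 2 * (823 * q ^ 2 * y ^ 2) := by gcongr
    have h4 : 0 ≤ q ^ 2 * y ^ 4 := by positivity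
    nlinarith
  have hBN : B ≤ c * k := by
    have h2 : (B : ℝ) ≤ ((c * k : ℕ) : ℝ) := by
      rw [hcast]
      have : (0 : ℝ) ≤ B := Nat.cast_nonneg _
      nlinarith
    exact_mod_cast h2
  refine le_trans ?_ (sum_successBound_ge_of_few hq1 hu₀ hτ hBN ?_)
  · have hd0 : 0 < 2 * q + (B : ℝ) := by positivity
    have h1 : 3 * y ^ 2 ≤ (2 * q + (c * k : ℕ)) / (2 * q + B) := by
      rw [le_div_iff₀ hd0, hcast]
      linarith
    have h2 : 1 + Real.log k / 2 ≤ Real.log ((2 * q + (c * k : ℕ)) / (2 * q + B)) := by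
      refine le_trans ?_ (Real.log_le_log (by positivity) h1)
      have h3 : Real.log (y ^ 2) = Real.log k / 2 := by
        rw [← hy4, Real.log_pow, Real.log_pow]; push_cast; ring
      have h4 : 1 ≤ Real.log 3 := by
        rw [Real.le_log_iff_exp_le (by norm_num)]
        have := Real.exp_one_lt_d9
        linarith
      rw [Real.log_mul (by norm_num) (by positivity), h3]
      linarith
    have h3 := mul_le_mul_of_nonneg_left h2 (show 0 ≤ q / 8 by positivity)
    have h4 : 0 ≤ Q * Real.log k := by positivity
    have h5 : q / 8 * (1 + Real.log k / 2) = q / 8 + 4 * (Q * Real.log k) := by rw [hq]; ring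
    linarith
  · rw [← hH]
    exact (mul_le_mul_of_nonneg_right hm.le hH0).trans (Nat.le_ceil _)

theorem log_le_sum_successBound {Q : ℝ}
    (hQ : 1 ≤ Q) (hq : q = 64 * Q) {U : Finset ι} {τ : ι → ℕ}
    {k c : ℕ} (hk : 0 < k) (hU : U.card ≤ k) {u₀ : ι} (hu₀ : u₀ ∈ U) (hτ : τ u₀ = 0)
    (hc : (c : ℝ) = (100 * q) ^ 2) :
    Q * Real.log k ≤
      ∑ t ∈ Finset.range (2 * (c * k)), successBound (contentionAt q U τ t) := by
  by_cases hm : Real.log k ≤ ((U.filter fun u => τ u < c * k).card : ℝ)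
  · exact log_le_sum_of_many hQ hq hk hU hc hm
  · exact log_le_sum_of_few hQ hq hk hu₀ hτ hc (not_le.1 hm)

end

/-! ### A single contention window -/

/-- Integrating out one coordinate first. -/
theorem lintegral_coinRow_update {k : ℕ} (i : Fin k) {f : (Fin k → unitInterval) → ENNReal}
    (hf : Measurable f) :
    ∫⁻ x, f x ∂coinRow k =
      ∫⁻ x, (∫⁻ y : unitInterval, f (Function.update x i y)) ∂coinRow k := by
  set g : (Fin k → unitInterval) → ENNReal := fun x => ∫⁻ y : unitInterval, f (Function.update x i y) with hg
  have hgm : Measurable g := by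
    refine Measurable.lintegral_prod_right' (f := fun p : (Fin k → unitInterval) × unitInterval =>
      f (Function.update p.1 i p.2)) (hf.comp ?_)
    exact measurable_update'
  have h1 : ∀ h : (Fin k → unitInterval) → ENNReal, Measurable h → ∫⁻ x, h x ∂coinRow k =
      (∫⋯∫⁻_(Finset.univ.erase i), (fun x => ∫⁻ y : unitInterval, h (Function.update x i y))
        ∂fun _ => (volume : Measure unitInterval)) (fun _ => 0) := by
    intro h hm
    unfold coinRow
    rw [lintegral_eq_lmarginal_univ (fun _ : Fin k => (0 : unitInterval)),
      lmarginal_erase' h hm (Finset.mem_univ i)]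
  -- Since `g` does not depend on coordinate `i`, averaging it over that coordinate changes nothing.
  rw [h1 f hf, h1 g hgm]
  congr 1
  funext x
  simp [hg]

/-- The stations of `S` that will not transmit successfully in the rest of a window of size `w` that
has reached slot `pos`, when their slots are given by `σ`. -/
def collided {k : ℕ} (S : Finset (Fin k)) (σ : Fin k → ℕ) (pos w : ℕ) : Finset (Fin k) :=
  S.filter fun u => ¬ (pos ≤ σ u ∧ σ u < w ∧ ∀ v ∈ S, σ v = σ u → v = u)

theorem mem_collided {k : ℕ} {S : Finset (Fin k)} {σ : Fin k → ℕ} {pos w : ℕ} {u : Fin k} :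
    u ∈ collided S σ pos w ↔
      u ∈ S ∧ ¬ (pos ≤ σ u ∧ σ u < w ∧ ∀ v ∈ S, σ v = σ u → v = u) := by
  simp [collided]

theorem collided_congr {k : ℕ} {S : Finset (Fin k)} {σ σ' : Fin k → ℕ} {pos w : ℕ}
    (h : ∀ u ∈ S, σ u = σ' u) : collided S σ pos w = collided S σ' pos w := by
  ext u
  simp only [mem_collided]
  constructor
  all_goals
    rintro ⟨hu, hn⟩
    refine ⟨hu, fun ⟨h1, h2, h3⟩ => hn ⟨by rwa [h u hu] at *, by rwa [h u hu] at *, ?_⟩⟩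
    intro v hv hvu
    refine h3 v hv ?_
    first
    | rwa [← h v hv, ← h u hu]
    | rwa [h v hv, h u hu]

theorem card_collided_le {k : ℕ} (S : Finset (Fin k)) (σ : Fin k → ℕ) (pos w : ℕ) :
    (collided S σ pos w).card ≤ S.card := Finset.card_filter_le _ _

/-- One more station causes at most two more collided stations, and none if it has a slot of its
own. -/
theorem card_collided_insert_le {k : ℕ} {S : Finset (Fin k)} {i : Fin k}
    (σ : Fin k → ℕ) (w : ℕ) :
    (collided (insert i S) σ 0 w).card ≤
      (collided S σ 0 w).card + if w ≤ σ i ∨ σ i ∈ S.image σ then 2 else 0 := by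
  classical
  split_ifs with h
  -- These are the stations that collide only because of `i`. Two of them would share a slot and so
  -- would have collided before.
  · set T := (S.filter fun v => σ v = σ i) \ collided S σ 0 w with hT
    have hT1 : T.card ≤ 1 := by
      rw [Finset.card_le_one]
      intro a ha b hb
      simp only [hT, Finset.mem_sdiff, Finset.mem_filter, mem_collided] at ha hb
      exact (not_not.1 fun hn => hb.2 ⟨hb.1.1, hn⟩).2.2 a ha.1.1 (ha.1.2.trans hb.1.2.symm)
    have hsub : collided (insert i S) σ 0 w ⊆ insert i (collided S σ 0 w ∪ T) := by
      intro u hu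
      rw [mem_collided, Finset.mem_insert] at hu
      rw [Finset.mem_insert, Finset.mem_union]
      obtain ⟨rfl | huS, hn⟩ := hu
      · exact .inl rfl
      by_cases hc : u ∈ collided S σ 0 w
      · exact .inr (.inl hc)
      by_cases hui : σ u = σ i
      · exact .inr (.inr (by simp [hT, huS, hui, hc]))
      · exfalso
        rw [mem_collided, not_and, not_not] at hc
        obtain ⟨h1, h2, h3⟩ := hc huS
        refine hn ⟨h1, h2, fun v hv hvu => ?_⟩
        rcases Finset.mem_insert.1 hv with rfl | hv
        · exact absurd hvu.symm hui
        · exact h3 v hv hvu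
    calc _ ≤ _ := Finset.card_le_card hsub
      _ ≤ (collided S σ 0 w ∪ T).card + 1 := Finset.card_insert_le _ _
      _ ≤ (collided S σ 0 w).card + T.card + 1 := by gcongr; exact Finset.card_union_le _ _
      _ ≤ _ := by omega
  · push Not at h
    rw [add_zero]
    refine Finset.card_le_card fun u hu => ?_
    rw [mem_collided, Finset.mem_insert] at hu
    have hi : ∀ v ∈ S, σ v ≠ σ i := fun v hv he => h.2 (Finset.mem_image.2 ⟨v, hv, he⟩)
    obtain ⟨rfl | huS, hn⟩ := hu
    · exfalso
      refine hn ⟨Nat.zero_le _, h.1, fun v hv hvu => ?_⟩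
      rcases Finset.mem_insert.1 hv with rfl | hv
      · rfl
      · exact absurd hvu (hi v hv)
    · rw [mem_collided]
      refine ⟨huS, fun ⟨h1, h2, h3⟩ => hn ⟨h1, h2, fun v hv hvu => ?_⟩⟩
      rcases Finset.mem_insert.1 hv with rfl | hv
      · exact absurd hvu.symm (hi u huS)
      · exact h3 v hv hvu

/-- The slot of a window of size `2 ^ cur` given by the coin `y`. -/
noncomputable def slotOf (cur : ℕ) (y : unitInterval) : ℕ := ⌊(2 : ℝ) ^ cur * (y : ℝ)⌋₊

theorem measurable_slotOf (cur : ℕ) : Measurable (slotOf cur) :=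
  Nat.measurable_floor.comp (by fun_prop)

theorem slotOf_le (cur : ℕ) (y : unitInterval) : slotOf cur y ≤ 2 ^ cur := by
  have h1 : (2 : ℝ) ^ cur * (y : ℝ) ≤ ((2 ^ cur : ℕ) : ℝ) := by
    push_cast
    exact mul_le_of_le_one_right (by positivity) y.2.2
  exact Nat.floor_le_of_le h1

theorem volume_slotOf_eq_le (cur j : ℕ) :
    volume {y : unitInterval | slotOf cur y = j} ≤ ((2 : ENNReal) ^ cur)⁻¹ := by
  have h2 : (0 : ℝ) < 2 ^ cur := by positivity
  rw [unitInterval.volume_apply]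
  have hsub : Subtype.val '' {y : unitInterval | slotOf cur y = j} ⊆
      Set.Icc ((j : ℝ) / 2 ^ cur) ((j + 1) / 2 ^ cur) := by
    rintro _ ⟨y, hy, rfl⟩
    have hy' : slotOf cur y = j := hy
    unfold slotOf at hy'
    rw [Nat.floor_eq_iff (mul_nonneg h2.le y.2.1)] at hy'
    constructor
    · rw [div_le_iff₀ h2]; linarith [hy'.1]
    · rw [le_div_iff₀ h2]; linarith [hy'.2]
  refine (measure_mono hsub).trans ?_
  rw [Real.volume_Icc, ← sub_div, add_sub_cancel_left, one_div,
    ENNReal.ofReal_inv_of_pos h2, ENNReal.ofReal_pow (by norm_num)]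
  simp

/-- The additional value `2 ^ cur` comes from the coin `1`, whose slot lies outside the window; it
is treated as one more occupied slot. -/
theorem volume_slotOf_mem_le {k : ℕ} (cur : ℕ) (S : Finset (Fin k)) (σ : Fin k → ℕ) :
    volume {y : unitInterval | 2 ^ cur ≤ slotOf cur y ∨ slotOf cur y ∈ S.image σ} ≤
      (S.card + 1 : ℕ) * ((2 : ENNReal) ^ cur)⁻¹ := by
  classical
  have hsub : {y : unitInterval | 2 ^ cur ≤ slotOf cur y ∨ slotOf cur y ∈ S.image σ} ⊆
      ⋃ j ∈ insert (2 ^ cur) (S.image σ), {y : unitInterval | slotOf cur y = j} := by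
    intro y hy
    simp only [Set.mem_iUnion]
    refine ⟨slotOf cur y, ?_, rfl⟩
    rcases hy with hy | hy
    · exact Finset.mem_insert.2 (.inl (le_antisymm (slotOf_le cur y) hy))
    · exact Finset.mem_insert.2 (.inr hy)
  refine (measure_mono hsub).trans ((measure_biUnion_finset_le _ _).trans ?_)
  refine (Finset.sum_le_sum fun j _ => volume_slotOf_eq_le cur j).trans ?_
  rw [Finset.sum_const, nsmul_eq_mul]
  gcongr
  exact (Finset.card_insert_le _ _).trans (by gcongr; exact Finset.card_image_le)

theorem measurable_collided {k : ℕ} (S : Finset (Fin k)) (cur pos w : ℕ) :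
    Measurable fun x : Fin k → unitInterval => collided S (fun u => slotOf cur (x u)) pos w := by
  have h1 : Measurable fun (x : Fin k → unitInterval) (u : Fin k) => slotOf cur (x u) :=
    measurable_pi_lambda _ fun u => (measurable_slotOf cur).comp (measurable_pi_apply u)
  exact (Measurable.of_discrete (f := fun σ : Fin k → ℕ => collided S σ pos w)).comp h1

/-- The moment generating function of the number of collided stations of a window. -/
theorem lintegral_two_pow_card_collided_le {k : ℕ} (cur n : ℕ) (S : Finset (Fin k))
    (hS : S.card ≤ n) :
    ∫⁻ x, (2 : ENNReal) ^ (collided S (fun u => slotOf cur (x u)) 0 (2 ^ cur)).card ∂coinRow k ≤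
      (1 + 3 * (n * ((2 : ENNReal) ^ cur)⁻¹)) ^ S.card := by
  classical
  induction S using Finset.induction_on with
  | empty => simp [collided]
  | insert i S hi ih =>
    rw [Finset.card_insert_of_notMem hi] at hS ⊢
    set σ : (Fin k → unitInterval) → Fin k → ℕ := fun x u => slotOf cur (x u) with hσ
    have hm : ∀ T : Finset (Fin k), Measurable fun x : Fin k → unitInterval =>
        (2 : ENNReal) ^ (collided T (σ x) 0 (2 ^ cur)).card := fun T =>
      (Measurable.of_discrete (f := fun D : Finset (Fin k) => (2 : ENNReal) ^ D.card)).comp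
        (measurable_collided T cur 0 (2 ^ cur))
    have hinner : ∀ x, ∫⁻ y, (2 : ENNReal) ^
          (collided (insert i S) (σ (Function.update x i y)) 0 (2 ^ cur)).card ≤
        2 ^ (collided S (σ x) 0 (2 ^ cur)).card * (1 + 3 * (n * ((2 : ENNReal) ^ cur)⁻¹)) := by
      intro x
      set A := {y : unitInterval | 2 ^ cur ≤ slotOf cur y ∨ slotOf cur y ∈ S.image (σ x)} with hA
      have hAm : MeasurableSet A := measurable_slotOf cur
        (MeasurableSet.of_discrete (s := {j : ℕ | 2 ^ cur ≤ j ∨ j ∈ S.image (σ x)}))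
      have hS' : ∀ y, ∀ u ∈ S, σ (Function.update x i y) u = σ x u := by
        intro y u hu
        simp only [hσ]
        rw [Function.update_of_ne (fun h : u = i => hi (h ▸ hu))]
      -- The slot of `i` is revealed last. An occupied slot adds at most two collided stations, a
      -- factor `2 ^ 2 = 1 + 3`.
      have hpt : ∀ y, (2 : ENNReal) ^
          (collided (insert i S) (σ (Function.update x i y)) 0 (2 ^ cur)).card ≤
          2 ^ (collided S (σ x) 0 (2 ^ cur)).card * (1 + A.indicator (fun _ => 3) y) := by
        intro y
        have h1 := card_collided_insert_le (S := S) (i := i) (σ (Function.update x i y)) (2 ^ cur)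
        rw [collided_congr (hS' y), Finset.image_congr (fun u hu => hS' y u hu)] at h1
        have h2 : σ (Function.update x i y) i = slotOf cur y := by simp [hσ]
        rw [h2] at h1
        refine (pow_le_pow_right₀ (by norm_num) h1).trans ?_
        rw [pow_add]
        gcongr
        by_cases hy : y ∈ A
        · rw [if_pos (show _ ∨ _ from hy), Set.indicator_of_mem hy]; norm_num
        · rw [if_neg (show ¬ (_ ∨ _) from hy), Set.indicator_of_notMem hy]; norm_num
      refine (lintegral_mono hpt).trans ?_
      rw [lintegral_const_mul' _ _ (by finiteness), lintegral_add_left measurable_const,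
        lintegral_const, lintegral_indicator_const hAm, measure_univ, mul_one]
      gcongr
      refine (volume_slotOf_mem_le cur S (σ x)).trans ?_
      gcongr
    rw [lintegral_coinRow_update i (hm (insert i S))]
    refine (lintegral_mono hinner).trans ?_
    rw [lintegral_mul_const _ (hm S), pow_succ]
    gcongr
    exact ih (by omega)

/-- A crowded window reduces the number of stations by a constant factor. -/
theorem coinRow_lt_card_collided_le {k : ℕ} {cur b : ℕ} {S : Finset (Fin k)}
    (hb : S.card ≤ 16 * b) (hw : 256 * S.card ≤ 2 ^ cur) :
    coinRow k {x | b < (collided S (fun u => slotOf cur (x u)) 0 (2 ^ cur)).card} ≤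
      (3 / 4) ^ b := by
  set X := fun x : Fin k → unitInterval =>
    (collided S (fun u => slotOf cur (x u)) 0 (2 ^ cur)).card
  -- Markov's inequality for `2 ^ X`, together with `(1 + 3 / 256) ^ 16 ≤ 3 / 2`.
  have h1 : (2 : ENNReal) ^ b * coinRow k {x | b < X x} ≤ (3 / 2) ^ b := by
    have hm : Measurable fun x => (2 : ENNReal) ^ X x :=
      (Measurable.of_discrete (f := fun D : Finset (Fin k) => (2 : ENNReal) ^ D.card)).comp
        (measurable_collided S cur 0 (2 ^ cur))
    have h2 : (2 : ENNReal) ^ b * coinRow k {x | b < X x} ≤ ∫⁻ x, (2 : ENNReal) ^ X x ∂coinRow k := by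
      refine le_trans ?_ (mul_meas_ge_le_lintegral hm (2 ^ b))
      gcongr with x
      intro hx
      exact pow_le_pow_right₀ (by norm_num) (le_of_lt hx)
    refine h2.trans ((lintegral_two_pow_card_collided_le cur _ S le_rfl).trans ?_)
    have h3 : 1 + 3 * ((S.card : ENNReal) * ((2 : ENNReal) ^ cur)⁻¹) ≤
        ENNReal.ofReal (1 + 3 / 256) := by
      have h4 : (S.card : ENNReal) * ((2 : ENNReal) ^ cur)⁻¹ =
          ENNReal.ofReal (S.card * (2 ^ cur)⁻¹) := by
        rw [ENNReal.ofReal_mul (by positivity), ENNReal.ofReal_inv_of_pos (by positivity),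
          ENNReal.ofReal_pow (by norm_num)]
        simp
      have h5 : (S.card : ℝ) * (2 ^ cur)⁻¹ ≤ 1 / 256 := by
        rw [← div_eq_mul_inv, div_le_div_iff₀ (by positivity) (by norm_num)]
        have : (256 * S.card : ℝ) ≤ 2 ^ cur := by exact_mod_cast hw
        linarith
      rw [h4, show (1 : ENNReal) = ENNReal.ofReal 1 by simp,
        show (3 : ENNReal) = ENNReal.ofReal 3 by simp, ← ENNReal.ofReal_mul (by norm_num),
        ← ENNReal.ofReal_add (by norm_num) (by positivity)]
      exact ENNReal.ofReal_le_ofReal (by linarith)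
    calc _ ≤ (ENNReal.ofReal (1 + 3 / 256)) ^ S.card := by gcongr
      _ ≤ (ENNReal.ofReal (1 + 3 / 256)) ^ (16 * b) :=
          pow_le_pow_right₀ (by rw [ENNReal.one_le_ofReal]; norm_num) hb
      _ = (ENNReal.ofReal ((1 + 3 / 256) ^ 16)) ^ b := by
          rw [pow_mul, ENNReal.ofReal_pow (by norm_num)]
      _ ≤ (ENNReal.ofReal (3 / 2)) ^ b := by
          gcongr; norm_num
      _ = (3 / 2) ^ b := by
          rw [ENNReal.ofReal_div_of_pos (by norm_num)]; norm_num
  have h2 : (2 : ENNReal) ^ b ≠ 0 := by positivity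
  have h3 : (2 : ENNReal) ^ b ≠ ⊤ := by finiteness
  rw [← ENNReal.mul_le_mul_iff_right h2 h3]
  refine h1.trans (le_of_eq ?_)
  rw [← mul_pow]
  congr 1
  have : (2 : ENNReal) * (3 / 4) = ENNReal.ofReal (2 * (3 / 4)) := by
    rw [ENNReal.ofReal_mul (by norm_num), ENNReal.ofReal_div_of_pos (by norm_num)]; norm_num
  rw [this, show (2 * (3 / 4) : ℝ) = 3 / 2 by norm_num, ENNReal.ofReal_div_of_pos (by norm_num)]
  norm_num

/-- In a large window, it is unlikely that there is a collision at all. -/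
theorem coinRow_collided_nonempty_le {k : ℕ} {cur M : ℕ} {S : Finset (Fin k)}
    (hw : 6 * S.card ^ 2 * M ≤ 2 ^ cur) (hM : 0 < M) :
    coinRow k {x | 0 < (collided S (fun u => slotOf cur (x u)) 0 (2 ^ cur)).card} ≤
      (M : ENNReal)⁻¹ := by
  set X := fun x : Fin k → unitInterval =>
    (collided S (fun u => slotOf cur (x u)) 0 (2 ^ cur)).card
  set A := {x | 0 < X x}
  have hAm : MeasurableSet A := (measurable_collided S cur 0 (2 ^ cur))
    (MeasurableSet.of_discrete (s := {D : Finset (Fin k) | 0 < D.card}))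
  -- The indicator of `0 < X` is at most `2 ^ X - 1`, so the generating function bounds the
  -- probability directly.
  have h1 : 1 + coinRow k A ≤ 1 + (M : ENNReal)⁻¹ := by
    have h2 : 1 + coinRow k A ≤ ∫⁻ x, (2 : ENNReal) ^ X x ∂coinRow k := by
      have h3 : 1 + coinRow k A = ∫⁻ x, (1 + A.indicator 1 x) ∂coinRow k := by
        rw [lintegral_add_left measurable_const, lintegral_indicator_one hAm]; simp
      rw [h3]
      refine lintegral_mono fun x => ?_
      by_cases hx : x ∈ A
      · rw [Set.indicator_of_mem hx]
        have h4 : (2 : ENNReal) ^ 1 ≤ 2 ^ X x := pow_le_pow_right₀ (by norm_num) hx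
        simpa [one_add_one_eq_two] using h4
      · rw [Set.indicator_of_notMem hx, add_zero]
        exact one_le_pow₀ (by norm_num)
    refine h2.trans ((lintegral_two_pow_card_collided_le cur _ S le_rfl).trans ?_)
    set y : ℝ := S.card * (2 ^ cur)⁻¹ with hy
    have hy0 : 0 ≤ y := by positivity
    have h4 : (S.card : ENNReal) * ((2 : ENNReal) ^ cur)⁻¹ = ENNReal.ofReal y := by
      rw [ENNReal.ofReal_mul (by positivity), ENNReal.ofReal_inv_of_pos (by positivity),
        ENNReal.ofReal_pow (by norm_num)]
      simp
    clear_value y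
    have h5 : 1 + 3 * ENNReal.ofReal y = ENNReal.ofReal (1 + 3 * y) := by
      rw [ENNReal.ofReal_add (by norm_num) (by positivity), ENNReal.ofReal_mul (by norm_num)]
      simp
    have hM0 : (0 : ℝ) < M := by exact_mod_cast hM
    have h6 : (1 + 3 * y) ^ S.card ≤ 1 + (M : ℝ)⁻¹ := by
      have h7 : (1 + 3 * y) ^ S.card ≤ Real.exp (3 * y * S.card) := by
        rw [mul_comm (3 * y), Real.exp_nat_mul]
        gcongr
        linarith [Real.add_one_le_exp (3 * y)]
      set z := 3 * y * S.card with hz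
      have hz0 : 0 ≤ z := by positivity
      have hz1 : z ≤ (M : ℝ)⁻¹ / 2 := by
        have h8 : (6 * S.card ^ 2 * M : ℝ) ≤ 2 ^ cur := by exact_mod_cast hw
        rw [hz, hy, show 3 * ((S.card : ℝ) * (2 ^ cur)⁻¹) * S.card = 3 * S.card ^ 2 / 2 ^ cur by
          ring, inv_eq_one_div, div_div, div_le_div_iff₀ (by positivity) (by positivity)]
        linarith
      have hM1 : (M : ℝ)⁻¹ ≤ 1 := inv_le_one_of_one_le₀ (by exact_mod_cast hM)
      have hz2 : z ≤ 1 / 2 := by linarith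
      have h9 : Real.exp z ≤ 1 + 2 * z := by
        have h10 : 1 - z ≤ Real.exp (-z) := by linarith [Real.add_one_le_exp (-z)]
        have h11 : Real.exp z * Real.exp (-z) = 1 := by rw [← Real.exp_add]; simp
        have h12 := Real.exp_pos z
        have h13 : Real.exp z * (1 - z) ≤ 1 := by nlinarith
        nlinarith
      linarith
    rw [h4, h5, ← ENNReal.ofReal_pow (by positivity)]
    refine (ENNReal.ofReal_le_ofReal h6).trans (le_of_eq ?_)
    rw [ENNReal.ofReal_add (by norm_num) (by positivity), ENNReal.ofReal_inv_of_pos hM0]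
    simp
  exact (ENNReal.add_le_add_iff_left (by norm_num)).1 h1

/-! ### The windows of `SUniform` -/

/-- The number of stations that the window of size `2 ^ cur` can cope with. -/
def capacity (L cur : ℕ) : ℕ := 4 * 2 ^ (5 * L - 4 * (10 + 5 * L - cur))

/-- A bound for the probability that some of `n` stations do not transmit successfully in the windows of
sizes `2 ^ cur, 2 ^ (cur - 1), ..., 1`. -/
noncomputable def sweepBound (L cur n : ℕ) : ENNReal :=
  -- Larger windows are not relied upon, and below exponent `10 + 4 * L` the sweep counts as failed.
  -- In between, each remaining window fails with probability at most `4 ^ (-L)`, provided that the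
  -- capacity is respected.
  if 10 + 5 * L < cur then (2 ^ L)⁻¹
  else if 10 + 4 * L ≤ cur then
    if n ≤ capacity L cur then (cur - (10 + 4 * L) + 1 : ℕ) * (4 ^ L)⁻¹ else 1
  else 1

/-- A union bound over the `L + 1` relevant windows of a sweep. -/
theorem succ_mul_inv_le (L : ℕ) : ((L + 1 : ℕ) : ENNReal) * (4 ^ L)⁻¹ ≤ (2 ^ L)⁻¹ := by
  have h1 : ((L + 1 : ℕ) : ENNReal) ≤ 2 ^ L := by exact_mod_cast Nat.lt_two_pow_self
  have h2 : (4 : ENNReal) ^ L = 2 ^ L * 2 ^ L := by rw [← mul_pow]; norm_num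
  have h3 : (2 : ENNReal) ^ L ≠ 0 := by positivity
  have h4 : (2 : ENNReal) ^ L ≠ ⊤ := by finiteness
  calc ((L + 1 : ℕ) : ENNReal) * (4 ^ L)⁻¹ ≤ 2 ^ L * (4 ^ L)⁻¹ := by gcongr
    _ = (2 ^ L)⁻¹ := by
      rw [h2, ENNReal.mul_inv (.inl h3) (.inl h4), ← mul_assoc, ENNReal.mul_inv_cancel h3 h4,
        one_mul]

theorem inv_two_pow_le_one (L : ℕ) : ((2 : ENNReal) ^ L)⁻¹ ≤ 1 :=
  ENNReal.inv_le_one.2 (one_le_pow₀ (by norm_num))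

theorem sweepBound_le_one (L cur n : ℕ) : sweepBound L cur n ≤ 1 := by
  unfold sweepBound
  split_ifs
  · exact inv_two_pow_le_one L
  · refine le_trans ?_ ((succ_mul_inv_le L).trans (inv_two_pow_le_one L))
    gcongr
    omega
  · exact le_rfl
  · exact le_rfl

theorem sweepBound_of_le {L cur n : ℕ} (hcur : 10 + 5 * L ≤ cur) (hn : n ≤ 4 * 32 ^ L) :
    sweepBound L cur n ≤ (2 ^ L)⁻¹ := by
  unfold sweepBound
  split_ifs with h1 h2 h3
  · exact le_rfl
  · refine le_trans ?_ (succ_mul_inv_le L)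
    gcongr
    omega
  · exfalso
    apply h3
    have h4 : 5 * L - 4 * (10 + 5 * L - cur) = 5 * L := by omega
    rw [capacity, h4, pow_mul]
    norm_num
    exact hn
  · omega

theorem three_quarters_pow_le {L b : ℕ} (hb : 4 * 2 ^ L ≤ b) :
    (3 / 4 : ENNReal) ^ b ≤ (4 ^ L)⁻¹ := by
  have h1 : (3 / 4 : ENNReal) = ENNReal.ofReal (3 / 4) := by
    rw [ENNReal.ofReal_div_of_pos (by norm_num)]; norm_num
  have h2 : ((4 : ENNReal) ^ L)⁻¹ = ENNReal.ofReal ((1 / 4) ^ L) := by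
    rw [one_div, inv_pow, ENNReal.ofReal_inv_of_pos (by positivity),
      ENNReal.ofReal_pow (by norm_num)]
    norm_num
  rw [h1, h2, ← ENNReal.ofReal_pow (by norm_num)]
  apply ENNReal.ofReal_le_ofReal
  have h3 : 2 * L ≤ 2 ^ L := by
    rcases L with _ | L
    · simp
    · have := Nat.lt_two_pow_self (n := L)
      rw [pow_succ]; omega
  calc (3 / 4 : ℝ) ^ b ≤ (3 / 4) ^ (4 * 2 ^ L) :=
        pow_le_pow_of_le_one (by norm_num) (by norm_num) hb
    _ = ((3 / 4) ^ 4) ^ 2 ^ L := by rw [pow_mul]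
    _ ≤ (1 / 2) ^ 2 ^ L := by gcongr; norm_num
    _ ≤ (1 / 2) ^ (2 * L) := pow_le_pow_of_le_one (by norm_num) (by norm_num) h3
    _ = (1 / 4) ^ L := by rw [pow_mul]; norm_num

theorem lintegral_le_of_forall_le {k : ℕ} {f : (Fin k → unitInterval) → ENNReal} {c : ENNReal}
    (h : ∀ x, f x ≤ c) : ∫⁻ x, f x ∂coinRow k ≤ c :=
  (lintegral_mono h).trans (by simp)

/-- One window of a sweep. -/
theorem lintegral_sweepBound_le {k L cur : ℕ} {S : Finset (Fin k)} (hS : S.card ≤ 4 * 32 ^ L)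
    (hcur : 10 + 4 * L ≤ cur) :
    ∫⁻ x, (if (collided S (fun u => slotOf cur (x u)) 0 (2 ^ cur)).card = 0 then 0 else
        sweepBound L (cur - 1) (collided S (fun u => slotOf cur (x u)) 0 (2 ^ cur)).card)
      ∂coinRow k ≤ sweepBound L cur S.card := by
  set X := fun x : Fin k → unitInterval =>
    (collided S (fun u => slotOf cur (x u)) 0 (2 ^ cur)).card with hX
  have hXS : ∀ x, X x ≤ S.card := fun x => card_collided_le _ _ _ _
  have hXm : Measurable X := (Measurable.of_discrete (f := Finset.card)).comp
    (measurable_collided S cur 0 (2 ^ cur))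
  change ∫⁻ x, (if X x = 0 then 0 else sweepBound L (cur - 1) (X x)) ∂coinRow k ≤ _
  rcases Nat.lt_or_ge (10 + 5 * L) cur with h1 | h1
  · refine lintegral_le_of_forall_le fun x => ?_
    rw [show sweepBound L cur S.card = (2 ^ L)⁻¹ by rw [sweepBound, if_pos h1]]
    split_ifs
    · exact zero_le
    · exact sweepBound_of_le (by omega) ((hXS x).trans hS)
  by_cases hn : S.card ≤ capacity L cur
  swap
  · refine lintegral_le_of_forall_le fun x => ?_
    rw [show sweepBound L cur S.card = 1 by
      rw [sweepBound, if_neg (by omega), if_pos hcur, if_neg hn]]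
    split_ifs
    · exact zero_le
    · exact sweepBound_le_one _ _ _
  rw [show sweepBound L cur S.card = (cur - (10 + 4 * L) + 1 : ℕ) * (4 ^ L)⁻¹ by
    rw [sweepBound, if_neg (by omega), if_pos hcur, if_pos hn]]
  rcases Nat.lt_or_ge (10 + 4 * L) cur with h2 | h2
  -- Halving the window divides the capacity by `16`, so the window size per station grows by a
  -- factor `8`.
  · set b := capacity L (cur - 1) with hb
    have hcap : capacity L cur = 16 * b := by
      rw [hb, capacity, capacity, show 5 * L - 4 * (10 + 5 * L - cur) =
        (5 * L - 4 * (10 + 5 * L - (cur - 1))) + 4 by omega, pow_add]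
      ring
    have hA : MeasurableSet {x | b < X x} := hXm (MeasurableSet.of_discrete (s := {n | b < n}))
    have hpt : ∀ x, (if X x = 0 then 0 else sweepBound L (cur - 1) (X x)) ≤
        (cur - 1 - (10 + 4 * L) + 1 : ℕ) * (4 ^ L)⁻¹ + {x | b < X x}.indicator 1 x := by
      intro x
      by_cases hx : b < X x
      · rw [Set.indicator_of_mem (by exact hx)]
        refine le_trans ?_ le_add_self
        split_ifs
        · exact zero_le
        · exact sweepBound_le_one _ _ _
      · refine le_trans ?_ le_self_add
        split_ifs
        · exact zero_le
        · rw [sweepBound, if_neg (by omega), if_pos (by omega), if_pos (by omega)]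
    refine (lintegral_mono hpt).trans ?_
    rw [lintegral_add_left measurable_const, lintegral_const, measure_univ, mul_one,
      lintegral_indicator_one hA]
    have h3 : coinRow k {x | b < X x} ≤ (4 ^ L)⁻¹ := by
      refine (coinRow_lt_card_collided_le (hcap ▸ hn) ?_).trans (three_quarters_pow_le ?_)
      -- The offset `10` of the window exponents comes from `256 * 4 = 2 ^ 10`.
      · calc 256 * S.card ≤ 256 * capacity L cur := by gcongr
          _ = 2 ^ (10 + (5 * L - 4 * (10 + 5 * L - cur))) := by rw [capacity, pow_add]; ring
          _ ≤ 2 ^ cur := Nat.pow_le_pow_right (by norm_num) (by omega)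
      · rw [hb, capacity]
        gcongr
        · norm_num
        · omega
    calc _ ≤ ((cur - 1 - (10 + 4 * L) + 1 : ℕ) : ENNReal) * (4 ^ L)⁻¹ + (4 ^ L)⁻¹ := by gcongr
      _ = ((cur - (10 + 4 * L) + 1 : ℕ) : ENNReal) * (4 ^ L)⁻¹ := by
        rw [show cur - (10 + 4 * L) + 1 = (cur - 1 - (10 + 4 * L) + 1) + 1 by omega]
        push_cast
        ring
  -- In the last relevant window at most `4 * 2 ^ L` stations are left, few enough for the birthday
  -- bound with `M = 4 ^ L`.
  · obtain rfl : cur = 10 + 4 * L := by omega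
    have hA : MeasurableSet {x | 0 < X x} := hXm (MeasurableSet.of_discrete (s := {n | 0 < n}))
    have hpt : ∀ x, (if X x = 0 then 0 else sweepBound L (10 + 4 * L - 1) (X x)) ≤
        {x | 0 < X x}.indicator 1 x := by
      intro x
      split_ifs with hx
      · exact zero_le
      · have hx' : x ∈ {x | 0 < X x} := Nat.pos_of_ne_zero hx
        rw [Set.indicator_of_mem hx']
        exact sweepBound_le_one _ _ _
    refine (lintegral_mono hpt).trans ?_
    rw [lintegral_indicator_one hA]
    have hcap : capacity L (10 + 4 * L) = 4 * 2 ^ L := by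
      rw [capacity]; congr 2; omega
    rw [hcap] at hn
    refine (coinRow_collided_nonempty_le (M := 4 ^ L) ?_ (by positivity)).trans ?_
    · have h4 : (4 : ℕ) ^ L = 2 ^ L * 2 ^ L := by rw [← mul_pow]; norm_num
      have h5 : (2 : ℕ) ^ (10 + 4 * L) = 1024 * (2 ^ L * 2 ^ L * (2 ^ L * 2 ^ L)) := by
        rw [pow_add, mul_comm 4 L, pow_mul]; ring
      have h6 : S.card ^ 2 ≤ (4 * 2 ^ L) ^ 2 := Nat.pow_le_pow_left hn 2
      rw [h4, h5]
      calc 6 * S.card ^ 2 * (2 ^ L * 2 ^ L) ≤ 6 * (4 * 2 ^ L) ^ 2 * (2 ^ L * 2 ^ L) := by gcongr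
        _ = 96 * (2 ^ L * 2 ^ L * (2 ^ L * 2 ^ L)) := by ring
        _ ≤ _ := by gcongr; norm_num
    · simp

/-- A bound for the probability that some of `n` stations do not transmit successfully in the rest of
the first `10 + 5 * L + R` steps of the outer loop of `SUniform`, from the window of size `2 ^ cur` in
step `top` on. -/
noncomputable def windowPotential (L R top cur n : ℕ) : ENNReal :=
  if n = 0 then 0
  else if 10 + 5 * L + R < top then 1
  -- The early steps are not expected to help; each of the `R + 1` steps from `10 + 5 * L` on
  -- contributes one factor.
  else if top < 10 + 5 * L then ((2 ^ L)⁻¹) ^ (R + 1)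
  else ((2 ^ L)⁻¹) ^ (10 + 5 * L + R - top) * sweepBound L cur n

/-- The value of `windowPotential` for the window after the given one. -/
noncomputable def nextPotential (L R top cur n : ℕ) : ENNReal :=
  if 0 < cur then windowPotential L R top (cur - 1) n else windowPotential L R (top + 1) (top + 1) n

theorem windowPotential_le_one (L R top cur n : ℕ) : windowPotential L R top cur n ≤ 1 := by
  unfold windowPotential
  split_ifs
  · exact zero_le
  · exact le_rfl
  · exact pow_le_one' (inv_two_pow_le_one L) _
  · exact mul_le_one' (pow_le_one' (inv_two_pow_le_one L) _) (sweepBound_le_one _ _ _)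

theorem nextPotential_le_one (L R top cur n : ℕ) : nextPotential L R top cur n ≤ 1 := by
  unfold nextPotential
  split_ifs <;> exact windowPotential_le_one _ _ _ _ _

theorem windowPotential_of_top_le {L R top cur n : ℕ} (h : top ≤ 10 + 5 * L)
    (hcur : 10 + 5 * L ≤ top → 10 + 5 * L ≤ cur) (hn : n ≤ 4 * 32 ^ L) :
    windowPotential L R top cur n ≤ ((2 ^ L)⁻¹) ^ (R + 1) := by
  unfold windowPotential
  split_ifs with h1 h2 h3
  · exact zero_le
  · omega
  · exact le_rfl
  · obtain rfl : top = 10 + 5 * L := by omega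
    rw [show 10 + 5 * L + R - (10 + 5 * L) = R by omega, pow_succ]
    gcongr
    exact sweepBound_of_le (hcur le_rfl) hn

/-- The potential does not increase in expectation in a window. -/
theorem lintegral_nextPotential_le {k L R top cur : ℕ} {S : Finset (Fin k)}
    (hS : S.card ≤ 4 * 32 ^ L) (hS0 : S.Nonempty) (htop : top ≤ 10 + 5 * L + R) :
    ∫⁻ x, nextPotential L R top cur (collided S (fun u => slotOf cur (x u)) 0 (2 ^ cur)).card
      ∂coinRow k ≤ windowPotential L R top cur S.card := by
  have hXS : ∀ x : Fin k → unitInterval,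
      (collided S (fun u => slotOf cur (x u)) 0 (2 ^ cur)).card ≤ S.card :=
    fun x => card_collided_le _ _ _ _
  have hcard : S.card ≠ 0 := Finset.card_ne_zero.2 hS0
  rcases Nat.lt_or_ge top (10 + 5 * L) with h1 | h1
  · refine lintegral_le_of_forall_le fun x => ?_
    rw [windowPotential, if_neg hcard, if_neg (by omega), if_pos h1]
    unfold nextPotential
    split_ifs
    · exact windowPotential_of_top_le h1.le (by omega) ((hXS x).trans hS)
    · exact windowPotential_of_top_le h1 (by omega) ((hXS x).trans hS)
  have hval : windowPotential L R top cur S.card =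
      ((2 ^ L)⁻¹) ^ (10 + 5 * L + R - top) * sweepBound L cur S.card := by
    rw [windowPotential, if_neg hcard, if_neg (by omega), if_neg (by omega)]
  rw [hval]
  rcases Nat.lt_or_ge cur (10 + 4 * L) with h2 | h2
  -- The current sweep already counts as failed. At the start of the next step, one factor of the
  -- power is exchanged for the bound on the new sweep.
  · refine lintegral_le_of_forall_le fun x => ?_
    rw [show sweepBound L cur S.card = 1 by
      rw [sweepBound, if_neg (by omega), if_neg (by omega)], mul_one]
    unfold nextPotential
    split_ifs with h3
    · unfold windowPotential
      split_ifs
      · exact zero_le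
      · omega
      · omega
      · exact mul_le_of_le_one_right zero_le (sweepBound_le_one _ _ _)
    · unfold windowPotential
      split_ifs with h4 h5 h6
      · exact zero_le
      · rw [show 10 + 5 * L + R - top = 0 by omega, pow_zero]
      · omega
      · rw [show 10 + 5 * L + R - top = (10 + 5 * L + R - (top + 1)) + 1 by omega, pow_succ]
        gcongr
        exact sweepBound_of_le (by omega) ((hXS x).trans hS)
  · have hnext : ∀ n, nextPotential L R top cur n = ((2 ^ L)⁻¹) ^ (10 + 5 * L + R - top) *
        (if n = 0 then 0 else sweepBound L (cur - 1) n) := by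
      intro n
      rw [nextPotential, if_pos (by omega), windowPotential]
      by_cases hn : n = 0
      · simp [hn]
      · rw [if_neg hn, if_neg (by omega), if_neg (by omega), if_neg hn]
    simp only [hnext]
    have hfin : ((2 ^ L)⁻¹ : ENNReal) ^ (10 + 5 * L + R - top) ≠ ⊤ :=
      ((pow_le_one' (inv_two_pow_le_one L) _).trans_lt ENNReal.one_lt_top).ne
    rw [lintegral_const_mul' _ _ hfin]
    gcongr
    exact lintegral_sweepBound_le hS h2

/-! ### The potential of the dissemination mode -/

open Classical in
/-- The followers. -/
noncomputable def followers {k : ℕ} (s : Fin k → State) : Finset (Fin k) :=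
  Finset.univ.filter fun u => ∃ t b, s u = .follower t b

/-- The slot of a follower in the current window. -/
def windowSlot : State → ℕ
  | .follower _ b => b.slot
  | _ => 0

/-- The potential of followers `F` with slots `σ` in slot `pos` of the window of size `2 ^ cur` in step
`top` of the outer loop. -/
noncomputable def slotPotential {k : ℕ} (L R top cur pos : ℕ) (F : Finset (Fin k))
    (σ : Fin k → ℕ) : ENNReal :=
  if 10 + 5 * L + R < top then 1
  else if pos = 0 then windowPotential L R top cur F.card
  else nextPotential L R top cur (collided F σ pos (2 ^ cur)).card

/-- `slotPotential`, for the position of a given follower. -/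
noncomputable def stationPotential {k : ℕ} (L R : ℕ) (F : Finset (Fin k)) (σ : Fin k → ℕ) :
    State → ENNReal
  | .follower _ b => slotPotential L R b.top b.cur b.pos F σ
  | _ => 0

/-- A bound for the probability that some follower stays in dissemination mode for too long. -/
noncomputable def disseminationPotential {k : ℕ} (L R : ℕ) (s : Fin k → State) : ENNReal :=
  ⨆ u, stationPotential L R (followers s) (fun v => windowSlot (s v)) (s u)

section
variable {k : ℕ} {q : ℝ} {s : Fin k → State} {l : Fin k} {tc top cur pos L R : ℕ}

theorem mem_followers {u : Fin k} : u ∈ followers s ↔ ∃ t b, s u = .follower t b := by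
  simp [followers]

theorem disseminationPotential_of_empty (h : followers s = ∅) :
    disseminationPotential L R s = 0 := by
  refine ENNReal.iSup_eq_zero.2 fun u => ?_
  cases hu : s u with
  | follower t b =>
    have : u ∈ followers s := mem_followers.2 ⟨t, b, hu⟩
    simp [h] at this
  | _ => rfl

theorem Electing.followers_eq (h : Electing s) : followers s = ∅ := by
  ext u
  simp only [mem_followers, Finset.notMem_empty, iff_false]
  rintro ⟨t, b, hu⟩
  rcases h u with h | h | ⟨_, _, h⟩ | ⟨_, h⟩ <;> simp [hu] at h

theorem Disseminating.mem_followers_iff (h : Disseminating s l tc top cur pos) {u : Fin k} :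
    u ∈ followers s ↔ s u = .follower tc ⟨top, cur, pos, windowSlot (s u)⟩ := by
  rw [mem_followers]
  constructor
  · rintro ⟨t, b, hu⟩
    have hul : u ≠ l := by
      rintro rfl
      have := h.leader
      simp [hu] at this
    rcases h.others u hul with h | h | ⟨_, _, h⟩ | ⟨_, _, h⟩ | ⟨slot, h⟩
    · simp [hu] at h
    · simp [hu] at h
    · simp [hu] at h
    · simp [hu] at h
    · rw [h]; rfl
  · exact fun h => ⟨_, _, h⟩

theorem Disseminating.ne_leader_of_mem (h : Disseminating s l tc top cur pos) {u : Fin k}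
    (hu : u ∈ followers s) : u ≠ l := by
  rintro rfl
  have h1 := h.mem_followers_iff.1 hu
  rw [h.leader] at h1
  simp at h1

/-- All followers share one position, so the supremum runs over equal values and zeros; it only
serves to read the position off the states. -/
theorem Disseminating.disseminationPotential_eq (h : Disseminating s l tc top cur pos)
    (hF : (followers s).Nonempty) : disseminationPotential L R s =
      slotPotential L R top cur pos (followers s) fun v => windowSlot (s v) := by
  apply le_antisymm
  · refine iSup_le fun u => ?_
    by_cases hu : u ∈ followers s
    · rw [h.mem_followers_iff.1 hu]; rfl
    · cases hs : s u with
      | follower t b => exact absurd (mem_followers.2 ⟨t, b, hs⟩) hu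
      | _ => exact zero_le
  · obtain ⟨u, hu⟩ := hF
    refine le_trans (le_of_eq ?_) (le_iSup _ u)
    rw [h.mem_followers_iff.1 hu]; rfl

theorem slotPotential_le_one (top cur pos : ℕ) (F : Finset (Fin k)) (σ : Fin k → ℕ) :
    slotPotential L R top cur pos F σ ≤ 1 := by
  unfold slotPotential
  split_ifs
  · exact le_rfl
  · exact windowPotential_le_one _ _ _ _ _
  · exact nextPotential_le_one _ _ _ _ _

theorem disseminationPotential_le_one : disseminationPotential L R s ≤ 1 := by
  refine iSup_le fun u => ?_
  cases s u with
  | follower t b => exact slotPotential_le_one _ _ _ _ _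
  | _ => exact zero_le

theorem slotPotential_congr {F : Finset (Fin k)} {σ σ' : Fin k → ℕ} (h : ∀ u ∈ F, σ u = σ' u) :
    slotPotential L R top cur pos F σ = slotPotential L R top cur pos F σ' := by
  unfold slotPotential
  rw [collided_congr h]

/-- In even rounds, the followers do not move. -/
theorem Disseminating.disseminationPotential_of_even (h : Disseminating s l tc top cur pos)
    (he : ¬ Ending s tc) (ho : ¬ Odd tc) (x : Fin k → unitInterval) (wake : Finset (Fin k)) :
    disseminationPotential L R (nextStates q s wake x) = disseminationPotential L R s := by
  have h' := h.disseminating_of_even he ho x wake (q := q)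
  have hmem : ∀ u, u ∈ followers s → nextStates q s wake x u =
      .follower (tc + 1) ⟨top, cur, pos, windowSlot (s u)⟩ := by
    intro u hu
    have hu' := h.mem_followers_iff.1 hu
    rcases h.step_of_ne he x wake (h.ne_leader_of_mem hu) (q := q) with
      ⟨h, _⟩ | ⟨h, _⟩ | ⟨⟨_, _, h⟩, _⟩ | ⟨slot, h, h1⟩
    · rw [hu'] at h; simp at h
    · rw [hu'] at h; simp at h
    · rw [hu'] at h; simp at h
    · rw [h1, if_neg ho, h]; rfl
  have hF : followers (nextStates q s wake x) = followers s := by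
    ext u
    constructor
    · intro hu
      rcases h.step_of_ne he x wake (h'.ne_leader_of_mem hu) (q := q) with
        ⟨_, h | h⟩ | ⟨_, h⟩ | ⟨_, ⟨_, _, h⟩ | ⟨_, _, h⟩⟩ | ⟨slot, h, h1⟩
      · simp [mem_followers, h] at hu
      · simp [mem_followers, h] at hu
      · simp [mem_followers, h] at hu
      · simp [mem_followers, h] at hu
      · simp [mem_followers, h] at hu
      · exact mem_followers.2 ⟨_, _, h⟩
    · exact fun hu => mem_followers.2 ⟨_, _, hmem u hu⟩
  rcases (followers s).eq_empty_or_nonempty with hE | hN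
  · rw [disseminationPotential_of_empty hE, disseminationPotential_of_empty (hF.trans hE)]
  · rw [h.disseminationPotential_eq hN, h'.disseminationPotential_eq (hF ▸ hN), hF]
    exact slotPotential_congr fun u hu => by rw [hmem u hu]; rfl

/-- The slots of the followers once those of a new window have been drawn. -/
noncomputable def drawnSlot (s : Fin k → State) (cur pos : ℕ) (x : Fin k → unitInterval)
    (u : Fin k) : ℕ :=
  currentSlot cur pos (windowSlot (s u)) (x u)

theorem Disseminating.solo_iff_of_odd (h : Disseminating s l tc top cur pos) (ho : Odd tc)
    (x : Fin k → unitInterval) {u : Fin k} (hu : u ∈ followers s) :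
    (∃ m, Solo (transmissions q s x) u m) ↔
      drawnSlot s cur pos x u = pos ∧
        ∀ v ∈ followers s, drawnSlot s cur pos x v = drawnSlot s cur pos x u → v = u := by
  have htr : ∀ v ∈ followers s, transmissions q s x v =
      if pos = drawnSlot s cur pos x v then some .packet else none := fun v hv =>
    (transmissions_follower x (h.mem_followers_iff.1 hv)).1 ho
  constructor
  · rintro ⟨m, hm⟩
    have h1 := hm.1
    rw [htr u hu] at h1
    split_ifs at h1 with hp
    refine ⟨hp.symm, fun v hv hvu => ?_⟩
    by_contra hne
    have h2 := hm.2 v hne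
    rw [htr v hv, hvu, if_pos hp] at h2
    simp at h2
  · rintro ⟨h1, h2⟩
    refine ⟨.packet, by rw [htr u hu, if_pos h1.symm], fun w hw => ?_⟩
    by_cases hwF : w ∈ followers s
    · rw [htr w hwF, if_neg]
      intro hp
      exact hw (h2 w hwF (hp.symm.trans h1.symm))
    · by_cases hwl : w = l
      · rw [hwl]; exact (h.transmissions_leader x).1 ho
      · rcases h.transmissions_of_ne x hwl (q := q) with h' | ⟨slot, h'⟩
        · exact h'
        · exact absurd (mem_followers.2 ⟨_, _, h'⟩) hwF

theorem Disseminating.mem_followers_of_odd (h : Disseminating s l tc top cur pos) (ho : Odd tc)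
    {top' cur' pos' : ℕ} (ha : Advances top cur pos top' cur' pos')
    (x : Fin k → unitInterval) (wake : Finset (Fin k)) {u : Fin k} :
    u ∈ followers (nextStates q s wake x) ↔ u ∈ followers s ∧
      ¬ (drawnSlot s cur pos x u = pos ∧
        ∀ v ∈ followers s, drawnSlot s cur pos x v = drawnSlot s cur pos x u → v = u) := by
  have he : ¬ Ending s tc := fun he => he.1.not_odd ho
  have h' := h.disseminating_of_odd ho ha x wake (q := q)
  constructor
  · intro hu
    rcases h.step_of_ne he x wake (h'.ne_leader_of_mem hu) (q := q) with
      ⟨_, h | h⟩ | ⟨_, h⟩ | ⟨_, ⟨_, _, h⟩ | ⟨_, _, h⟩⟩ | ⟨slot, h1, h2⟩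
    · simp [mem_followers, h] at hu
    · simp [mem_followers, h] at hu
    · simp [mem_followers, h] at hu
    · simp [mem_followers, h] at hu
    · simp [mem_followers, h] at hu
    · have huF : u ∈ followers s := mem_followers.2 ⟨_, _, h1⟩
      refine ⟨huF, fun hc => ?_⟩
      rw [if_pos ho, if_pos ((h.solo_iff_of_odd ho x huF).2 hc)] at h2
      simp [mem_followers, h2] at hu
  · rintro ⟨hu, hc⟩
    have hu' := h.mem_followers_iff.1 hu
    rcases h.step_of_ne he x wake (h.ne_leader_of_mem hu) (q := q) with
      ⟨h, _⟩ | ⟨h, _⟩ | ⟨⟨_, _, h⟩, _⟩ | ⟨slot, h1, h2⟩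
    · rw [hu'] at h; simp at h
    · rw [hu'] at h; simp at h
    · rw [hu'] at h; simp at h
    · rw [if_pos ho, if_neg (fun hs => hc ((h.solo_iff_of_odd ho x hu).1 hs))] at h2
      exact mem_followers.2 ⟨_, _, h2⟩

theorem Disseminating.windowSlot_of_odd (h : Disseminating s l tc top cur pos) (ho : Odd tc)
    {top' cur' pos' : ℕ} (ha : Advances top cur pos top' cur' pos')
    (x : Fin k → unitInterval) (wake : Finset (Fin k)) {u : Fin k}
    (hu : u ∈ followers (nextStates q s wake x)) :
    windowSlot (nextStates q s wake x u) = drawnSlot s cur pos x u := by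
  have he : ¬ Ending s tc := fun he => he.1.not_odd ho
  have h' := h.disseminating_of_odd ho ha x wake (q := q)
  obtain ⟨huF, hc⟩ := (h.mem_followers_of_odd ho ha x wake).1 hu
  have hu' := h.mem_followers_iff.1 huF
  rcases h.step_of_ne he x wake (h.ne_leader_of_mem huF) (q := q) with
    ⟨h, _⟩ | ⟨h, _⟩ | ⟨⟨_, _, h⟩, _⟩ | ⟨slot, h1, h2⟩
  · rw [hu'] at h; simp at h
  · rw [hu'] at h; simp at h
  · rw [hu'] at h; simp at h
  · rw [if_pos ho, if_neg (fun hs => hc ((h.solo_iff_of_odd ho x huF).1 hs)), ha.next_eq] at h2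
    rw [h2, drawnSlot, h1]; rfl

/-- Once the slots of a window have been drawn, the rest of the window is determined. -/
theorem Disseminating.disseminationPotential_of_odd_le (h : Disseminating s l tc top cur pos)
    (ho : Odd tc) (htop : top ≤ 10 + 5 * L + R) (x : Fin k → unitInterval)
    (wake : Finset (Fin k)) :
    disseminationPotential L R (nextStates q s wake x) ≤ nextPotential L R top cur
      (collided (followers s) (drawnSlot s cur pos x) pos (2 ^ cur)).card := by
  have hpos := h.pos_lt
  -- After the last slot of a window, the stations that are still followers are exactly the collided
  -- ones.
  have hlast : ∀ {top' cur'}, Advances top cur pos top' cur' 0 → pos + 1 = 2 ^ cur →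
      followers (nextStates q s wake x) =
        collided (followers s) (drawnSlot s cur pos x) pos (2 ^ cur) := by
    intro top' cur' ha hp
    ext u
    rw [h.mem_followers_of_odd ho ha x wake, mem_collided]
    refine and_congr_right fun _ => not_congr ⟨fun ⟨h1, h2⟩ => ⟨by omega, by omega, h2⟩,
      fun ⟨h1, h2, h3⟩ => ⟨by omega, h3⟩⟩
  have hwindow : ∀ {top' cur'}, Advances top cur pos top' cur' 0 → pos + 1 = 2 ^ cur →
      disseminationPotential L R (nextStates q s wake x) ≤ windowPotential L R top' cur'
        (collided (followers s) (drawnSlot s cur pos x) pos (2 ^ cur)).card := by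
    intro top' cur' ha hp
    rw [← hlast ha hp]
    rcases (followers (nextStates q s wake x)).eq_empty_or_nonempty with hE | hN
    · rw [disseminationPotential_of_empty hE]; exact zero_le
    · rw [(h.disseminating_of_odd ho ha x wake).disseminationPotential_eq hN, slotPotential]
      split_ifs with h1 h2
      · rw [windowPotential, if_neg (Finset.card_ne_zero.2 hN), if_pos h1]
      · exact le_rfl
      · exact absurd rfl h2
  by_cases hp : pos + 1 < 2 ^ cur
  · have ha := advances_within (top := top) hp
    rcases (followers (nextStates q s wake x)).eq_empty_or_nonempty with hE | hN
    · rw [disseminationPotential_of_empty hE]; exact zero_le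
    · rw [(h.disseminating_of_odd ho ha x wake).disseminationPotential_eq hN, slotPotential,
        if_neg (by omega), if_neg (by omega),
        collided_congr (fun u hu => h.windowSlot_of_odd ho ha x wake hu)]
      -- A station that leaves in slot `pos` shares its slot with no other follower, so its
      -- departure affects no other station.
      refine le_of_eq (congrArg _ (congrArg _ ?_))
      ext u
      simp only [mem_collided, h.mem_followers_of_odd ho ha x wake]
      set σ := drawnSlot s cur pos x
      constructor
      · rintro ⟨⟨h1, h2⟩, h3⟩
        refine ⟨h1, fun ⟨h4, h5, h6⟩ => ?_⟩
        rcases Nat.eq_or_lt_of_le h4 with h7 | h7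
        · exact h2 ⟨h7.symm, h6⟩
        · exact h3 ⟨h7, h5, fun v hv => h6 v hv.1⟩
      · rintro ⟨h1, h2⟩
        refine ⟨⟨h1, fun ⟨h3, h4⟩ => h2 ⟨h3.ge, by omega, h4⟩⟩, fun ⟨h3, h4, h5⟩ => ?_⟩
        refine h2 ⟨by omega, h4, fun v hv hvu => h5 v ⟨hv, fun ⟨h6, _⟩ => ?_⟩ hvu⟩
        omega
  · unfold nextPotential
    rcases cur with _ | cur
    · obtain rfl : pos = 0 := by simpa using hpos
      exact hwindow (advances_up top) (by norm_num)
    · rw [if_pos (by omega)]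
      exact hwindow (advances_down (by omega)) (by omega)

theorem Disseminating.lintegral_disseminationPotential_le (h : Disseminating s l tc top cur pos)
    (he : ¬ Ending s tc) (hk : k ≤ 4 * 32 ^ L) (wake : Finset (Fin k)) :
    ∫⁻ x, disseminationPotential L R (nextStates q s wake x) ∂coinRow k ≤
      disseminationPotential L R s := by
  by_cases ho : Odd tc
  swap
  · exact lintegral_le_of_forall_le fun x =>
      (h.disseminationPotential_of_even he ho x wake).le
  rcases (followers s).eq_empty_or_nonempty with hE | hN
  · refine lintegral_le_of_forall_le fun x => ?_
    obtain ⟨_, _, _, ha⟩ := exists_advances (top := top) h.pos_lt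
    rw [disseminationPotential_of_empty]
    · exact zero_le
    · ext u
      rw [h.mem_followers_of_odd ho ha x wake, hE]
      simp
  rw [h.disseminationPotential_eq hN, slotPotential]
  split_ifs with h1 h2
  · exact lintegral_le_of_forall_le fun x => disseminationPotential_le_one
  -- Fresh coins matter only at the start of a window.
  · subst h2
    refine (lintegral_mono fun x => h.disseminationPotential_of_odd_le ho (by omega) x wake).trans ?_
    exact lintegral_nextPotential_le ((Finset.card_le_univ _).trans (by simpa using hk)) hN
      (by omega)
  · refine lintegral_le_of_forall_le fun x =>
      (h.disseminationPotential_of_odd_le ho (by omega) x wake).trans (le_of_eq ?_)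
    have : drawnSlot s cur pos x = fun v => windowSlot (s v) := by
      funext v
      rw [drawnSlot, currentSlot, if_neg h2]
    rw [this]

theorem one_le_disseminationPotential {u : Fin k} {t : ℕ} {b : Sawtooth}
    (hu : s u = .follower t b) (hb : 10 + 5 * L + R < b.top) :
    1 ≤ disseminationPotential L R s := by
  refine le_trans (le_of_eq ?_) (le_iSup _ u)
  rw [hu, stationPotential, slotPotential, if_pos hb]

theorem Disseminating.disseminationPotential_start_le (h : Disseminating s l tc 1 1 0)
    (hk : k ≤ 4 * 32 ^ L) : disseminationPotential L R s ≤ ((2 ^ L)⁻¹) ^ (R + 1) := by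
  rcases (followers s).eq_empty_or_nonempty with hE | hN
  · rw [disseminationPotential_of_empty hE]; exact zero_le
  · rw [h.disseminationPotential_eq hN, slotPotential, if_neg (by omega), if_pos rfl]
    exact windowPotential_of_top_le (by omega) (by omega)
      ((Finset.card_le_univ _).trans (by simpa using hk))

end

/-! ### The potential of the leader election -/

/-- The transmission probability that a station had `d` rounds ago in the current election. -/
noncomputable def stationContention (q : ℝ) (d : ℕ) : State → ℝ
  | .electing i => if d ≤ i then decrease q (i - d) else 0
  | _ => 0

/-- The sum of the transmission probabilities `d` rounds ago in the current election. -/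
noncomputable def pastContention {k : ℕ} (q : ℝ) (s : Fin k → State) (d : ℕ) : ℝ :=
  ∑ u, stationContention q d (s u)

/-- The sum of the lower bounds for the success probabilities of the past rounds of the current
election. -/
noncomputable def electionLog {k : ℕ} (q : ℝ) (s : Fin k → State) : ℝ :=
  ∑ d ∈ Finset.range (age s), successBound (pastContention q s (d + 1))

section
variable {k : ℕ} {q : ℝ} {s : Fin k → State} {l : Fin k} {tc top cur pos : ℕ}

theorem stationContention_nonneg (hq : 0 < q) (d : ℕ) (a : State) :
    0 ≤ stationContention q d a := by
  cases a with
  | electing i =>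
    simp only [stationContention]
    split_ifs
    · exact (decrease_pos hq _).le
    · exact le_rfl
  | _ => exact le_rfl

theorem stationContention_le_half (hq : 0 < q) (d : ℕ) (a : State) :
    stationContention q d a ≤ 1 / 2 := by
  cases a with
  | electing i =>
    simp only [stationContention]
    split_ifs
    · exact decrease_le_half hq _
    · norm_num
  | _ => norm_num [stationContention]

theorem pastContention_nonneg (hq : 0 < q) (s : Fin k → State) (d : ℕ) :
    0 ≤ pastContention q s d :=
  Finset.sum_nonneg fun _ _ => stationContention_nonneg hq _ _

theorem electionLog_eq_zero (h : ∀ u i, s u = .electing i → i = 0) : electionLog q s = 0 := by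
  have : age s = 0 := Nat.le_zero.1 (age_le fun u i hu => (h u i hu).le)
  simp [electionLog, this]

theorem Electing.electionLog_of_not_solo (h : Electing s) {x : Fin k → unitInterval}
    (hx : ∀ v m, ¬ Solo (transmissions q s x) v m) (wake : Finset (Fin k)) :
    electionLog q (nextStates q s wake x) =
      electionLog q s + successBound (pastContention q s 0) := by
  have hstep := h.step_of_not_solo hx wake
  by_cases hE : ∃ u i, s u = .electing i
  · obtain ⟨u, i, hu⟩ := hE
    -- All counters advance in unison and newcomers contribute nothing to past rounds, so the
    -- history of the election can be read off the present counters.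
    have hpast : ∀ d, pastContention q (nextStates q s wake x) (d + 1) = pastContention q s d := by
      intro d
      refine Finset.sum_congr rfl fun v _ => ?_
      rcases hstep v with ⟨h1, h2 | h2⟩ | ⟨h1, h2⟩ | ⟨n, hn, h1, h2⟩ | ⟨h1, h2⟩ | ⟨i, h1, h2⟩ <;>
        rw [h1, h2] <;> simp [stationContention]
    rw [electionLog, h.age_of_not_solo hx wake hu, electionLog]
    simp only [hpast]
    rw [Finset.sum_range_succ']
  · push Not at hE
    rw [electionLog_eq_zero, electionLog_eq_zero (fun u i hu => absurd hu (hE u i))]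
    · have : pastContention q s 0 = 0 := by
        refine Finset.sum_eq_zero fun v _ => ?_
        cases hv : s v with
        | electing i => exact absurd hv (hE v i)
        | _ => rfl
      rw [this, successBound_zero, add_zero]
    · intro v i hv
      rcases hstep v with ⟨h1, h2 | h2⟩ | ⟨h1, h2⟩ | ⟨n, hn, h1, h2⟩ | ⟨h1, h2⟩ | ⟨j, h1, h2⟩
      · simp [h2] at hv
      · simp [h2] at hv
      · simp [h2] at hv
      · simp [h2] at hv
      · rw [h2] at hv
        exact (State.electing.inj hv).symm
      · exact absurd h1 (hE v j)

theorem Disseminating.ne_electing (h : Disseminating s l tc top cur pos) (u : Fin k) (i : ℕ) :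
    s u ≠ .electing i := by
  intro hu
  by_cases hul : u = l
  · subst hul
    have := h.leader
    simp [hu] at this
  · rcases h.others u hul with h | h | ⟨_, _, h⟩ | ⟨_, _, h⟩ | ⟨_, h⟩ <;> simp [hu] at h

/-- An election that has lasted for a linear number of rounds is improbable. -/
theorem log_le_electionLog {Q : ℝ} (hQ : 1 ≤ Q) (hq : q = 64 * Q) {c : ℕ} (hk : 0 < k)
    (hc : (c : ℝ) = (100 * q) ^ 2) {u : Fin k} {i : ℕ} (hu : s u = .electing i)
    (hi : 2 * (c * k) ≤ i) : Q * Real.log k ≤ electionLog q s := by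
  classical
  have hq0 : 0 < q := by linarith
  have hage := hi.trans (le_age hu)
  obtain ⟨u₀, hu₀⟩ := exists_electing_age hu
  set U := Finset.univ.filter fun v => ∃ i, s v = .electing i
  -- Time is counted from the entry of the oldest participant. The arrival times may depend on past
  -- coins, but the bound holds for any arrival times.
  set τ : Fin k → ℕ := fun v => age s - electionTime (s v) with hτ
  have hcont : ∀ t < age s, pastContention q s (age s - 1 - t + 1) = contentionAt q U τ t := by
    intro t ht
    rw [pastContention, contentionAt, Finset.sum_filter]
    refine Finset.sum_congr rfl fun v _ => ?_
    cases hv : s v with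
    | electing i =>
      have hle := le_age hv
      simp only [hτ, hv, electionTime, stationContention]
      rw [if_pos (show ∃ j, State.electing i = .electing j from ⟨i, rfl⟩)]
      by_cases h1 : age s - i ≤ t
      · rw [if_pos (show age s - 1 - t + 1 ≤ i by omega), if_pos h1]
        congr 1
        omega
      · rw [if_neg (show ¬ age s - 1 - t + 1 ≤ i by omega), if_neg h1]
    | _ => simp [stationContention]
  have hU : U.card ≤ k := (Finset.card_le_univ _).trans (by simp)
  refine (log_le_sum_successBound hQ hq hk hU (u₀ := u₀) (τ := τ) (by simp [U, hu₀])
    (by simp [hτ, hu₀, electionTime]) hc).trans ?_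
  rw [electionLog, ← Finset.sum_range_reflect fun d => successBound (pastContention q s (d + 1))]
  calc ∑ t ∈ Finset.range (2 * (c * k)), successBound (contentionAt q U τ t)
      ≤ ∑ t ∈ Finset.range (age s), successBound (contentionAt q U τ t) :=
        Finset.sum_le_sum_of_subset_of_nonneg (Finset.range_subset_range.2 hage)
          fun t _ _ => successBound_nonneg (contentionAt_nonneg hq0 U τ t)
    _ = _ := Finset.sum_congr rfl fun t ht => by
        rw [hcont t (Finset.mem_range.1 ht)]

/-! #### The probability of a success -/

/-- This is `1 ≤ (1 - p) * (1 + 2 * p)` with `1 + 2 * p ≤ exp (2 * p)`. The limit `1 / 2` is the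
initial probability of `DecreaseSlowly`. -/
theorem exp_neg_two_mul_le {p : ℝ} (h0 : 0 ≤ p) (h1 : p ≤ 1 / 2) : Real.exp (-2 * p) ≤ 1 - p := by
  have h2 : 1 + 2 * p ≤ Real.exp (2 * p) := by linarith [Real.add_one_le_exp (2 * p)]
  have h3 : Real.exp (-2 * p) * Real.exp (2 * p) = 1 := by rw [← Real.exp_add]; simp
  have h4 := Real.exp_pos (-2 * p)
  have h5 : Real.exp (-2 * p) * (1 + 2 * p) ≤ 1 := by nlinarith
  nlinarith

/-- The right-hand side is the probability that exactly one of independent stations transmits. -/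
theorem successBound_le_sum {ι : Type*} [Fintype ι] [DecidableEq ι] {p : ι → ℝ}
    (h0 : ∀ u, 0 ≤ p u) (h1 : ∀ u, p u ≤ 1 / 2) :
    successBound (∑ u, p u) ≤ ∑ v, p v * ∏ w ∈ Finset.univ.erase v, (1 - p w) := by
  rw [successBound, Finset.sum_mul]
  refine Finset.sum_le_sum fun v _ => mul_le_mul_of_nonneg_left ?_ (h0 v)
  calc Real.exp (-2 * ∑ u, p u) ≤ Real.exp (∑ u ∈ Finset.univ.erase v, -2 * p u) := by
        rw [← Finset.mul_sum]
        apply Real.exp_le_exp.2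
        have := Finset.sum_le_sum_of_subset_of_nonneg (Finset.erase_subset v Finset.univ)
          fun u _ _ => h0 u
        linarith
    _ = ∏ w ∈ Finset.univ.erase v, Real.exp (-2 * p w) := Real.exp_sum _ _
    _ ≤ _ := Finset.prod_le_prod (fun w _ => Real.exp_nonneg _)
        fun w _ => exp_neg_two_mul_le (h0 w) (h1 w)

theorem Electing.transmissions_eq (h : Electing s) (x : Fin k → unitInterval)
    (u : Fin k) : transmissions q s x u =
      if (x u : ℝ) < stationContention q 0 (s u) then some .packet else none := by
  unfold transmissions
  rcases h u with h | h | ⟨n, _, h⟩ | ⟨i, h⟩ <;> rw [h]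
  · simp [act, stationContention, not_lt.2 (x u).2.1]
  · simp [act, stationContention, not_lt.2 (x u).2.1]
  · simp [act, stationContention, not_lt.2 (x u).2.1]
  · simp [act, stationContention, decrease]

theorem volume_coe_lt {c : ℝ} (h0 : 0 ≤ c) (h1 : c ≤ 1) :
    volume {y : unitInterval | (y : ℝ) < c} = ENNReal.ofReal c :=
  unitInterval.volume_Iio ⟨c, h0, h1⟩

theorem volume_not_coe_lt {c : ℝ} (h0 : 0 ≤ c) (h1 : c ≤ 1) :
    volume {y : unitInterval | ¬ (y : ℝ) < c} = ENNReal.ofReal (1 - c) := by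
  have : {y : unitInterval | ¬ (y : ℝ) < c} = Set.Ici ⟨c, h0, h1⟩ := by
    ext y
    change ¬ (y : ℝ) < c ↔ _
    rw [not_lt]
    exact Iff.rfl
  rw [this, unitInterval.volume_Ici]

theorem measurableSet_solo (s : Fin k → State) :
    MeasurableSet {x | ∃ v m, Solo (transmissions q s x) v m} :=
  measurable_transmissions q s
    (MeasurableSet.of_discrete (s := {t : Fin k → Option Message | ∃ v m, Solo t v m}))

theorem Electing.coinRow_not_solo_le (h : Electing s) (hq : 0 < q) :
    coinRow k {x | ∃ v m, Solo (transmissions q s x) v m}ᶜ ≤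
      ENNReal.ofReal (Real.exp (-successBound (pastContention q s 0))) := by
  classical
  set p : Fin k → ℝ := fun u => stationContention q 0 (s u) with hp
  have h0 : ∀ u, 0 ≤ p u := fun u => stationContention_nonneg hq _ _
  have hhalf : ∀ u, p u ≤ 1 / 2 := fun u => stationContention_le_half hq _ _
  -- The coins for which `v` alone transmits: disjoint product sets.
  set box : Fin k → Set (Fin k → unitInterval) := fun v => Set.univ.pi fun w =>
    if w = v then {y | (y : ℝ) < p w} else {y | ¬ (y : ℝ) < p w} with hbox
  have hmem : ∀ v x, x ∈ box v → (x v : ℝ) < p v ∧ ∀ w, w ≠ v → ¬ (x w : ℝ) < p w := by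
    intro v x hx
    simp only [hbox, Set.mem_univ_pi] at hx
    refine ⟨by simpa using hx v, fun w hw => by simpa [hw] using hx w⟩
  have hsub : (⋃ v ∈ Finset.univ, box v) ⊆ {x | ∃ v m, Solo (transmissions q s x) v m} := by
    intro x hx
    simp only [Set.mem_iUnion] at hx
    obtain ⟨v, -, hx⟩ := hx
    obtain ⟨h1, h2⟩ := hmem v x hx
    refine ⟨v, .packet, ?_, fun w hw => ?_⟩
    · rw [h.transmissions_eq, if_pos h1]
    · rw [h.transmissions_eq, if_neg (h2 w hw)]
  have hdisj : Set.PairwiseDisjoint (↑(Finset.univ : Finset (Fin k))) box := by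
    intro v _ w _ hvw
    refine Set.disjoint_left.2 fun x hv hw => ?_
    exact (hmem w x hw).2 v hvw (hmem v x hv).1
  have hlt : ∀ c : ℝ, MeasurableSet {y : unitInterval | (y : ℝ) < c} := fun c =>
    measurableSet_lt (by fun_prop) measurable_const
  have hmeas : ∀ v ∈ (Finset.univ : Finset (Fin k)), MeasurableSet (box v) := by
    intro v _
    refine MeasurableSet.univ_pi fun w => ?_
    split_ifs
    · exact hlt _
    · exact (hlt _).compl
  have hvol : ∀ v, coinRow k (box v) =
      ENNReal.ofReal (p v * ∏ w ∈ Finset.univ.erase v, (1 - p w)) := by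
    intro v
    rw [coinRow, hbox, Measure.pi_pi, ← Finset.mul_prod_erase _ _ (Finset.mem_univ v),
      ENNReal.ofReal_mul (h0 v), ENNReal.ofReal_prod_of_nonneg
        (fun w _ => by linarith [hhalf w]), if_pos rfl,
      volume_coe_lt (h0 v) (by linarith [hhalf v])]
    congr 1
    refine Finset.prod_congr rfl fun w hw => ?_
    rw [if_neg (Finset.ne_of_mem_erase hw), volume_not_coe_lt (h0 w) (by linarith [hhalf w])]
  have hsucc : ENNReal.ofReal (successBound (pastContention q s 0)) ≤
      coinRow k {x | ∃ v m, Solo (transmissions q s x) v m} := by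
    refine le_trans ?_ (measure_mono hsub)
    rw [measure_biUnion_finset hdisj hmeas]
    simp only [hvol]
    rw [← ENNReal.ofReal_sum_of_nonneg]
    · exact ENNReal.ofReal_le_ofReal (successBound_le_sum h0 hhalf)
    · exact fun v _ => mul_nonneg (h0 v)
        (Finset.prod_nonneg fun w _ => by linarith [hhalf w])
  rw [prob_compl_eq_one_sub (measurableSet_solo s)]
  refine (tsub_le_tsub_left hsucc 1).trans ?_
  rw [show (1 : ENNReal) = ENNReal.ofReal 1 by simp,
    ← ENNReal.ofReal_sub _ (successBound_nonneg (pastContention_nonneg hq s 0))]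
  apply ENNReal.ofReal_le_ofReal
  linarith [Real.add_one_le_exp (-successBound (pastContention q s 0))]

/-! ### The total potential -/

/-- The states of a station that has not entered dissemination mode yet. -/
def IsPending : State → Prop
  | .leader _ => False
  | .follower _ _ => False
  | .off => False
  | _ => True

open Classical in
/-- The number of stations that have not entered dissemination mode yet. -/
noncomputable def pendingCount (s : Fin k → State) : ℕ :=
  (Finset.univ.filter fun u => IsPending (s u)).card

/-- Leaders and followers never return to the waiting loop, so a station is a leader in at most one
mode. -/
theorem isPending_of_next {x : Fin k → unitInterval} {wake : Finset (Fin k)} {u : Fin k}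
    (h : IsPending (nextStates q s wake x u)) : IsPending (s u) := by
  by_contra hs
  have hne : s u ≠ .asleep := fun h => hs (by rw [h]; trivial)
  rw [nextStates_of_ne_asleep q wake x hne] at h
  cases hu : s u with
  | leader tc =>
    rw [hu] at h
    unfold update at h
    cases hf : feedback (transmissions q s x) u <;> rw [hf] at h <;> dsimp only at h
    · exact h
    · split_ifs at h <;> exact h
    · exact h
  | follower tc b =>
    rw [hu] at h
    unfold update at h
    cases hf : feedback (transmissions q s x) u <;> rw [hf] at h <;> dsimp only at h <;>
      split_ifs at h <;> exact h
  | off => rw [hu] at h; exact h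
  | _ => rw [hu] at hs; exact hs trivial

open Classical in
theorem pendingCount_next_le (x : Fin k → unitInterval) (wake : Finset (Fin k)) :
    pendingCount (nextStates q s wake x) ≤ pendingCount s := by
  refine Finset.card_le_card fun u hu => ?_
  simp only [Finset.mem_filter, Finset.mem_univ, true_and] at hu ⊢
  exact isPending_of_next hu

open Classical in
theorem pendingCount_next_lt {x : Fin k → unitInterval} {wake : Finset (Fin k)} {v : Fin k}
    (h1 : IsPending (s v)) (h2 : ¬ IsPending (nextStates q s wake x v)) :
    pendingCount (nextStates q s wake x) + 1 ≤ pendingCount s := by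
  refine Finset.card_lt_card ⟨fun u hu => ?_, fun hc => h2 ?_⟩
  · simp only [Finset.mem_filter, Finset.mem_univ, true_and] at hu ⊢
    exact isPending_of_next hu
  · have := hc (Finset.mem_filter.2 ⟨Finset.mem_univ v, h1⟩)
    exact (Finset.mem_filter.1 this).2

/-- A bound for the probability that some station becomes overdue: `δ` for an election, and the bound
`((2 ^ L)⁻¹) ^ (R + 1)` for a dissemination mode, for each station that may still become a leader. -/
noncomputable def potential (q : ℝ) (δ : ENNReal) (L R : ℕ) (s : Fin k → State) : ENNReal :=
  (δ + ((2 ^ L)⁻¹) ^ (R + 1)) * pendingCount s +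
    δ * ENNReal.ofReal (Real.exp (electionLog q s)) + disseminationPotential L R s

theorem lintegral_potential_le (hq : 0 < q) {δ : ENNReal} {L R : ℕ}
    (hk : k ≤ 4 * 32 ^ L) (hs : Regular s) (wake : Finset (Fin k)) :
    ∫⁻ x, potential q δ L R (nextStates q s wake x) ∂coinRow k ≤ potential q δ L R s := by
  rcases hs with h | ⟨l, tc, top, cur, pos, h⟩
  · set N := {x | ∃ v m, Solo (transmissions q s x) v m}ᶜ with hN
    set f := successBound (pastContention q s 0) with hf
    have hNm : MeasurableSet N := (measurableSet_solo s).compl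
    have hpt : ∀ x, potential q δ L R (nextStates q s wake x) ≤
        (δ + ((2 ^ L)⁻¹) ^ (R + 1)) * pendingCount s +
          N.indicator (fun _ => δ * ENNReal.ofReal (Real.exp (electionLog q s + f))) x := by
      intro x
      -- A success resets the election term to `δ` and creates a dissemination term; the new leader,
      -- no longer pending, pays for both.
      by_cases hx : ∃ v m, Solo (transmissions q s x) v m
      · rw [Set.indicator_of_notMem (show x ∉ N from not_not.2 hx), add_zero]
        obtain ⟨v, m, hv⟩ := hx
        have hD := h.disseminating_of_solo hv wake
        have hlog : electionLog q (nextStates q s wake x) = 0 :=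
          electionLog_eq_zero fun u i hu => absurd hu (hD.ne_electing u i)
        have hlt : pendingCount (nextStates q s wake x) + 1 ≤ pendingCount s := by
          obtain ⟨-, i, hi⟩ := h.solo hv
          refine pendingCount_next_lt (v := v) (by rw [hi]; trivial) ?_
          rw [h.leader_of_solo hv wake]
          exact id
        rw [potential, hlog, Real.exp_zero, ENNReal.ofReal_one, mul_one, add_assoc]
        calc _ ≤ (δ + ((2 ^ L)⁻¹) ^ (R + 1)) * pendingCount (nextStates q s wake x) +
              (δ + ((2 ^ L)⁻¹) ^ (R + 1)) := by
              gcongr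
              exact hD.disseminationPotential_start_le hk
          _ = (δ + ((2 ^ L)⁻¹) ^ (R + 1)) * (pendingCount (nextStates q s wake x) + 1 : ℕ) := by
              push_cast; ring
          _ ≤ _ := by gcongr
      -- Without a success the election term is multiplied by `exp f`, but this happens with
      -- probability at most `exp (-f)`.
      · rw [Set.indicator_of_mem (show x ∈ N from hx)]
        push Not at hx
        rw [potential, h.electionLog_of_not_solo hx wake, disseminationPotential_of_empty
          (h.electing_of_not_solo hx wake).followers_eq, add_zero]
        gcongr
        exact pendingCount_next_le x wake
    refine (lintegral_mono hpt).trans ?_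
    rw [lintegral_add_left measurable_const, lintegral_const, measure_univ, mul_one,
      lintegral_indicator_const hNm]
    refine (add_le_add le_rfl ?_).trans le_self_add
    calc δ * ENNReal.ofReal (Real.exp (electionLog q s + f)) * coinRow k N
        ≤ δ * ENNReal.ofReal (Real.exp (electionLog q s + f)) *
            ENNReal.ofReal (Real.exp (-f)) := by
          gcongr
          exact h.coinRow_not_solo_le hq
      _ = δ * ENNReal.ofReal (Real.exp (electionLog q s)) := by
          rw [mul_assoc, ← ENNReal.ofReal_mul (Real.exp_nonneg _), ← Real.exp_add]
          congr 4
          ring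
  · have hlog : electionLog q s = 0 :=
      electionLog_eq_zero fun u i hu => absurd hu (h.ne_electing u i)
    have hnext : ∀ x, electionLog q (nextStates q s wake x) = 0 := by
      intro x
      refine electionLog_eq_zero fun u i hu => ?_
      by_cases he : Ending s tc
      · rcases h.step_of_ending he x wake u (q := q) with ⟨_, h | h⟩ | ⟨_, h⟩ | ⟨_, h⟩ | ⟨_, h⟩
        · simp [hu] at h
        · simp [hu] at h
        · simp [hu] at h
        · rw [hu] at h; exact State.electing.inj h
        · simp [hu] at h
      · obtain ⟨_, _, _, h'⟩ := h.exists_disseminating he x wake (q := q)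
        exact absurd hu (h'.ne_electing u i)
    have hpt : ∀ x, potential q δ L R (nextStates q s wake x) ≤
        ((δ + ((2 ^ L)⁻¹) ^ (R + 1)) * pendingCount s + δ) +
          disseminationPotential L R (nextStates q s wake x) := by
      intro x
      rw [potential, hnext, Real.exp_zero, ENNReal.ofReal_one, mul_one]
      gcongr
      exact pendingCount_next_le x wake
    refine (lintegral_mono hpt).trans ?_
    rw [lintegral_add_left measurable_const, lintegral_const, measure_univ, mul_one, potential,
      hlog, Real.exp_zero, ENNReal.ofReal_one, mul_one]
    gcongr
    by_cases he : Ending s tc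
    · refine lintegral_le_of_forall_le fun x => ?_
      rw [disseminationPotential_of_empty (h.electing_of_ending he x wake).followers_eq]
      exact zero_le
    · exact h.lintegral_disseminationPotential_le he hk wake

end

/-- With the probability given by the initial potential, no station ever becomes overdue. -/
theorem coinMeasure_overdue_le {k L R c : ℕ} {q Q : ℝ} (hk0 : 0 < k) (hQ : 1 ≤ Q)
    (hq : q = 64 * Q) (hc : (c : ℝ) = (100 * q) ^ 2) (hk : k ≤ 4 * 32 ^ L) (adv : Adversary k) :
    coinMeasure k {ω | ∃ r, Overdue (2 * (c * k)) (10 + 5 * L + R) (run q adv ω r).now} ≤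
      (ENNReal.ofReal ((k : ℝ) ^ (-Q)) + ((2 ^ L)⁻¹) ^ (R + 1)) * (k + 1) := by
  have hkR : (0 : ℝ) < k := by exact_mod_cast hk0
  set δ := ENNReal.ofReal ((k : ℝ) ^ (-Q)) with hδ
  refine (measure_exists_run_le (potential q δ L R) _
    (fun s hs _ wake => lintegral_potential_le (by linarith) hk hs wake)
    ?_).trans ?_
  · rintro s (⟨u, i, hu, hi⟩ | ⟨u, t, b, hu, hb⟩)
    · have hlog := log_le_electionLog hQ hq hk0 hc hu hi
      refine le_trans ?_ (le_self_add.trans' le_add_self)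
      -- The factor `k ^ (-Q)` cancels against `exp (Q * log k)`.
      rw [hδ, ← ENNReal.ofReal_mul (by positivity), ENNReal.one_le_ofReal,
        Real.rpow_def_of_pos hkR, ← Real.exp_add]
      apply Real.one_le_exp
      linarith
    · exact (one_le_disseminationPotential hu hb).trans le_add_self
  · have hE : Electing fun _ : Fin k => State.asleep := fun _ => .inl rfl
    have hcount : pendingCount (fun _ : Fin k => State.asleep) ≤ k :=
      (Finset.card_le_univ _).trans (by simp)
    rw [potential, electionLog_eq_zero (by simp), Real.exp_zero, ENNReal.ofReal_one, mul_one,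
      disseminationPotential_of_empty hE.followers_eq, add_zero, mul_add, mul_one]
    gcongr
    exact le_self_add

/-! ### Choice of the parameters -/

theorem inv_two_pow_clog_le {k : ℕ} (hk : 0 < k) (n : ℕ) :
    (((2 : ENNReal) ^ Nat.clog 32 k)⁻¹) ^ (5 * n) ≤ ENNReal.ofReal ((k : ℝ) ^ (-(n : ℝ))) := by
  have hk0 : (0 : ℝ) < k := by exact_mod_cast hk
  set L := Nat.clog 32 k
  -- As `32 = 2 ^ 5`, five failed sweeps are worth one factor `1 / k`.
  have h1 : (k : ℝ) ≤ 32 ^ L := by exact_mod_cast Nat.le_pow_clog (by norm_num) k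
  have h2 : (((2 : ENNReal) ^ L)⁻¹) ^ (5 * n) = ENNReal.ofReal (((32 : ℝ) ^ L)⁻¹ ^ n) := by
    rw [ENNReal.ofReal_pow (by positivity), ENNReal.ofReal_inv_of_pos (by positivity),
      ENNReal.ofReal_pow (by norm_num), pow_mul, ← ENNReal.inv_pow, ← pow_mul, mul_comm L 5,
      pow_mul]
    norm_num
  rw [h2, Real.rpow_neg hk0.le, Real.rpow_natCast, ← inv_pow (k : ℝ) n]
  exact ENNReal.ofReal_le_ofReal
    (pow_le_pow_left₀ (by positivity) (inv_anti₀ hk0 h1) n)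

/-- Rounding up the logarithm costs at most a factor `32`, so the modes last for linear time. -/
theorem two_pow_clog_le {k : ℕ} (hk : 0 < k) (R : ℕ) :
    2 ^ (10 + 5 * Nat.clog 32 k + R + 4) ≤ 2 ^ (19 + R) * k := by
  have h1 : 32 ^ Nat.clog 32 k ≤ 32 * k := by
    rcases Nat.lt_or_ge 1 k with h | h
    · have h2 := Nat.pow_pred_clog_lt_self (b := 32) (by norm_num) h
      have h3 := Nat.clog_pos (b := 32) (by norm_num) h
      calc 32 ^ Nat.clog 32 k = 32 * 32 ^ (Nat.clog 32 k).pred := by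
            rw [← pow_succ', show (Nat.clog 32 k).pred + 1 = Nat.clog 32 k from
              Nat.succ_pred_eq_of_pos h3]
        _ ≤ _ := by gcongr
    · rw [Nat.clog_of_right_le_one h]
      omega
  calc 2 ^ (10 + 5 * Nat.clog 32 k + R + 4) = 2 ^ (14 + R) * 32 ^ Nat.clog 32 k := by
        rw [show 10 + 5 * Nat.clog 32 k + R + 4 = (14 + R) + 5 * Nat.clog 32 k by omega, pow_add,
          pow_mul]
        norm_num
    _ ≤ 2 ^ (14 + R) * (32 * k) := by gcongr
    _ = _ := by rw [show 19 + R = (14 + R) + 5 by omega, pow_add]; ring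

/-- The latency is linear with high probability. -/
theorem one_sub_le_coinMeasure_resolved {η : ℝ} {k c n : ℕ} {q : ℝ} (hk : 2 ≤ k) (hn : 1 ≤ n)
    (hηn : η + 3 ≤ n) (hq : q = 64 * n) (hc : (c : ℝ) = (100 * q) ^ 2) (adv : Adversary k) :
    1 - 1 / (k : ℝ) ^ η ≤ (coinMeasure k).real
      {ω | ResolvedWithLatency q adv ω ((2 * c + 2 ^ (19 + 5 * n) + 7 : ℕ) * k)} := by
  have hk0 : 0 < k := by omega
  have hkR : (0 : ℝ) < k := by exact_mod_cast hk0
  have hk2 : (2 : ℝ) ≤ k := by exact_mod_cast hk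
  set L := Nat.clog 32 k with hL
  set S := {ω | ResolvedWithLatency q adv ω ((2 * c + 2 ^ (19 + 5 * n) + 7 : ℕ) * k)} with hS
  set B := {ω | ∃ r, Overdue (2 * (c * k)) (10 + 5 * L + 5 * n) (run q adv ω r).now}
  have hkL : k ≤ 4 * 32 ^ L :=
    (Nat.le_pow_clog (by norm_num) k).trans (Nat.le_mul_of_pos_left _ (by norm_num))
  have hB : coinMeasure k B ≤ ENNReal.ofReal (1 / (k : ℝ) ^ η) := by
    refine (coinMeasure_overdue_le hk0 (Q := n) (by exact_mod_cast hn) hq hc hkL adv).trans ?_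
    have h1 : ((2 ^ L)⁻¹ : ENNReal) ^ (5 * n + 1) ≤ ENNReal.ofReal ((k : ℝ) ^ (-(n : ℝ))) :=
      (pow_le_pow_right_of_le_one' (inv_two_pow_le_one L) (Nat.le_succ _)).trans
        (inv_two_pow_clog_le hk0 n)
    calc _ ≤ (ENNReal.ofReal ((k : ℝ) ^ (-(n : ℝ))) + ENNReal.ofReal ((k : ℝ) ^ (-(n : ℝ)))) *
          (k + 1) := by gcongr
      _ = ENNReal.ofReal (((k : ℝ) ^ (-(n : ℝ)) + (k : ℝ) ^ (-(n : ℝ))) * (k + 1)) := by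
          rw [ENNReal.ofReal_mul (by positivity), ENNReal.ofReal_add (by positivity)
            (by positivity), ENNReal.ofReal_add (by positivity) (by norm_num),
            ENNReal.ofReal_natCast, ENNReal.ofReal_one]
      _ ≤ _ := by
          apply ENNReal.ofReal_le_ofReal
          have h2 : (k : ℝ) ^ (-(n : ℝ)) ≤ (k : ℝ) ^ (-η - 3) :=
            Real.rpow_le_rpow_of_exponent_le (by linarith) (by linarith)
          have h3 : (k : ℝ) ^ (-η - 3) = 1 / (k : ℝ) ^ η / k ^ 3 := by
            rw [Real.rpow_sub hkR, Real.rpow_neg hkR.le, one_div,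
              ← Real.rpow_natCast (k : ℝ) 3, Nat.cast_ofNat]
          -- The three spare powers of `k` pay for the union bound; this needs `2 ≤ k`.
          have h4 : 2 * ((k : ℝ) + 1) ≤ k ^ 3 := by nlinarith [mul_pos hkR hkR]
          have h5 : 0 < 1 / (k : ℝ) ^ η := by positivity
          rw [h3] at h2
          calc ((k : ℝ) ^ (-(n : ℝ)) + (k : ℝ) ^ (-(n : ℝ))) * (k + 1)
              ≤ (1 / (k : ℝ) ^ η / k ^ 3 + 1 / (k : ℝ) ^ η / k ^ 3) * (k + 1) := by gcongr
            _ = 1 / (k : ℝ) ^ η * ((2 * (k + 1)) / k ^ 3) := by ring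
            _ ≤ 1 / (k : ℝ) ^ η * 1 := by
                gcongr
                rw [div_le_one (by positivity)]
                exact h4
            _ = _ := mul_one _
  -- Covering the whole space requires only subadditivity, not the measurability of `S`.
  have hsub : Set.univ ⊆ S ∪ B := by
    intro ω _
    by_cases hω : ω ∈ B
    · exact .inr hω
    · left
      have hok : ∀ r, ¬ Overdue (2 * (c * k)) (10 + 5 * L + 5 * n) (run q adv ω r).now :=
        fun r hr => hω ⟨r, hr⟩
      refine resolvedWithLatency_of_not_overdue hok ?_
      have h1 := two_pow_clog_le hk0 (5 * n)
      rw [← hL] at h1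
      have h2 : 2 * (c * k) + 2 ^ (10 + 5 * L + 5 * n + 4) + 7 ≤
          (2 * c + 2 ^ (19 + 5 * n) + 7) * k := by nlinarith
      exact_mod_cast h2
  have h1 : (1 : ENNReal) ≤ coinMeasure k S + coinMeasure k B := by
    rw [← measure_univ (μ := coinMeasure k)]
    exact (measure_mono hsub).trans (measure_union_le _ _)
  have h2 : (1 : ENNReal) ≤ ENNReal.ofReal ((coinMeasure k).real S + 1 / (k : ℝ) ^ η) := by
    rw [ENNReal.ofReal_add measureReal_nonneg (by positivity), ofReal_measureReal]
    exact h1.trans (by gcongr)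
  rw [ENNReal.one_le_ofReal] at h2
  linarith

end AdaptiveNoK

theorem theorem6p3 (η : ℝ) (hη : 0 < η) :
    ∃ q : ℝ, 0 < q ∧ ∃ C : ℝ, 0 < C ∧
      ∀ k : ℕ, 1 ≤ k → ∀ adv : AdaptiveNoK.Adversary k,
        1 - 1 / (k : ℝ) ^ η ≤
          (AdaptiveNoK.coinMeasure k).real
            {ω | AdaptiveNoK.ResolvedWithLatency q adv ω (C * k)} := by
  obtain ⟨n, hn⟩ : ∃ n, n = ⌈η⌉₊ + 3 := ⟨_, rfl⟩
  -- This is `(100 * q) ^ 2` for `q = 64 * n`.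
  obtain ⟨c, hc⟩ : ∃ c, c = (6400 * n) ^ 2 := ⟨_, rfl⟩
  have hn0 : 0 < n := by omega
  refine ⟨64 * n, by positivity, (2 * c + 2 ^ (19 + 5 * n) + 7 : ℕ), by positivity, ?_⟩
  intro k hk adv
  rcases Nat.eq_or_lt_of_le hk with rfl | hk2
  -- For `k = 1` the claimed lower bound is `0`.
  · rw [Nat.cast_one, Real.one_rpow, div_one, sub_self]
    exact MeasureTheory.measureReal_nonneg
  · refine AdaptiveNoK.one_sub_le_coinMeasure_resolved hk2 (by omega) ?_ rfl ?_ adv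
    · rw [hn]
      push_cast
      linarith [Nat.le_ceil η]
    · rw [hc]
      push_cast
      ring
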